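/- **Model.** A principal with safe payoff $\theta\in(0,1)$ chooses once, at a time of her choice, between a safe action, which pays $\theta$ to her and $\beta$ to the agent, and a risky action, which pays $\omega\in\{0,1\}$ to both; $\Pr(\omega=1)=\mu$, $0<\beta<\mu<\theta<1$, and the discount rate is $\rho>0$. With probability $\sigma\in(0,1)$ the agent is manipulative. Real news reveals $\omega$ (news of type $\omega$) and arrives, independently of $\omega$ and of the agent's type, at a time with continuous, strictly positive density $g$ on $[0,\infty)$, $\int_0^\infty g\le 1$, distribution function $G$, and strictly decreasing hazard rate $H=g/(1-G)$. A manipulative agent chooses a mixed faking time $F_A$ on $[0,\infty]$, at which a fake arrival of type-1 news is produced if the game has not ended; the principal chooses a mixed stopping time $F_P$ on $[0,\infty]$, at which she takes the safe action if no news has arrived, and the probability $a(t)\in[0,1]$ of the risky action after type-1 news at $t$ (after type-0 news she takes the safe action). Mixed strategies have an absolutely continuous part with density $f_i$ and countably many atoms. The posterior probability of $\omega=1$ after type-1 news at $t$ is $$\mu_1(t)=\frac{\mu g(t)(1-\sigma F_A(t))+\mu\sigma f_A(t)(1-G(t))}{\mu g(t)(1-\sigma F_A(t))+\sigma f_A(t)(1-G(t))}$$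 ($=\mu$ at atoms of $F_A$). In an equilibrium every faking time and every stopping time with positive density or mass maximizes the expected payoff of the respective player, given the other's strategy and $a$, and $a(t)=1$ if $\mu_1(t)>\theta$, $a(t)=0$ if $\mu_1(t)<\theta$, for all $t\ge 0$. An equilibrium has beneficial search if the payoff of the player with the decision authority exceeds her safe payoff. Let $\phi_P(\theta)=\frac{\rho\theta}{\mu(1-\theta)}$, $\phi_A=\frac{\rho\mu}{\beta(1-\mu)}$, and assume $H(0)>\phi_P(\theta)>\lim_{t\to\infty}H(t)$ and $\phi_P(\theta)>\phi_A$. Let $\tau_P(\theta)$ be the principal's optimal search duration when all news is real, i.e. the maximizer over $t\ge0$ of $\int_0^t e^{-\rho s}g(s)(\mu+(1-\mu)\theta)\,ds+e^{-\rho t}(1-G(t))\theta$, and let $$\bar\sigma(\theta)=1-\exp\Big\{-\int_0^{\tau_P(\theta)}\frac{\mu(1-\theta)H(s)-\rho\theta}{\theta-\mu}\,ds\Big\}.$$ Delegation to an intermediary with safe payoff $\theta_I$ means that the intermediary plays the game against the agent in the place of the principal, whose own payoff is $\theta$ whenever the intermediary takes the safe action and $\omega$ whenever it takes the risky one. **Proposition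 (Delegating to an Intermediary).** Suppose $\sigma<\bar\sigma(\theta)$. For all $\theta_I$ in a neighbourhood of $\theta$, the game between the intermediary and the agent has an equilibrium with beneficial search, and the principal's payoff $U(\theta_I\mid\theta)$ is the same in all such equilibria; the function $U(\cdot\mid\theta)$ is differentiable at $\theta$, with $\frac{dU}{d\theta_I}(\theta\mid\theta)<0$. Moreover, there is $\theta_I^*<\theta$ such that for every $\theta_I\in(\theta_I^*,\theta)$ the intermediary satisfies the assumptions made above on $\theta$, $\sigma<\bar\sigma(\theta_I)$, and: 1. an equilibrium with beneficial search between intermediary and agent exists, and in each of them the principal's payoff is strictly higher than in every equilibrium of the game in which she keeps the authority; 2. in each of these equilibria the principal is never tempted to overrule the intermediary's chosen action: at (almost) every time $t\ge0$, in particular at every atom of $F_A$, and whether the search ends at $t$ by type-0 news, type-1 news or without news, the principal, at the posterior belief about $\omega$, strictly prefers each action that the intermediary takes with positive probability. There is such an equilibrium in which this holds at every $t\ge0$. -/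

import Mathlib

open scoped Topology

noncomputable section

/-- A mixed strategy over times in `[0, ∞]`: an absolutely continuous part with density `density`,
atoms `atom t` at finite times `t` (summability makes all but countably many of them zero), and
the remaining mass on the time `∞`. -/
structure MixedTime where
  density : ℝ → ℝ
  atom : ℝ → ℝ
  density_measurable : Measurable density
  density_nonneg : ∀ t, 0 ≤ density t
  density_of_neg : ∀ t, t < 0 → density t = 0
  density_integrable : MeasureTheory.Integrable density
  atom_nonneg : ∀ t, 0 ≤ atom t
  atom_of_neg : ∀ t, t < 0 → atom t = 0
  atom_summable : Summable atom
  total_le_one : (∫ t, density t) + (∑' t, atom t) ≤ 1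

namespace MixedTime

/-- The integral of `h` over the times in `[0, t]` (an atom at `t` included). -/
def integralUpTo (F : MixedTime) (h : ℝ → ℝ) (t : ℝ) : ℝ :=
  (∫ s in (0 : ℝ)..t, h s * F.density s)
    + ∑' s, (Set.Iic t).indicator (fun s => h s * F.atom s) s

/-- The integral of `h` over all finite times. -/
def integral (F : MixedTime) (h : ℝ → ℝ) : ℝ :=
  (∫ s, h s * F.density s) + ∑' s, h s * F.atom s

/-- The cumulative distribution function at finite times. -/
def cdf (F : MixedTime) (t : ℝ) : ℝ := F.integralUpTo (fun _ => 1) t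

/-- The mass on the time `∞`. -/
def massTop (F : MixedTime) : ℝ := 1 - ((∫ t, F.density t) + ∑' t, F.atom t)

/-- The expectation of a payoff with value `u t` at finite `t` and `uTop` at `∞`. -/
def expectation (F : MixedTime) (u : ℝ → ℝ) (uTop : ℝ) : ℝ := F.integral u + F.massTop * uTop

/-- Every time in `[0, ∞]` that carries positive density or positive mass is a best one. -/
def IsOptimal (F : MixedTime) (u : ℝ → ℝ) (uTop : ℝ) : Prop :=
  (∀ t, 0 ≤ t → (0 < F.density t ∨ 0 < F.atom t) →
    (∀ t', 0 ≤ t' → u t' ≤ u t) ∧ uTop ≤ u t) ∧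
  (0 < F.massTop → ∀ t', 0 ≤ t' → u t' ≤ uTop)

end MixedTime

/-- The data of the search game apart from the safe payoff of the player who has the decision
authority: prior `μ` of the good state, discount rate `ρ`, prior probability `σ` of the
manipulative type of agent, safe payoff `β` of the agent, and density `g` on `[0, ∞)` of the
arrival time of real news. Total mass of `g` below one means that real news may never arrive. -/
structure NewsGame where
  μ : ℝ
  ρ : ℝ
  σ : ℝ
  β : ℝ
  g : ℝ → ℝ
  ρ_pos : 0 < ρ
  σ_pos : 0 < σ
  σ_lt_one : σ < 1
  β_pos : 0 < β
  β_lt_μ : β < μ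
  g_continuousOn : ContinuousOn g (Set.Ici 0)
  g_pos : ∀ t, 0 ≤ t → 0 < g t
  g_integrableOn : MeasureTheory.IntegrableOn g (Set.Ioi 0)
  g_total_le_one : ∫ t in Set.Ioi 0, g t ≤ 1
  hazard_strictAntiOn :
    StrictAntiOn (fun t => g t / (1 - ∫ s in (0 : ℝ)..t, g s)) (Set.Ici 0)

/-- A strategy profile: `a t` is the probability of the risky action after type-1 news at `t`,
`FA` the agent's faking time, `FP` the stopping time of the player with the decision authority. -/
structure Profile where
  a : ℝ → ℝ
  a_measurable : Measurable a
  a_nonneg : ∀ t, 0 ≤ a t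
  a_le_one : ∀ t, a t ≤ 1
  FA : MixedTime
  FP : MixedTime

/-- What is observed at the moment of the decision: no news (stopping), type-0 or type-1 news. -/
inductive News where
  | none
  | typeZero
  | typeOne

namespace NewsGame

/-- Distribution function of the arrival time of real news. -/
def G (M : NewsGame) (t : ℝ) : ℝ := ∫ s in (0 : ℝ)..t, M.g s

/-- Hazard rate of real news. -/
def hazard (M : NewsGame) (t : ℝ) : ℝ := M.g t / (1 - M.G t)

def phiP (M : NewsGame) (v : ℝ) : ℝ := M.ρ * v / (M.μ * (1 - v))

def phiA (M : NewsGame) : ℝ := M.ρ * M.μ / (M.β * (1 - M.μ))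

def AssumptionA1 (M : NewsGame) (v : ℝ) : Prop :=
  M.phiP v < M.hazard 0 ∧
    ∃ hTop, Filter.Tendsto M.hazard Filter.atTop (𝓝 hTop) ∧ hTop < M.phiP v

def AssumptionA2 (M : NewsGame) (v : ℝ) : Prop := M.phiA < M.phiP v

/-- The standing assumptions on the safe payoff `v` of the player with the decision authority. -/
def Admissible (M : NewsGame) (v : ℝ) : Prop :=
  M.μ < v ∧ v < 1 ∧ M.AssumptionA1 v ∧ M.AssumptionA2 v

/-- First-best payoff (all news is real) of search duration `t` at safe payoff `v`. -/
def firstBestPayoff (M : NewsGame) (v t : ℝ) : ℝ :=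
  (∫ s in (0 : ℝ)..t, Real.exp (-M.ρ * s) * (M.g s * (M.μ + (1 - M.μ) * v)))
    + Real.exp (-M.ρ * t) * (1 - M.G t) * v

/-- The optimal first-best search duration at safe payoff `v`. -/
def firstBestDuration (M : NewsGame) (v : ℝ) : ℝ :=
  sInf {t | 0 ≤ t ∧ ∀ s, 0 ≤ s → M.firstBestPayoff v s ≤ M.firstBestPayoff v t}

/-- The threshold for the prior probability of the manipulative type. -/
def sigmaBar (M : NewsGame) (v : ℝ) : ℝ :=
  1 - Real.exp (-∫ s in (0 : ℝ)..M.firstBestDuration v,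
    (M.μ * (1 - v) * M.hazard s - M.ρ * v) / (v - M.μ))

/-- Probability that no fake news has been intended at or before `t`. -/
def noFake (M : NewsGame) (e : Profile) (t : ℝ) : ℝ := 1 - M.σ * e.FA.cdf t

/-- Posterior probability of the good state given type-1 news at `t`, by Bayes' rule; at an atom
of the faking time the news is fake with probability one, and the posterior is the prior. -/
def belief (M : NewsGame) (e : Profile) (t : ℝ) : ℝ :=
  open Classical in
  if 0 < e.FA.atom t then M.μ
  else
    (M.μ * M.g t * M.noFake e t + M.μ * M.σ * e.FA.density t * (1 - M.G t)) /
      (M.μ * M.g t * M.noFake e t + M.σ * e.FA.density t * (1 - M.G t))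

/-- Expected payoff, with safe payoff `v`, after type-1 news at `t` when the risky action is then
taken with probability `a t`. -/
def typeOnePayoff (M : NewsGame) (v : ℝ) (e : Profile) (t : ℝ) : ℝ :=
  (1 - e.a t) * v + e.a t * M.belief e t

/-- Flow payoff from real news (of type 0 or type 1), with safe payoff `v`. -/
def realNewsFlow (M : NewsGame) (v : ℝ) (e : Profile) (s : ℝ) : ℝ :=
  Real.exp (-M.ρ * s) *
    ((1 - M.μ) * M.g s * M.noFake e s * v
      + M.μ * M.g s * M.noFake e s * M.typeOnePayoff v e s)

/-- Payoff per unit of faking mass at `s`, with safe payoff `v`. -/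
def fakeNewsFlow (M : NewsGame) (v : ℝ) (e : Profile) (s : ℝ) : ℝ :=
  Real.exp (-M.ρ * s) * (M.σ * (1 - M.G s) * M.typeOnePayoff v e s)

/-- Expected payoff of a player with safe payoff `v` if the search is stopped at `t` with the safe
action unless news arrives before, given the agent's strategy `e.FA` and the response `e.a`. -/
def searchPayoff (M : NewsGame) (v : ℝ) (e : Profile) (t : ℝ) : ℝ :=
  (∫ s in (0 : ℝ)..t, M.realNewsFlow v e s) + e.FA.integralUpTo (M.fakeNewsFlow v e) t
    + Real.exp (-M.ρ * t) * ((1 - M.G t) * M.noFake e t) * v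

/-- The same payoff if the search is never stopped without news. -/
def searchPayoffTop (M : NewsGame) (v : ℝ) (e : Profile) : ℝ :=
  (∫ s in Set.Ioi (0 : ℝ), M.realNewsFlow v e s) + e.FA.integral (M.fakeNewsFlow v e)

/-- Expected payoff of a player with safe payoff `v` under the profile `e`. -/
def payoff (M : NewsGame) (v : ℝ) (e : Profile) : ℝ :=
  e.FP.expectation (M.searchPayoff v e) (M.searchPayoffTop v e)

/-- The agent's flow payoff from real news before the search is stopped. -/
def agentFlow (M : NewsGame) (e : Profile) (s : ℝ) : ℝ :=
  Real.exp (-M.ρ * s) *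
    ((1 - M.μ) * M.g s * (1 - e.FP.cdf s) * M.β
      + M.μ * M.g s * (1 - e.FP.cdf s) * ((1 - e.a s) * M.β + e.a s))

/-- The agent's payoff per unit of stopping mass at `s`. -/
def agentStopFlow (M : NewsGame) (s : ℝ) : ℝ := Real.exp (-M.ρ * s) * ((1 - M.G s) * M.β)

/-- Expected payoff of the manipulative agent from the faking time `t`. -/
def agentPayoff (M : NewsGame) (e : Profile) (t : ℝ) : ℝ :=
  (∫ s in (0 : ℝ)..t, M.agentFlow e s) + e.FP.integralUpTo M.agentStopFlow t
    + Real.exp (-M.ρ * t) * ((1 - M.G t) * (1 - e.FP.cdf t))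
      * ((1 - e.a t) * M.β + M.μ * e.a t)

/-- Expected payoff of the manipulative agent if he never fakes. -/
def agentPayoffTop (M : NewsGame) (e : Profile) : ℝ :=
  (∫ s in Set.Ioi (0 : ℝ), M.agentFlow e s) + e.FP.integral M.agentStopFlow

/-- `e` is an equilibrium of the game between the agent and a player with the decision authority
whose safe payoff is `v`. -/
structure IsEquilibrium (M : NewsGame) (v : ℝ) (e : Profile) : Prop where
  faking_optimal : e.FA.IsOptimal (M.agentPayoff e) (M.agentPayoffTop e)
  risky_of_lt : ∀ t, 0 ≤ t → v < M.belief e t → e.a t = 1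
  safe_of_lt : ∀ t, 0 ≤ t → M.belief e t < v → e.a t = 0
  stopping_optimal : e.FP.IsOptimal (M.searchPayoff v e) (M.searchPayoffTop v e)

/-- An equilibrium in which the player with the decision authority does better than by the
immediate choice of the safe action. -/
def IsBeneficialEquilibrium (M : NewsGame) (v : ℝ) (e : Profile) : Prop :=
  M.IsEquilibrium v e ∧ v < M.payoff v e

/-- Posterior probability of the good state when the search ends at `t`. Arrival times are
independent of the state, so without news the posterior is the prior. -/
def posterior (M : NewsGame) (e : Profile) (t : ℝ) : News → ℝ
  | News.none => M.μ
  | News.typeZero => 0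
  | News.typeOne => M.belief e t

/-- Probability that the risky action is taken when the search ends at `t`. -/
def riskyProb (e : Profile) (t : ℝ) : News → ℝ
  | News.none => 0
  | News.typeZero => 0
  | News.typeOne => e.a t

/-- A player with safe payoff `v` strictly prefers, at her posterior, every action that is taken
with positive probability when the search ends at `t` (for whatever reason it ends). -/
def NoOverrule (M : NewsGame) (v : ℝ) (e : Profile) (t : ℝ) : Prop :=
  ∀ n : News, (0 < riskyProb e t n → v < M.posterior e t n) ∧
    (riskyProb e t n < 1 → M.posterior e t n < v)

end NewsGame

end

/-! Every equilibrium with beneficial search has the same form, up to what does not affect payoffs.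
With safe payoff `v`, let `τ` be the first-best cutoff, where the hazard rate falls to `phiP v`.
There is a time `x < τ` before which nobody fakes or stops. Between `x` and `τ` the searcher is
indifferent about stopping, which forces the agent to fake at the rate `fakeRate v`, and the agent
is indifferent about faking, which forces discounted survival to fall at the rate `survivalRate`.
The search ends at `τ`, and by then the manipulative agent has faked for sure. This fixes `x`
through `∫ s in x..τ, M.fakeRate v s = M.totalFake`, and `σ < sigmaBar v` says exactly that such an
`x > 0` exists.

Two facts about incentives drive the derivation. Past `τ` continued search loses even if all news is
real. Up to `τ` the agent strictly prefers to postpone faking as long as nobody stops and type-1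
news is followed by the risky action; this is the role of `AssumptionA2`. The delicate step is that
type-1 news is always trusted before the end (`a_eq_one_of_lt_end`). The rest follows from the last
and the first optimal stopping times (`end_structure`, `exists_start`) and from two linear integral
equations (`structure_theorem`). Conversely, these rates define an equilibrium
(`isBeneficialEquilibrium_profile`).

Hence the payoff of a principal with safe payoff `θ` is the explicit `delegationPayoff θ v x τ`. As
a function of `v` it has two parts: the gain from search with purely real news up to `x`, and an
integral over `[x, τ]` of `fakeRate θ - fakeRate v`, weighted by `mixingWeight`, which vanishes at
`v = θ`. A smaller `v` makes the intermediary tolerate faster faking. Since the total amount of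
faking is fixed, faking starts later. The principal gains search without fakes, valued at the
discount factor of `x`. She pays with denser fakes later, which are weighted less because of
discounting, stopping and earlier fakes. The two effects involve the same density `newsExcess`, so
the derivative is minus a positive multiple of `∫ (discount x - mixingWeight) * newsExcess`, hence
negative.

Left of `θ` this yields a strict gain over the beneficial equilibria without delegation, and a
fortiori over the others, which pay at most `θ`. The principal does not overrule, because the faking
rate at `θ` leaves a slack `ρ * θ` in her preference for the risky action, uniformly in time, and
this survives small changes of `v`. -/

noncomputable section

open MeasureTheory Set Filter

/-! ### Mixed strategies over times: distribution functions and integration by parts. -/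

namespace MixedTime

variable (F : MixedTime)

/-- The times that carry positive density or positive mass. -/
def Supports (t : ℝ) : Prop := 0 < F.density t ∨ 0 < F.atom t

lemma density_eq_zero_of_not_supports {t : ℝ} (h : ¬ F.Supports t) : F.density t = 0 := by
  unfold Supports at h
  push Not at h
  exact le_antisymm h.1 (F.density_nonneg t)

lemma atom_eq_zero_of_not_supports {t : ℝ} (h : ¬ F.Supports t) : F.atom t = 0 := by
  unfold Supports at h
  push Not at h
  exact le_antisymm h.2 (F.atom_nonneg t)

lemma nonneg_of_supports {t : ℝ} (h : F.Supports t) : 0 ≤ t := by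
  by_contra hn
  rcases h with h | h
  · rw [F.density_of_neg t (not_le.1 hn)] at h; exact lt_irrefl _ h
  · rw [F.atom_of_neg t (not_le.1 hn)] at h; exact lt_irrefl _ h

lemma density_intervalIntegrable (a b : ℝ) : IntervalIntegrable F.density volume a b :=
  F.density_integrable.intervalIntegrable

lemma countable_atoms : F.atom.support.Countable := F.atom_summable.countable_support

lemma ae_atom_eq_zero : ∀ᵐ t, F.atom t = 0 := by
  have := F.countable_atoms.ae_notMem (volume : Measure ℝ)
  filter_upwards [this] with t ht
  simpa using ht

lemma summable_indicator (s : Set ℝ) : Summable (s.indicator F.atom) :=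
  F.atom_summable.indicator s

/-- The cumulative distribution function of the atomic part. -/
def atomCdf (t : ℝ) : ℝ := ∑' s, (Iic t).indicator F.atom s

lemma cdf_eq (t : ℝ) : F.cdf t = (∫ s in (0 : ℝ)..t, F.density s) + F.atomCdf t := by
  simp [cdf, integralUpTo, atomCdf]

lemma atomCdf_mono : Monotone F.atomCdf := by
  intro s t hst
  refine (F.summable_indicator _).tsum_le_tsum (fun r => ?_) (F.summable_indicator _)
  exact indicator_le_indicator_of_subset (Iic_subset_Iic.2 hst) (fun r => F.atom_nonneg r) r

lemma intervalIntegral_density_mono : Monotone fun t => ∫ s in (0 : ℝ)..t, F.density s := by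
  intro s t hst
  have h := intervalIntegral.integral_add_adjacent_intervals
    (F.density_intervalIntegrable 0 s) (F.density_intervalIntegrable s t)
  have h2 : 0 ≤ ∫ r in s..t, F.density r :=
    intervalIntegral.integral_nonneg hst fun r _ => F.density_nonneg r
  simp only
  linarith

lemma cdf_mono : Monotone F.cdf := by
  intro s t hst
  rw [cdf_eq, cdf_eq]
  exact add_le_add (F.intervalIntegral_density_mono hst) (F.atomCdf_mono hst)

lemma cdf_measurable : Measurable F.cdf := F.cdf_mono.measurable

lemma atomCdf_zero : F.atomCdf 0 = F.atom 0 := by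
  unfold atomCdf
  rw [tsum_eq_single 0]
  · simp
  · intro s hs
    by_cases h : s ∈ Iic (0 : ℝ)
    · rw [indicator_of_mem h, F.atom_of_neg s (lt_of_le_of_ne h hs)]
    · rw [indicator_of_notMem h]

lemma cdf_zero : F.cdf 0 = F.atom 0 := by
  rw [cdf_eq, atomCdf_zero]; simp

lemma cdf_nonneg {t : ℝ} (ht : 0 ≤ t) : 0 ≤ F.cdf t :=
  le_trans (by rw [cdf_zero]; exact F.atom_nonneg 0) (F.cdf_mono ht)

lemma intervalIntegral_density_le {t : ℝ} (ht : 0 ≤ t) :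
    ∫ s in (0 : ℝ)..t, F.density s ≤ ∫ s, F.density s := by
  rw [intervalIntegral.integral_of_le ht]
  exact setIntegral_le_integral F.density_integrable (ae_of_all _ F.density_nonneg)

lemma atomCdf_le (t : ℝ) : F.atomCdf t ≤ ∑' s, F.atom s :=
  (F.summable_indicator _).tsum_le_tsum
    (fun r => indicator_le_self' (fun _ _ => F.atom_nonneg _) r) F.atom_summable

lemma cdf_le_total {t : ℝ} (ht : 0 ≤ t) : F.cdf t ≤ 1 - F.massTop := by
  rw [cdf_eq, massTop]
  have := F.intervalIntegral_density_le ht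
  have := F.atomCdf_le t
  linarith

lemma massTop_nonneg : 0 ≤ F.massTop := by
  have := F.total_le_one
  rw [massTop]; linarith

lemma cdf_le_one {t : ℝ} (ht : 0 ≤ t) : F.cdf t ≤ 1 := by
  have := F.cdf_le_total ht
  have := F.massTop_nonneg
  linarith

lemma cdf_eq_of_not_supports {s t : ℝ} (hst : s ≤ t) (h : ∀ r ∈ Ioc s t, ¬ F.Supports r) :
    F.cdf t = F.cdf s := by
  have h1 : ∫ r in s..t, F.density r = 0 := by
    rw [intervalIntegral.integral_congr_ae (g := fun _ => (0 : ℝ))]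
    · simp
    · refine ae_of_all _ fun r hr => F.density_eq_zero_of_not_supports (h r ?_)
      rwa [uIoc_of_le hst] at hr
  have h2 := intervalIntegral.integral_add_adjacent_intervals
    (F.density_intervalIntegrable 0 s) (F.density_intervalIntegrable s t)
  have h3 : F.atomCdf t = F.atomCdf s := by
    unfold atomCdf
    congr 1
    ext r
    by_cases hr : r ≤ s
    · rw [indicator_of_mem (show r ∈ Iic t from hr.trans hst),
        indicator_of_mem (show r ∈ Iic s from hr)]
    · rw [indicator_of_notMem (show r ∉ Iic s from hr)]
      by_cases hr' : r ≤ t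
      · rw [indicator_of_mem (show r ∈ Iic t from hr')]
        exact F.atom_eq_zero_of_not_supports (h r ⟨not_le.1 hr, hr'⟩)
      · rw [indicator_of_notMem (show r ∉ Iic t from hr')]
  rw [cdf_eq, cdf_eq, h3, ← h2, h1, add_zero]

lemma continuous_primitive_density : Continuous fun t => ∫ s in (0 : ℝ)..t, F.density s :=
  intervalIntegral.continuous_primitive (fun a b => F.density_intervalIntegrable a b) 0

lemma atomCdf_tendsto_right (t : ℝ) : Tendsto F.atomCdf (𝓝[>] t) (𝓝 (F.atomCdf t)) := by
  refine tendsto_tsum_of_dominated_convergence F.atom_summable (fun s => ?_) ?_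
  · by_cases hs : s ≤ t
    · refine tendsto_const_nhds.congr' ?_
      filter_upwards [self_mem_nhdsWithin] with r hr
      rw [indicator_of_mem (show s ∈ Iic t from hs),
        indicator_of_mem (show s ∈ Iic r from hs.trans (le_of_lt hr))]
    · refine tendsto_const_nhds.congr' ?_
      have : Iio s ∈ 𝓝[>] t := mem_nhdsWithin_of_mem_nhds (Iio_mem_nhds (not_le.1 hs))
      filter_upwards [this] with r hr
      rw [indicator_of_notMem (show s ∉ Iic t from hs),
        indicator_of_notMem (show s ∉ Iic r from fun h => (not_le.2 (show r < s from hr)) h)]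
  · refine Eventually.of_forall fun r s => ?_
    rw [Real.norm_of_nonneg (indicator_nonneg (fun _ _ => F.atom_nonneg _) _)]
    exact indicator_le_self' (fun _ _ => F.atom_nonneg _) s

lemma cdf_tendsto_right (t : ℝ) : Tendsto F.cdf (𝓝[>] t) (𝓝 (F.cdf t)) := by
  have h : Tendsto (fun r => (∫ s in (0 : ℝ)..r, F.density s) + F.atomCdf r) (𝓝[>] t)
      (𝓝 ((∫ s in (0 : ℝ)..t, F.density s) + F.atomCdf t)) :=
    (F.continuous_primitive_density.continuousAt.tendsto.mono_left nhdsWithin_le_nhds).add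
      (F.atomCdf_tendsto_right t)
  rw [cdf_eq]
  exact h.congr fun r => (F.cdf_eq r).symm

/-- Integration by parts for the absolutely continuous part. -/
lemma intervalIntegral_primitive_mul_density {w : ℝ → ℝ} {T : ℝ}
    (hw : IntervalIntegrable w volume 0 T) (c : ℝ) :
    ∫ s in (0 : ℝ)..T, (c + ∫ r in (0 : ℝ)..s, w r) * F.density s =
      (c + ∫ r in (0 : ℝ)..T, w r) * (∫ r in (0 : ℝ)..T, F.density r)
        - ∫ s in (0 : ℝ)..T, w s * ∫ r in (0 : ℝ)..s, F.density r := by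
  have hf := F.density_intervalIntegrable 0 T
  have hW : AbsolutelyContinuousOnInterval (fun s => ∫ r in (0 : ℝ)..s, w r) 0 T :=
    hw.absolutelyContinuousOnInterval_intervalIntegral (c := 0) (by simp)
  have hD : AbsolutelyContinuousOnInterval (fun s => ∫ r in (0 : ℝ)..s, F.density r) 0 T :=
    hf.absolutelyContinuousOnInterval_intervalIntegral (c := 0) (by simp)
  have h := hW.integral_deriv_mul_eq_sub hD
  have hWc : IntervalIntegrable (fun s => (∫ r in (0 : ℝ)..s, w r) * F.density s) volume 0 T :=
    hf.continuousOn_mul hW.continuousOn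
  have hDc : IntervalIntegrable (fun s => w s * ∫ r in (0 : ℝ)..s, F.density r) volume 0 T :=
    hw.mul_continuousOn hD.continuousOn
  have h2 : ∫ x in (0 : ℝ)..T, deriv (fun s => ∫ r in (0 : ℝ)..s, w r) x
        * (∫ r in (0 : ℝ)..x, F.density r)
        + (∫ r in (0 : ℝ)..x, w r) * deriv (fun s => ∫ r in (0 : ℝ)..s, F.density r) x
      = ∫ x in (0 : ℝ)..T, (w x * (∫ r in (0 : ℝ)..x, F.density r)
        + (∫ r in (0 : ℝ)..x, w r) * F.density x) := by
    refine intervalIntegral.integral_congr_ae ?_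
    filter_upwards [hw.ae_hasDerivAt_integral, hf.ae_hasDerivAt_integral] with x h1 h2 hx
    have hx' := uIoc_subset_uIcc hx
    rw [(h1 hx' 0 (by simp)).deriv, (h2 hx' 0 (by simp)).deriv]
  rw [h2, intervalIntegral.integral_add hDc hWc] at h
  simp_rw [add_mul]
  rw [intervalIntegral.integral_add (hf.const_mul c) hWc, intervalIntegral.integral_const_mul]
  simp only [intervalIntegral.integral_same, mul_zero, sub_zero] at h
  linarith

lemma tsum_eq_tsum_atoms (h : ℝ → ℝ) (h0 : ∀ s, F.atom s = 0 → h s = 0) :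
    ∑' s, h s = ∑' s : F.atom.support, h s := by
  rw [tsum_subtype_eq_of_support_subset]
  intro s hs
  by_contra hn
  exact hs (h0 s (by simpa using hn))

/-- Integration by parts for the atomic part. -/
lemma tsum_primitive_mul_atom {w : ℝ → ℝ} {T : ℝ} (hT : 0 ≤ T)
    (hw : IntervalIntegrable w volume 0 T) (c : ℝ) :
    ∑' s, (Iic T).indicator (fun s => (c + ∫ r in (0 : ℝ)..s, w r) * F.atom s) s =
      (c + ∫ r in (0 : ℝ)..T, w r) * F.atomCdf T - ∫ s in (0 : ℝ)..T, w s * F.atomCdf s := by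
  have : Countable F.atom.support := F.countable_atoms.to_subtype
  have hwi : IntegrableOn w (Ioc 0 T) := (intervalIntegrable_iff_integrableOn_Ioc_of_le hT).1 hw
  -- Sum and integral are exchanged: the integral of `w` from an atom to `T`, summed over the atoms
  -- with their masses, is the integral of `w` times the atomic distribution function. Restricting
  -- to the countable set of atoms makes Fubini for series available.
  set Fs : F.atom.support → ℝ → ℝ := fun i r => F.atom i * (Ici (i : ℝ)).indicator w r with hFs
  have hFi : ∀ i, Integrable (Fs i) (volume.restrict (Ioc 0 T)) := fun i =>
    (Integrable.indicator hwi measurableSet_Ici).const_mul _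
  have hsum : Summable fun i : F.atom.support => F.atom i := F.atom_summable.subtype _
  have hFsum : Summable fun i => ∫ r in Ioc 0 T, ‖Fs i r‖ := by
    refine Summable.of_nonneg_of_le (fun i => integral_nonneg fun r => norm_nonneg _)
      (fun i => ?_) (hsum.mul_right (∫ r in Ioc 0 T, ‖w r‖))
    rw [← integral_const_mul]
    refine integral_mono (hFi i).norm (hwi.norm.const_mul _) fun r => ?_
    simp only [hFs, norm_mul, Real.norm_of_nonneg (F.atom_nonneg i)]
    exact mul_le_mul_of_nonneg_left (norm_indicator_le_norm_self _ _) (F.atom_nonneg _)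
  have h := hasSum_integral_of_summable_integral_norm hFi hFsum
  have hr : ∫ r in Ioc 0 T, (∑' i, Fs i r) = ∫ s in (0 : ℝ)..T, w s * F.atomCdf s := by
    rw [intervalIntegral.integral_of_le hT]
    refine integral_congr_ae (ae_of_all _ fun r => ?_)
    simp only [hFs, atomCdf]
    rw [F.tsum_eq_tsum_atoms ((Iic r).indicator F.atom), ← tsum_mul_left]
    · refine tsum_congr fun i => ?_
      by_cases hi : (i : ℝ) ≤ r
      · rw [indicator_of_mem (show r ∈ Ici (i : ℝ) from hi),
          indicator_of_mem (show (i : ℝ) ∈ Iic r from hi), mul_comm]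
      · rw [indicator_of_notMem (show r ∉ Ici (i : ℝ) from hi),
          indicator_of_notMem (show (i : ℝ) ∉ Iic r from hi)]; simp
    · intro s hs
      by_cases hsr : s ∈ Iic r
      · rw [indicator_of_mem hsr, hs]
      · rw [indicator_of_notMem hsr]
  rw [hr] at h
  have hA : HasSum (fun i : F.atom.support => (c + ∫ r in (0 : ℝ)..T, w r)
      * (Iic T).indicator F.atom i) ((c + ∫ r in (0 : ℝ)..T, w r) * F.atomCdf T) := by
    refine HasSum.mul_left _ ?_
    have h1 : Summable fun i : F.atom.support => (Iic T).indicator F.atom i :=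
      (F.summable_indicator _).subtype _
    have h2 := F.tsum_eq_tsum_atoms ((Iic T).indicator F.atom) (fun s hs => by
      by_cases hsr : s ∈ Iic T
      · rw [indicator_of_mem hsr, hs]
      · rw [indicator_of_notMem hsr])
    rw [atomCdf, h2]
    exact h1.hasSum
  have hS := hA.sub h
  rw [F.tsum_eq_tsum_atoms, ← hS.tsum_eq]
  · refine tsum_congr fun i => ?_
    have hi0 : 0 ≤ (i : ℝ) := by
      by_contra hn
      exact i.2 (F.atom_of_neg _ (not_le.1 hn))
    simp only [hFs]
    rw [integral_const_mul]
    by_cases hi : (i : ℝ) ≤ T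
    · rw [indicator_of_mem (show (i : ℝ) ∈ Iic T from hi),
        indicator_of_mem (show (i : ℝ) ∈ Iic T from hi)]
      have e1 : ∫ r in Ioc 0 T, (Ici (i : ℝ)).indicator w r = ∫ r in (i : ℝ)..T, w r := by
        rw [integral_indicator measurableSet_Ici, Measure.restrict_restrict measurableSet_Ici,
          intervalIntegral.integral_of_le hi]
        refine setIntegral_congr_set ?_
        have hsub : Ioc (i : ℝ) T ⊆ Ici (i : ℝ) ∩ Ioc 0 T := fun r hr =>
          ⟨hr.1.le, lt_of_le_of_lt hi0 hr.1, hr.2⟩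
        have hsub2 : Ici (i : ℝ) ∩ Ioc 0 T ⊆ Icc (i : ℝ) T := fun r hr => ⟨hr.1, hr.2.2⟩
        exact Filter.EventuallyLE.antisymm
          (hsub2.eventuallyLE.trans Ioc_ae_eq_Icc.symm.le) hsub.eventuallyLE
      have e2 := intervalIntegral.integral_add_adjacent_intervals
        (hw.mono_set (c := 0) (d := i) (by
          rw [uIcc_of_le hi0, uIcc_of_le hT]; exact Icc_subset_Icc le_rfl hi))
        (hw.mono_set (c := i) (d := T) (by
          rw [uIcc_of_le hi, uIcc_of_le hT]; exact Icc_subset_Icc hi0 le_rfl))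
      rw [e1, ← e2]
      ring
    · rw [indicator_of_notMem (show (i : ℝ) ∉ Iic T from hi),
        indicator_of_notMem (show (i : ℝ) ∉ Iic T from hi)]
      have e1 : ∫ r in Ioc 0 T, (Ici (i : ℝ)).indicator w r = 0 := by
        rw [setIntegral_eq_zero_of_forall_eq_zero]
        intro r hr
        exact indicator_of_notMem (fun h => hi (le_trans h hr.2)) _
      rw [e1]; ring
  · intro s hs
    by_cases hsr : s ∈ Iic T
    · rw [indicator_of_mem hsr, hs, mul_zero]
    · rw [indicator_of_notMem hsr]

/-- Integration by parts against a mixed strategy. -/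
theorem integralUpTo_primitive {w φ : ℝ → ℝ} {T : ℝ} (hT : 0 ≤ T)
    (hw : IntervalIntegrable w volume 0 T) (c : ℝ)
    (hφ : ∀ s ∈ Icc 0 T, φ s = c + ∫ r in (0 : ℝ)..s, w r) :
    F.integralUpTo φ T = φ T * F.cdf T - ∫ s in (0 : ℝ)..T, w s * F.cdf s := by
  have h1 : ∫ s in (0 : ℝ)..T, φ s * F.density s
      = ∫ s in (0 : ℝ)..T, (c + ∫ r in (0 : ℝ)..s, w r) * F.density s := by
    refine intervalIntegral.integral_congr fun s hs => ?_
    rw [uIcc_of_le hT] at hs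
    simp only [hφ s hs]
  have h2 : (Iic T).indicator (fun s => φ s * F.atom s)
      = (Iic T).indicator (fun s => (c + ∫ r in (0 : ℝ)..s, w r) * F.atom s) := by
    ext s
    by_cases hs : s ∈ Iic T
    · rw [indicator_of_mem hs, indicator_of_mem hs]
      rcases lt_or_ge s 0 with h0 | h0
      · rw [F.atom_of_neg s h0]; simp
      · rw [hφ s ⟨h0, hs⟩]
    · rw [indicator_of_notMem hs, indicator_of_notMem hs]
  have h3 : ∫ s in (0 : ℝ)..T, w s * F.cdf s
      = (∫ s in (0 : ℝ)..T, w s * ∫ r in (0 : ℝ)..s, F.density r)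
        + ∫ s in (0 : ℝ)..T, w s * F.atomCdf s := by
    rw [← intervalIntegral.integral_add]
    · refine intervalIntegral.integral_congr fun s _ => ?_
      simp only [cdf_eq, mul_add]
    · exact hw.mul_continuousOn F.continuous_primitive_density.continuousOn
    · rw [intervalIntegrable_iff_integrableOn_Ioc_of_le hT] at hw ⊢
      refine Integrable.mul_bdd (c := F.atomCdf T) hw
        F.atomCdf_mono.measurable.aestronglyMeasurable ?_
      refine (ae_restrict_mem measurableSet_Ioc).mono fun s hs => ?_
      rw [Real.norm_of_nonneg]
      · exact F.atomCdf_mono hs.2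
      · exact tsum_nonneg fun r => indicator_nonneg (fun _ _ => F.atom_nonneg _) r
  rw [integralUpTo, h1, h2, F.intervalIntegral_primitive_mul_density hw,
    F.tsum_primitive_mul_atom hT hw, h3, hφ T ⟨hT, le_rfl⟩, cdf_eq]
  ring

lemma tendsto_integralUpTo {h : ℝ → ℝ} (h1 : Integrable fun s => h s * F.density s)
    (h2 : Summable fun s => |h s * F.atom s|) :
    Tendsto (F.integralUpTo h) atTop (𝓝 (F.integral h)) := by
  refine Tendsto.add ?_ ?_
  · have h3 := intervalIntegral_tendsto_integral_Ioi (0 : ℝ) h1.integrableOn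
      (tendsto_id (α := ℝ) (x := atTop))
    have h4 : ∫ s in Ioi (0 : ℝ), h s * F.density s = ∫ s, h s * F.density s := by
      rw [← integral_Ici_eq_integral_Ioi]
      refine setIntegral_eq_integral_of_forall_compl_eq_zero fun s hs => ?_
      rw [F.density_of_neg s (not_le.1 hs), mul_zero]
    rw [← h4]
    exact h3
  · refine tendsto_tsum_of_dominated_convergence h2 (fun s => ?_) ?_
    · refine tendsto_const_nhds.congr' ?_
      filter_upwards [eventually_ge_atTop s] with t ht
      rw [indicator_of_mem (show s ∈ Iic t from ht)]
    · exact Eventually.of_forall fun t s => norm_indicator_le_norm_self _ _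

lemma tendsto_cdf : Tendsto F.cdf atTop (𝓝 (1 - F.massTop)) := by
  have h := F.tendsto_integralUpTo (h := fun _ => 1) (by simpa using F.density_integrable)
    (by simpa using F.atom_summable.abs)
  have : F.integral (fun _ => 1) = 1 - F.massTop := by simp [integral, massTop]
  rw [← this]
  exact h

lemma integral_eq_integralUpTo {T : ℝ} (hT : 0 ≤ T) (h0 : ∀ t, T < t → ¬ F.Supports t)
    (h : ℝ → ℝ) : F.integral h = F.integralUpTo h T := by
  unfold integral integralUpTo
  congr 1
  · rw [intervalIntegral.integral_of_le hT, ← integral_Icc_eq_integral_Ioc]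
    refine (setIntegral_eq_integral_of_forall_compl_eq_zero fun s hs => ?_).symm
    rcases lt_or_ge s 0 with hs0 | hs0
    · rw [F.density_of_neg s hs0, mul_zero]
    · rw [F.density_eq_zero_of_not_supports (h0 s (by
        by_contra hn; exact hs ⟨hs0, not_lt.1 hn⟩)), mul_zero]
  · congr 1
    ext s
    by_cases hs : s ∈ Iic T
    · rw [indicator_of_mem hs]
    · rw [indicator_of_notMem hs, F.atom_eq_zero_of_not_supports (h0 s (not_le.1 hs)), mul_zero]

lemma cdf_eq_total {T : ℝ} (hT : 0 ≤ T) (h0 : ∀ t, T < t → ¬ F.Supports t) :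
    F.cdf T = 1 - F.massTop := by
  have := F.integral_eq_integralUpTo hT h0 (fun _ => 1)
  rw [cdf, ← this]
  simp [integral, massTop]

/-- A strategy has a support point or mass at infinity. -/
lemma exists_supports_of_massTop (h : F.massTop < 1) : ∃ t, F.Supports t := by
  by_contra! hn
  have h1 : ∀ t, F.density t = 0 := fun t => F.density_eq_zero_of_not_supports (hn t)
  have h2 : ∀ t, F.atom t = 0 := fun t => F.atom_eq_zero_of_not_supports (hn t)
  simp [massTop, h1, h2] at h

lemma integral_congr_supports {h h' : ℝ → ℝ} (hh : ∀ t, F.Supports t → h t = h' t) :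
    F.integral h = F.integral h' := by
  unfold integral
  have h1 : ∀ t, h t * F.density t = h' t * F.density t := fun t => by
    by_cases ht : F.Supports t
    · rw [hh t ht]
    · rw [F.density_eq_zero_of_not_supports ht, mul_zero, mul_zero]
  have h2 : ∀ t, h t * F.atom t = h' t * F.atom t := fun t => by
    by_cases ht : F.Supports t
    · rw [hh t ht]
    · rw [F.atom_eq_zero_of_not_supports ht, mul_zero, mul_zero]
  simp_rw [h1, h2]

lemma integral_const (c : ℝ) : F.integral (fun _ => c) = c * (1 - F.massTop) := by
  simp only [integral, massTop, MeasureTheory.integral_const_mul, tsum_mul_left]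
  ring

end MixedTime

/-- A function that solves a linear homogeneous integral equation is an exponential. -/
theorem eq_mul_exp_of_integral_equation {c y : ℝ → ℝ} {a b y₀ : ℝ} (hc : Continuous c)
    (hyi : IntervalIntegrable (fun s => c s * y s) volume a b)
    (hy : ∀ t ∈ Icc a b, y t = y₀ - ∫ s in a..t, c s * y s) {t : ℝ} (ht : t ∈ Icc a b) :
    y t = y₀ * Real.exp (-∫ s in a..t, c s) := by
  have hab : a ≤ b := ht.1.trans ht.2
  have hcont : ContinuousOn y (Icc a b) := by
    have h1 : ContinuousOn (fun t => y₀ - ∫ s in a..t, c s * y s) (Icc a b) := by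
      refine continuousOn_const.sub ?_
      have := intervalIntegral.continuousOn_primitive_interval' hyi left_mem_uIcc
      rwa [uIcc_of_le hab] at this
    exact h1.congr hy
  have hC : ∀ t, HasDerivAt (fun t => ∫ s in a..t, c s) (c t) t := fun t =>
    intervalIntegral.integral_hasDerivAt_right (hc.intervalIntegrable _ _)
      (hc.stronglyMeasurableAtFilter _ _) hc.continuousAt
  have hyd : ∀ r ∈ Ioo a b, HasDerivAt y (-(c r * y r)) r := by
    intro r hr
    have hr' : Icc a b ∈ 𝓝 r := Icc_mem_nhds hr.1 hr.2
    have hcy : ContinuousOn (fun s => c s * y s) (Ioo a b) :=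
      hc.continuousOn.mul (hcont.mono Ioo_subset_Icc_self)
    have h1 : HasDerivAt (fun t => ∫ s in a..t, c s * y s) (c r * y r) r := by
      refine intervalIntegral.integral_hasDerivAt_right (hyi.mono_set ?_) ?_ ?_
      · rw [uIcc_of_le hr.1.le, uIcc_of_le hab]; exact Icc_subset_Icc le_rfl hr.2.le
      · exact hcy.stronglyMeasurableAtFilter isOpen_Ioo r hr
      · exact hcy.continuousAt (Ioo_mem_nhds hr.1 hr.2)
    have h2 := (hasDerivAt_const r y₀).sub h1
    rw [zero_sub] at h2
    refine h2.congr_of_eventuallyEq ?_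
    filter_upwards [hr'] with s hs using hy s hs
  rcases eq_or_lt_of_le ht.1 with rfl | hat
  · rw [hy a ht]; simp
  set z : ℝ → ℝ := fun t => y t * Real.exp (∫ s in a..t, c s) with hz
  have hzc : ContinuousOn z (Icc a t) := by
    refine (hcont.mono (Icc_subset_Icc le_rfl ht.2)).mul ?_
    exact (Real.continuous_exp.comp
      (continuous_iff_continuousAt.2 fun t => (hC t).continuousAt)).continuousOn
  obtain ⟨r, hr, hr'⟩ := exists_hasDerivAt_eq_slope z (fun _ => 0) hat hzc (fun r hr => by
    have h := (hyd r ⟨hr.1, hr.2.trans_le ht.2⟩).mul (hC r).exp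
    convert! h using 1
    ring)
  have h3 : z t - z a = 0 := by
    have : t - a ≠ 0 := (sub_pos.2 hat).ne'
    field_simp at hr'
    linarith
  have h4 : z a = y₀ := by simp [hz, hy a ⟨le_rfl, hab⟩]
  have h5 : z t = y₀ := by linarith
  rw [← h5, hz]
  simp only
  rw [mul_assoc, ← Real.exp_add]
  simp

/-! ### Real news: hazard rate and discounting. -/

namespace NewsGame

variable (M : NewsGame)

/-- The hazard rate, continued to negative times by its value at zero. -/
def hazardExt (t : ℝ) : ℝ := M.hazard (max t 0)

/-- Discounted probability that no real news has arrived at `t`. -/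
def discount (t : ℝ) : ℝ := Real.exp (-(M.ρ * t + ∫ s in (0 : ℝ)..t, M.hazardExt s))

lemma μ_pos : 0 < M.μ := M.β_pos.trans M.β_lt_μ

lemma g_intervalIntegrable {a b : ℝ} (ha : 0 ≤ a) (hb : 0 ≤ b) :
    IntervalIntegrable M.g volume a b := by
  refine (M.g_continuousOn.mono ?_).intervalIntegrable
  intro x hx
  exact le_trans (le_min ha hb) hx.1

lemma G_strictMonoOn : StrictMonoOn M.G (Ici 0) := by
  intro s hs t ht hst
  have h1 := intervalIntegral.integral_add_adjacent_intervals
    (M.g_intervalIntegrable le_rfl hs) (M.g_intervalIntegrable hs ht)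
  have h2 : 0 < ∫ r in s..t, M.g r :=
    intervalIntegral.intervalIntegral_pos_of_pos_on (M.g_intervalIntegrable hs ht)
      (fun x hx => M.g_pos x (le_trans hs hx.1.le)) hst
  unfold G
  linarith

lemma G_zero : M.G 0 = 0 := by simp [G]

lemma G_nonneg {t : ℝ} (ht : 0 ≤ t) : 0 ≤ M.G t := by
  rw [← M.G_zero]
  exact M.G_strictMonoOn.monotoneOn (mem_Ici.2 le_rfl) ht ht

/-- The density is positive after `t` as well, so some of a total mass of at most one is still to
come. -/
lemma G_lt_one {t : ℝ} (ht : 0 ≤ t) : M.G t < 1 := by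
  have h1 : M.G t < M.G (t + 1) :=
    M.G_strictMonoOn ht (show (0 : ℝ) ≤ t + 1 by linarith) (by linarith)
  have h2 : M.G (t + 1) ≤ ∫ s in Ioi 0, M.g s := by
    unfold G
    rw [intervalIntegral.integral_of_le (by linarith)]
    refine setIntegral_mono_set M.g_integrableOn ?_ Ioc_subset_Ioi_self.eventuallyLE
    exact (ae_restrict_mem measurableSet_Ioi).mono fun x hx => (M.g_pos x (le_of_lt hx)).le
  linarith [M.g_total_le_one]

lemma G_continuousOn : ContinuousOn M.G (Ici 0) := by
  intro t ht
  have h : ContinuousOn M.G (uIcc 0 (t + 1)) :=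
    intervalIntegral.continuousOn_primitive_interval'
      (M.g_intervalIntegrable le_rfl (by have : (0 : ℝ) ≤ t := ht; linarith)) left_mem_uIcc
  have ht' : (0 : ℝ) ≤ t := ht
  rw [uIcc_of_le (by linarith)] at h
  refine (h t ⟨ht, by linarith⟩).mono_of_mem_nhdsWithin ?_
  filter_upwards [self_mem_nhdsWithin, mem_nhdsWithin_of_mem_nhds (Iio_mem_nhds (lt_add_one t))]
    with s h1 h2 using ⟨h1, le_of_lt h2⟩

lemma hazard_continuousOn : ContinuousOn M.hazard (Ici 0) :=
  M.g_continuousOn.div (continuousOn_const.sub M.G_continuousOn)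
    fun _ ht => (sub_pos.2 (M.G_lt_one ht)).ne'

lemma hazardExt_of_nonneg {t : ℝ} (ht : 0 ≤ t) : M.hazardExt t = M.hazard t := by
  rw [hazardExt, max_eq_left ht]

lemma hazardExt_continuous : Continuous M.hazardExt :=
  M.hazard_continuousOn.comp_continuous (continuous_id.max continuous_const)
    fun t => show (0 : ℝ) ≤ max t 0 from le_max_right _ _

lemma hazardExt_strictAntiOn : StrictAntiOn M.hazardExt (Ici 0) := by
  intro s hs t ht hst
  rw [M.hazardExt_of_nonneg hs, M.hazardExt_of_nonneg ht]
  exact M.hazard_strictAntiOn hs ht hst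

lemma hazardExt_antitone : Antitone M.hazardExt := by
  intro s t hst
  have h := M.hazardExt_strictAntiOn.antitoneOn (show (0 : ℝ) ≤ max s 0 from le_max_right _ _)
    (show (0 : ℝ) ≤ max t 0 from le_max_right _ _) (max_le_max_right 0 hst)
  simpa [hazardExt] using h

lemma hazardExt_pos (t : ℝ) : 0 < M.hazardExt t :=
  div_pos (M.g_pos _ (le_max_right _ _)) (sub_pos.2 (M.G_lt_one (le_max_right _ _)))

lemma hazardExt_mul {t : ℝ} (ht : 0 ≤ t) : M.hazardExt t * (1 - M.G t) = M.g t := by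
  rw [M.hazardExt_of_nonneg ht, hazard, div_mul_cancel₀]
  exact (sub_pos.2 (M.G_lt_one ht)).ne'

/-- The survival function of real news decreases at the rate hazard times itself, and this linear
equation has only the exponential solution. -/
lemma one_sub_G_eq {t : ℝ} (ht : 0 ≤ t) :
    1 - M.G t = Real.exp (-∫ s in (0 : ℝ)..t, M.hazardExt s) := by
  have hcongr : ∀ r, 0 ≤ r → ∀ s ∈ uIcc 0 r, M.hazardExt s * (1 - M.G s) = M.g s := by
    intro r hr s hs
    rw [uIcc_of_le hr] at hs
    exact M.hazardExt_mul hs.1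
  have h := eq_mul_exp_of_integral_equation (c := M.hazardExt) (y := fun t => 1 - M.G t)
    (a := 0) (b := t) (y₀ := 1) M.hazardExt_continuous ?_ ?_ ⟨ht, le_rfl⟩
  · rw [one_mul] at h; exact h
  · refine (M.g_intervalIntegrable le_rfl ht).congr fun s hs => ?_
    exact (hcongr t ht s (uIoc_subset_uIcc hs)).symm
  · intro r hr
    rw [intervalIntegral.integral_congr (hcongr r hr.1)]
    rfl

lemma discount_pos (t : ℝ) : 0 < M.discount t := Real.exp_pos _

lemma discount_zero : M.discount 0 = 1 := by simp [discount]

lemma discount_eq {t : ℝ} (ht : 0 ≤ t) :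
    M.discount t = Real.exp (-M.ρ * t) * (1 - M.G t) := by
  rw [M.one_sub_G_eq ht, ← Real.exp_add, discount]
  congr 1; ring

lemma discount_mul_hazardExt {t : ℝ} (ht : 0 ≤ t) :
    M.discount t * M.hazardExt t = Real.exp (-M.ρ * t) * M.g t := by
  rw [M.discount_eq ht, mul_assoc, mul_comm (1 - M.G t), M.hazardExt_mul ht]

lemma hasDerivAt_discount (t : ℝ) :
    HasDerivAt M.discount (-(M.discount t * (M.ρ + M.hazardExt t))) t := by
  have h1 : HasDerivAt (fun t => ∫ s in (0 : ℝ)..t, M.hazardExt s) (M.hazardExt t) t :=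
    intervalIntegral.integral_hasDerivAt_right (M.hazardExt_continuous.intervalIntegrable _ _)
      (M.hazardExt_continuous.stronglyMeasurableAtFilter _ _) M.hazardExt_continuous.continuousAt
  have h2 := (((hasDerivAt_id t).const_mul M.ρ).add h1).neg.exp
  convert! h2 using 1
  simp only [discount, Pi.neg_apply, Pi.add_apply, id]
  ring

lemma discount_continuous : Continuous M.discount :=
  continuous_iff_continuousAt.2 fun t => (M.hasDerivAt_discount t).continuousAt

lemma discount_sub (s t : ℝ) :
    M.discount t - M.discount s
      = -∫ r in s..t, M.discount r * (M.ρ + M.hazardExt r) := by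
  rw [← intervalIntegral.integral_neg]
  refine (intervalIntegral.integral_eq_sub_of_hasDerivAt
    (fun r _ => M.hasDerivAt_discount r) ?_).symm
  exact ((M.discount_continuous.mul
    (continuous_const.add M.hazardExt_continuous)).neg).intervalIntegrable _ _

lemma discount_strictAnti : StrictAnti M.discount :=
  strictAnti_of_hasDerivAt_neg M.hasDerivAt_discount fun t =>
    neg_neg_of_pos (mul_pos (M.discount_pos t) (add_pos M.ρ_pos (M.hazardExt_pos t)))

lemma discount_le_one {t : ℝ} (ht : 0 ≤ t) : M.discount t ≤ 1 := by
  rw [← M.discount_zero]; exact M.discount_strictAnti.antitone ht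

lemma tendsto_discount : Tendsto M.discount atTop (𝓝 0) := by
  have h1 : Tendsto (fun t => Real.exp (-M.ρ * t)) atTop (𝓝 0) := by
    refine Real.tendsto_exp_atBot.comp ?_
    exact tendsto_id.const_mul_atTop_of_neg (neg_neg_of_pos M.ρ_pos)
  refine squeeze_zero' (Eventually.of_forall fun t => (M.discount_pos t).le) ?_ h1
  filter_upwards [eventually_ge_atTop 0] with t ht
  rw [M.discount_eq ht]
  have := M.G_nonneg ht
  have := Real.exp_pos (-M.ρ * t)
  nlinarith

lemma integrableOn_discount_mul_hazardExt :
    IntegrableOn (fun t => M.discount t * M.hazardExt t) (Ioi 0) := by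
  have h : IntegrableOn (fun t => Real.exp (-M.ρ * t) * M.g t) (Ioi 0) := by
    refine Integrable.bdd_mul (c := 1) M.g_integrableOn (by fun_prop) ?_
    refine (ae_restrict_mem measurableSet_Ioi).mono fun t ht => ?_
    rw [Real.norm_of_nonneg (Real.exp_pos _).le, Real.exp_le_one_iff]
    have : (0 : ℝ) < t := ht
    have := M.ρ_pos
    nlinarith
  refine h.congr_fun (fun t ht => ?_) measurableSet_Ioi
  exact (M.discount_mul_hazardExt (le_of_lt ht)).symm

/-! ### Posterior beliefs and the searcher's payoff as the integral of a flow. -/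

variable (e : Profile)

lemma noFake_le_one {t : ℝ} (ht : 0 ≤ t) : M.noFake e t ≤ 1 := by
  have := mul_nonneg M.σ_pos.le (e.FA.cdf_nonneg ht)
  unfold noFake; linarith

lemma one_sub_σ_le_noFake {t : ℝ} (ht : 0 ≤ t) : 1 - M.σ ≤ M.noFake e t := by
  have := mul_le_mul_of_nonneg_left (e.FA.cdf_le_one ht) M.σ_pos.le
  unfold noFake; linarith

lemma noFake_pos {t : ℝ} (ht : 0 ≤ t) : 0 < M.noFake e t := by
  have := M.one_sub_σ_le_noFake e ht
  have := M.σ_lt_one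
  linarith

lemma noFake_measurable : Measurable (M.noFake e) :=
  measurable_const.sub (e.FA.cdf_measurable.const_mul _)

/-- The posterior belief after type-1 news when the faking time has no atom, in hazard rates. -/
def smoothBelief (t : ℝ) : ℝ :=
  (M.μ * M.hazardExt t * M.noFake e t + M.μ * (M.σ * e.FA.density t)) /
    (M.μ * M.hazardExt t * M.noFake e t + M.σ * e.FA.density t)

/-- Gain from the risky action after type-1 news over the safe payoff `v`, per unit of time
and of the discount factor. -/
def newsGain (v : ℝ) (t : ℝ) : ℝ :=
  M.μ * (1 - v) * M.hazardExt t * M.noFake e t - (v - M.μ) * (M.σ * e.FA.density t)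

lemma newsRate_pos {t : ℝ} (ht : 0 ≤ t) :
    0 < M.μ * M.hazardExt t * M.noFake e t + M.σ * e.FA.density t :=
  add_pos_of_pos_of_nonneg (mul_pos (mul_pos M.μ_pos (M.hazardExt_pos t)) (M.noFake_pos e ht))
    (mul_nonneg M.σ_pos.le (e.FA.density_nonneg t))

lemma belief_of_atom {t : ℝ} (h : 0 < e.FA.atom t) : M.belief e t = M.μ := by
  simp [belief, h]

lemma belief_eq_smoothBelief {t : ℝ} (ht : 0 ≤ t) (h : e.FA.atom t = 0) :
    M.belief e t = M.smoothBelief e t := by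
  have hG : 0 < 1 - M.G t := sub_pos.2 (M.G_lt_one ht)
  rw [belief, if_neg (by rw [h]; exact lt_irrefl _), smoothBelief, ← M.hazardExt_mul ht]
  have e1 : M.μ * (M.hazardExt t * (1 - M.G t)) * M.noFake e t
      + M.μ * M.σ * e.FA.density t * (1 - M.G t)
      = (M.μ * M.hazardExt t * M.noFake e t + M.μ * (M.σ * e.FA.density t)) * (1 - M.G t) := by
    ring
  have e2 : M.μ * (M.hazardExt t * (1 - M.G t)) * M.noFake e t
      + M.σ * e.FA.density t * (1 - M.G t)
      = (M.μ * M.hazardExt t * M.noFake e t + M.σ * e.FA.density t) * (1 - M.G t) := by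
    ring
  rw [e1, e2, mul_div_mul_right _ _ hG.ne']

/-- The arrival rate of type-1 news is positive, so `newsGain` has the sign of the posterior minus
`v`. As `v` is arbitrary, the same identity serves the player with authority and a principal who
only watches. -/
lemma smoothBelief_sub_mul (v : ℝ) {t : ℝ} (ht : 0 ≤ t) :
    (M.smoothBelief e t - v) * (M.μ * M.hazardExt t * M.noFake e t + M.σ * e.FA.density t)
      = M.newsGain e v t := by
  have h := (M.newsRate_pos e ht).ne'
  rw [smoothBelief, sub_mul, div_mul_cancel₀ _ h, newsGain]
  ring

lemma lt_belief_iff (v : ℝ) {t : ℝ} (ht : 0 ≤ t) (h : e.FA.atom t = 0) :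
    v < M.belief e t ↔ 0 < M.newsGain e v t := by
  rw [M.belief_eq_smoothBelief e ht h, ← M.smoothBelief_sub_mul e v ht,
    mul_pos_iff_of_pos_right (M.newsRate_pos e ht), sub_pos]

lemma belief_lt_iff (v : ℝ) {t : ℝ} (ht : 0 ≤ t) (h : e.FA.atom t = 0) :
    M.belief e t < v ↔ M.newsGain e v t < 0 := by
  rw [M.belief_eq_smoothBelief e ht h, ← M.smoothBelief_sub_mul e v ht,
    ← neg_pos, ← neg_mul, mul_pos_iff_of_pos_right (M.newsRate_pos e ht), neg_pos, sub_neg]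

lemma smoothBelief_nonneg {t : ℝ} (ht : 0 ≤ t) : 0 ≤ M.smoothBelief e t := by
  refine div_nonneg ?_ (M.newsRate_pos e ht).le
  have h1 := mul_pos (mul_pos M.μ_pos (M.hazardExt_pos t)) (M.noFake_pos e ht)
  have h2 := mul_nonneg M.μ_pos.le (mul_nonneg M.σ_pos.le (e.FA.density_nonneg t))
  linarith

lemma smoothBelief_le_one (hμ : M.μ < 1) {t : ℝ} (ht : 0 ≤ t) : M.smoothBelief e t ≤ 1 := by
  refine div_le_one_of_le₀ ?_ (M.newsRate_pos e ht).le
  have h2 := mul_nonneg M.σ_pos.le (e.FA.density_nonneg t)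
  nlinarith

lemma smoothBelief_measurable : Measurable (M.smoothBelief e) := by
  have h1 := M.hazardExt_continuous.measurable
  have h2 := M.noFake_measurable e
  have h3 := e.FA.density_measurable
  unfold smoothBelief
  fun_prop

/-- Expected payoff after type-1 news when the faking time has no atom. -/
def smoothPayoff (v : ℝ) (t : ℝ) : ℝ := (1 - e.a t) * v + e.a t * M.smoothBelief e t

lemma smoothPayoff_measurable (v : ℝ) : Measurable (M.smoothPayoff e v) := by
  have h1 := M.smoothBelief_measurable e
  have h2 := e.a_measurable
  unfold smoothPayoff
  fun_prop

lemma abs_mix_le {a v b : ℝ} (h0 : 0 ≤ a) (h1 : a ≤ 1) (hb0 : 0 ≤ b) (hb1 : b ≤ 1) :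
    |(1 - a) * v + a * b| ≤ |v| + 1 := by
  calc |(1 - a) * v + a * b| ≤ |(1 - a) * v| + |a * b| := abs_add_le _ _
    _ = (1 - a) * |v| + a * b := by
      rw [abs_mul, abs_mul, abs_of_nonneg h0, abs_of_nonneg hb0, abs_of_nonneg (sub_nonneg.2 h1)]
    _ ≤ |v| + 1 := by
      have := abs_nonneg v
      nlinarith

lemma abs_smoothPayoff_le (hμ : M.μ < 1) (v : ℝ) {t : ℝ} (ht : 0 ≤ t) :
    |M.smoothPayoff e v t| ≤ |v| + 1 :=
  abs_mix_le (e.a_nonneg t) (e.a_le_one t) (M.smoothBelief_nonneg e ht)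
    (M.smoothBelief_le_one e hμ ht)

lemma abs_typeOnePayoff_le (hμ : M.μ < 1) (v : ℝ) {t : ℝ} (ht : 0 ≤ t) :
    |M.typeOnePayoff v e t| ≤ |v| + 1 := by
  rcases (e.FA.atom_nonneg t).lt_or_eq with h | h
  · refine abs_mix_le (e.a_nonneg t) (e.a_le_one t) ?_ ?_ <;> rw [M.belief_of_atom e h]
    exacts [M.μ_pos.le, hμ.le]
  · refine abs_mix_le (e.a_nonneg t) (e.a_le_one t) ?_ ?_ <;>
      rw [M.belief_eq_smoothBelief e ht h.symm]
    exacts [M.smoothBelief_nonneg e ht, M.smoothBelief_le_one e hμ ht]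

lemma typeOnePayoff_eq_smoothPayoff (v : ℝ) {t : ℝ} (ht : 0 ≤ t) (h : e.FA.atom t = 0) :
    M.typeOnePayoff v e t = M.smoothPayoff e v t := by
  rw [typeOnePayoff, M.belief_eq_smoothBelief e ht h, smoothPayoff]

lemma realNewsFlow_eq (v : ℝ) {t : ℝ} (ht : 0 ≤ t) (h : e.FA.atom t = 0) :
    M.realNewsFlow v e t = ((1 - M.μ) * M.noFake e t * v
      + M.μ * M.noFake e t * M.smoothPayoff e v t) * (M.discount t * M.hazardExt t) := by
  rw [realNewsFlow, M.discount_mul_hazardExt ht, M.typeOnePayoff_eq_smoothPayoff e v ht h]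
  ring

lemma fakeNewsFlow_eq (v : ℝ) {t : ℝ} (ht : 0 ≤ t) (h : e.FA.atom t = 0) :
    M.fakeNewsFlow v e t = M.σ * M.discount t * M.smoothPayoff e v t := by
  rw [fakeNewsFlow, M.discount_eq ht, M.typeOnePayoff_eq_smoothPayoff e v ht h]
  ring

lemma integrableOn_realNewsFlow (hμ : M.μ < 1) (v : ℝ) :
    IntegrableOn (M.realNewsFlow v e) (Ioi 0) := by
  have h1 : IntegrableOn (fun t => ((1 - M.μ) * M.noFake e t * v
      + M.μ * M.noFake e t * M.smoothPayoff e v t) * (M.discount t * M.hazardExt t)) (Ioi 0) := by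
    refine Integrable.bdd_mul (c := |v| + (|v| + 1)) M.integrableOn_discount_mul_hazardExt ?_ ?_
    · have h1 := M.noFake_measurable e
      have h2 := M.smoothPayoff_measurable e v
      exact Measurable.aestronglyMeasurable (by fun_prop)
    · refine (ae_restrict_mem measurableSet_Ioi).mono fun t ht => ?_
      have ht' : (0 : ℝ) ≤ t := le_of_lt ht
      have hN0 := (M.noFake_pos e ht').le
      have hN1 := M.noFake_le_one e ht'
      have hp := M.abs_smoothPayoff_le e hμ v ht'
      have hμ0 := M.μ_pos
      rw [Real.norm_eq_abs]
      refine (abs_add_le _ _).trans (add_le_add ?_ ?_)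
      · rw [abs_mul, abs_of_nonneg (mul_nonneg (by linarith) hN0)]
        refine mul_le_of_le_one_left (abs_nonneg _) ?_
        nlinarith
      · rw [abs_mul, abs_of_nonneg (mul_nonneg hμ0.le hN0)]
        refine (mul_le_of_le_one_left (abs_nonneg _) ?_).trans hp
        nlinarith
  refine h1.congr ?_
  filter_upwards [ae_restrict_mem measurableSet_Ioi,
    ae_restrict_of_ae e.FA.ae_atom_eq_zero] with t ht h0
  exact (M.realNewsFlow_eq e v (le_of_lt ht) h0).symm

lemma integrable_fakeNewsFlow_mul_density (hμ : M.μ < 1) (v : ℝ) :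
    Integrable (fun t => M.fakeNewsFlow v e t * e.FA.density t) := by
  have h1 : Integrable (fun t => ((Ici (0 : ℝ)).indicator
      (fun t => M.σ * M.discount t * M.smoothPayoff e v t) t) * e.FA.density t) := by
    refine Integrable.bdd_mul (c := |v| + 1) e.FA.density_integrable ?_ ?_
    · have h1 := M.discount_continuous.measurable
      have h2 := M.smoothPayoff_measurable e v
      exact (Measurable.indicator (by fun_prop) measurableSet_Ici).aestronglyMeasurable
    · refine ae_of_all _ fun t => ?_
      by_cases ht : t ∈ Ici (0 : ℝ)
      · rw [indicator_of_mem ht, Real.norm_eq_abs, abs_mul,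
          abs_of_nonneg (mul_nonneg M.σ_pos.le (M.discount_pos t).le)]
        refine (mul_le_of_le_one_left (abs_nonneg _) ?_).trans (M.abs_smoothPayoff_le e hμ v ht)
        exact mul_le_one₀ M.σ_lt_one.le (M.discount_pos t).le (M.discount_le_one ht)
      · rw [indicator_of_notMem ht, norm_zero]
        positivity
  refine h1.congr ?_
  filter_upwards [e.FA.ae_atom_eq_zero] with t h0
  by_cases ht : t ∈ Ici (0 : ℝ)
  · rw [indicator_of_mem ht, M.fakeNewsFlow_eq e v ht h0]
  · rw [e.FA.density_of_neg t (not_le.1 ht), mul_zero, mul_zero]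

lemma summable_fakeNewsFlow_mul_atom (hμ : M.μ < 1) (v : ℝ) :
    Summable (fun t => |M.fakeNewsFlow v e t * e.FA.atom t|) := by
  refine Summable.of_nonneg_of_le (fun _ => abs_nonneg _) (fun t => ?_)
    (e.FA.atom_summable.mul_left (|v| + 1))
  rcases lt_or_ge t 0 with ht | ht
  · rw [e.FA.atom_of_neg t ht]; simp
  · rw [abs_mul, abs_of_nonneg (e.FA.atom_nonneg t)]
    refine mul_le_mul_of_nonneg_right ?_ (e.FA.atom_nonneg t)
    have : M.fakeNewsFlow v e t = M.σ * M.discount t * M.typeOnePayoff v e t := by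
      rw [fakeNewsFlow, M.discount_eq ht]; ring
    rw [this, abs_mul, abs_of_nonneg (mul_nonneg M.σ_pos.le (M.discount_pos t).le)]
    refine (mul_le_of_le_one_left (abs_nonneg _) ?_).trans (M.abs_typeOnePayoff_le e hμ v ht)
    exact mul_le_one₀ M.σ_lt_one.le (M.discount_pos t).le (M.discount_le_one ht)

/-- All flows are dominated by integrable ones and the stopping payoff is discounted away. Thus
inequalities between payoffs at finite times carry over to the time `∞`. -/
theorem tendsto_searchPayoff (hμ : M.μ < 1) (v : ℝ) :
    Tendsto (M.searchPayoff v e) atTop (𝓝 (M.searchPayoffTop v e)) := by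
  have h1 := intervalIntegral_tendsto_integral_Ioi (0 : ℝ)
    (M.integrableOn_realNewsFlow e hμ v) (tendsto_id (α := ℝ) (x := atTop))
  have h2 := e.FA.tendsto_integralUpTo (M.integrable_fakeNewsFlow_mul_density e hμ v)
    (M.summable_fakeNewsFlow_mul_atom e hμ v)
  have h3 : Tendsto (fun t => Real.exp (-M.ρ * t) * ((1 - M.G t) * M.noFake e t) * v)
      atTop (𝓝 0) := by
    have h4 := (M.tendsto_discount.mul
      ((e.FA.tendsto_cdf.const_mul M.σ).const_sub 1)).mul_const v
    rw [zero_mul, zero_mul] at h4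
    refine h4.congr' ?_
    filter_upwards [eventually_ge_atTop 0] with t ht
    rw [M.discount_eq ht, noFake]; ring
  have h := (h1.add h2).add h3
  rw [add_zero] at h
  exact h

/-- Interval integrability of a bounded measurable multiple. -/
lemma _root_.IntervalIntegrable.bdd_measurable_mul {m h : ℝ → ℝ} {t C : ℝ} (ht : 0 ≤ t)
    (hh : IntervalIntegrable h volume 0 t) (hm : Measurable m) (hC : ∀ s, 0 ≤ s → |m s| ≤ C) :
    IntervalIntegrable (fun s => m s * h s) volume 0 t := by
  rw [intervalIntegrable_iff_integrableOn_Ioc_of_le ht] at hh ⊢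
  refine Integrable.bdd_mul (c := C) hh hm.aestronglyMeasurable ?_
  exact (ae_restrict_mem measurableSet_Ioc).mono fun s hs => hC s hs.1.le

lemma newsGain_flow_intervalIntegrable (v : ℝ) {t : ℝ} (ht : 0 ≤ t) :
    IntervalIntegrable (fun s => M.discount s * (e.a s * M.newsGain e v s)) volume 0 t := by
  have h1 : IntervalIntegrable (fun s => M.noFake e s * (M.μ * (1 - v) * M.hazardExt s))
      volume 0 t := by
    refine IntervalIntegrable.bdd_measurable_mul ht (C := 1) ?_ (M.noFake_measurable e) ?_
    · exact (continuous_const.mul M.hazardExt_continuous).intervalIntegrable _ _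
    · intro s hs
      rw [abs_of_pos (M.noFake_pos e hs)]; exact M.noFake_le_one e hs
  have h2 : IntervalIntegrable (M.newsGain e v) volume 0 t := by
    refine (h1.sub (((e.FA.density_intervalIntegrable 0 t).const_mul M.σ).const_mul
      (v - M.μ))).congr fun s _ => ?_
    simp only [newsGain]
    ring
  have h3 : IntervalIntegrable (fun s => e.a s * M.newsGain e v s) volume 0 t :=
    h2.bdd_measurable_mul ht e.a_measurable (C := 1) fun s _ => by
      rw [abs_of_nonneg (e.a_nonneg s)]; exact e.a_le_one s
  exact h3.continuousOn_mul M.discount_continuous.continuousOn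

lemma noFake_flow_intervalIntegrable {c : ℝ → ℝ} (hc : Continuous c) {t : ℝ} (ht : 0 ≤ t) :
    IntervalIntegrable (fun s => M.noFake e s * c s) volume 0 t := by
  refine IntervalIntegrable.bdd_measurable_mul ht (C := 1) (hc.intervalIntegrable _ _)
    (M.noFake_measurable e) ?_
  intro s hs
  rw [abs_of_pos (M.noFake_pos e hs)]; exact M.noFake_le_one e hs

/-- The flow of the payoff gain from search over the immediate safe action. -/
def searchFlow (v : ℝ) (s : ℝ) : ℝ :=
  M.discount s * (e.a s * M.newsGain e v s - M.ρ * v * M.noFake e s)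

lemma searchFlow_intervalIntegrable (v : ℝ) {t : ℝ} (ht : 0 ≤ t) :
    IntervalIntegrable (M.searchFlow e v) volume 0 t := by
  refine ((M.newsGain_flow_intervalIntegrable e v ht).sub
    (M.noFake_flow_intervalIntegrable e (c := fun s => M.ρ * v * M.discount s)
      (continuous_const.mul M.discount_continuous) ht)).congr fun s _ => ?_
  simp only [searchFlow]
  ring

lemma integralUpTo_discount (F : MixedTime) {t : ℝ} (ht : 0 ≤ t) :
    F.integralUpTo M.discount t = M.discount t * F.cdf t
      + ∫ s in (0 : ℝ)..t, M.discount s * (M.ρ + M.hazardExt s) * F.cdf s := by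
  have hc : Continuous fun r => -(M.discount r * (M.ρ + M.hazardExt r)) :=
    (M.discount_continuous.mul (continuous_const.add M.hazardExt_continuous)).neg
  rw [F.integralUpTo_primitive ht (hc.intervalIntegrable _ _) 1, sub_eq_add_neg,
    ← intervalIntegral.integral_neg]
  · simp
  · intro s _
    have := M.discount_sub 0 s
    rw [M.discount_zero] at this
    rw [intervalIntegral.integral_neg]; linarith

/-- Relative to the safe payoff `v`, search gains `newsGain` whenever the risky action is taken and
costs the delay of `v`. Atoms of faking are met with the safe action, which pays the same as
stopping. Hence they cause no jump, and the payoff is absolutely continuous in the stopping time. -/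
theorem searchPayoff_eq (hμ : M.μ < 1) (v : ℝ) (ha : ∀ t, 0 ≤ t → 0 < e.FA.atom t → e.a t = 0)
    {t : ℝ} (ht : 0 ≤ t) :
    M.searchPayoff v e t = v + ∫ s in (0 : ℝ)..t, M.searchFlow e v s := by
  have hf := e.FA.density_intervalIntegrable 0 t
  have hr : ∫ s in (0 : ℝ)..t, M.realNewsFlow v e s
      = ∫ s in (0 : ℝ)..t, (M.noFake e s * (v * (M.discount s * M.hazardExt s))
        + e.a s * (M.smoothBelief e s - v) * (M.noFake e s
          * (M.μ * M.discount s * M.hazardExt s))) := by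
    refine intervalIntegral.integral_congr_ae ?_
    filter_upwards [e.FA.ae_atom_eq_zero] with s h0 hs
    rw [uIoc_of_le ht] at hs
    rw [M.realNewsFlow_eq e v hs.1.le h0, smoothPayoff]
    ring
  have hdens : ∫ s in (0 : ℝ)..t, M.fakeNewsFlow v e s * e.FA.density s
      = ∫ s in (0 : ℝ)..t, (M.σ * v * (M.discount s * e.FA.density s)
        + e.a s * (M.smoothBelief e s - v) * (M.discount s * (M.σ * e.FA.density s))) := by
    refine intervalIntegral.integral_congr_ae ?_
    filter_upwards [e.FA.ae_atom_eq_zero] with s h0 hs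
    rw [uIoc_of_le ht] at hs
    rw [M.fakeNewsFlow_eq e v hs.1.le h0, smoothPayoff]
    ring
  -- At an atom the payoff is just `v`, discounted; together with the density part these terms are
  -- integrated by parts through `integralUpTo_discount`.
  have hatom : ∑' s, (Iic t).indicator (fun s => M.fakeNewsFlow v e s * e.FA.atom s) s
      = M.σ * v * ∑' s, (Iic t).indicator (fun s => M.discount s * e.FA.atom s) s := by
    rw [← tsum_mul_left]
    refine tsum_congr fun s => ?_
    by_cases hs : s ∈ Iic t
    · rw [indicator_of_mem hs, indicator_of_mem hs]
      rcases (e.FA.atom_nonneg s).lt_or_eq with h | h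
      · have hs0 : 0 ≤ s := e.FA.nonneg_of_supports (Or.inr h)
        rw [fakeNewsFlow, typeOnePayoff, ha s hs0 h, M.discount_eq hs0]; ring
      · rw [← h]; ring
    · rw [indicator_of_notMem hs, indicator_of_notMem hs, mul_zero]
  have hbm : Measurable fun s => e.a s * (M.smoothBelief e s - v) :=
    e.a_measurable.mul ((M.smoothBelief_measurable e).sub_const v)
  have hbb : ∀ s, 0 ≤ s → |e.a s * (M.smoothBelief e s - v)| ≤ 1 + |v| := by
    intro s hs
    rw [abs_mul, abs_of_nonneg (e.a_nonneg s)]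
    refine (mul_le_of_le_one_left (abs_nonneg _) (e.a_le_one s)).trans ?_
    refine (abs_sub _ _).trans (add_le_add ?_ le_rfl)
    rw [abs_of_nonneg (M.smoothBelief_nonneg e hs)]
    exact M.smoothBelief_le_one e hμ hs
  have i1 := M.noFake_flow_intervalIntegrable e
    (c := fun s => v * (M.discount s * M.hazardExt s))
    (continuous_const.mul (M.discount_continuous.mul M.hazardExt_continuous)) ht
  have i2 := (M.noFake_flow_intervalIntegrable e
    (c := fun s => M.μ * M.discount s * M.hazardExt s)
    ((continuous_const.mul M.discount_continuous).mul M.hazardExt_continuous) ht).bdd_measurable_mul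
      ht hbm hbb
  have i3 : IntervalIntegrable (fun s => M.discount s * e.FA.density s) volume 0 t :=
    hf.continuousOn_mul M.discount_continuous.continuousOn
  have i4 : IntervalIntegrable (fun s => M.discount s * (M.σ * e.FA.density s)) volume 0 t :=
    (hf.const_mul M.σ).continuousOn_mul M.discount_continuous.continuousOn
  have i5 := i4.bdd_measurable_mul ht hbm hbb
  have i6 := M.noFake_flow_intervalIntegrable e
    (c := fun s => v * (M.discount s * (M.ρ + M.hazardExt s)))
    (continuous_const.mul (M.discount_continuous.mul
      (continuous_const.add M.hazardExt_continuous))) ht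
  have i7 : IntervalIntegrable (fun s => v * (M.discount s * (M.ρ + M.hazardExt s))) volume 0 t :=
    (continuous_const.mul (M.discount_continuous.mul
      (continuous_const.add M.hazardExt_continuous))).intervalIntegrable _ _
  have hq := M.integralUpTo_discount e.FA ht
  unfold MixedTime.integralUpTo at hq
  have hcdf : M.σ * v * (∫ s in (0 : ℝ)..t, M.discount s * (M.ρ + M.hazardExt s) * e.FA.cdf s)
      = ∫ s in (0 : ℝ)..t, (v * (M.discount s * (M.ρ + M.hazardExt s))
        - M.noFake e s * (v * (M.discount s * (M.ρ + M.hazardExt s)))) := by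
    rw [← intervalIntegral.integral_const_mul]
    refine intervalIntegral.integral_congr fun s _ => ?_
    simp only [noFake]
    ring
  rw [intervalIntegral.integral_sub i7 i6, intervalIntegral.integral_const_mul] at hcdf
  have hd := M.discount_sub 0 t
  rw [M.discount_zero] at hd
  have hgain : ∫ s in (0 : ℝ)..t, M.searchFlow e v s
      = ((∫ s in (0 : ℝ)..t, M.noFake e s * (v * (M.discount s * M.hazardExt s)))
        + (∫ s in (0 : ℝ)..t, e.a s * (M.smoothBelief e s - v) * (M.noFake e s
          * (M.μ * M.discount s * M.hazardExt s)))
        + ∫ s in (0 : ℝ)..t,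
          e.a s * (M.smoothBelief e s - v) * (M.discount s * (M.σ * e.FA.density s)))
        - ∫ s in (0 : ℝ)..t, M.noFake e s * (v * (M.discount s * (M.ρ + M.hazardExt s))) := by
    rw [← intervalIntegral.integral_add i1 i2, ← intervalIntegral.integral_add (i1.add i2) i5,
      ← intervalIntegral.integral_sub ((i1.add i2).add i5) i6]
    refine intervalIntegral.integral_congr fun s hs => ?_
    rw [uIcc_of_le ht] at hs
    simp only [searchFlow, ← M.smoothBelief_sub_mul e v hs.1]
    ring
  rw [hgain, searchPayoff, MixedTime.integralUpTo, hr, hdens, hatom,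
    intervalIntegral.integral_add i1 i2, intervalIntegral.integral_add (i3.const_mul _) i5,
    intervalIntegral.integral_const_mul, ← mul_assoc (Real.exp _), ← M.discount_eq ht]
  have e1 : M.discount t * M.noFake e t * v
      = v * M.discount t - M.σ * v * (M.discount t * e.FA.cdf t) := by
    rw [noFake]; ring
  linear_combination e1 + hcdf + (M.σ * v) * hq + v * hd

/-! ### The agent's payoff from a faking time. -/

/-- Discounted probability that the search still runs at `t` from the agent's point of view. -/
def survival (t : ℝ) : ℝ := M.discount t * (1 - e.FP.cdf t)

lemma survival_nonneg {t : ℝ} (ht : 0 ≤ t) : 0 ≤ M.survival e t :=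
  mul_nonneg (M.discount_pos t).le (sub_nonneg.2 (e.FP.cdf_le_one ht))

lemma survival_le_discount {t : ℝ} (ht : 0 ≤ t) : M.survival e t ≤ M.discount t :=
  mul_le_of_le_one_right (M.discount_pos t).le (by have := e.FP.cdf_nonneg ht; linarith)

lemma survival_antitoneOn : AntitoneOn (M.survival e) (Ici 0) := by
  intro s hs t ht hst
  have h1 := M.discount_strictAnti.antitone hst
  have h2 := e.FP.cdf_mono hst
  have h3 := e.FP.cdf_le_one (show (0 : ℝ) ≤ t from ht)
  exact mul_le_mul h1 (by linarith) (by linarith) (M.discount_pos s).le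

lemma survival_measurable : Measurable (M.survival e) :=
  M.discount_continuous.measurable.mul (measurable_const.sub e.FP.cdf_measurable)

lemma abs_survival_le_one {t : ℝ} (ht : 0 ≤ t) : |M.survival e t| ≤ 1 := by
  rw [abs_of_nonneg (M.survival_nonneg e ht)]
  exact (M.survival_le_discount e ht).trans (M.discount_le_one ht)

lemma survival_flow_intervalIntegrable {c : ℝ → ℝ} {t : ℝ} (ht : 0 ≤ t)
    (hc : IntervalIntegrable c volume 0 t) :
    IntervalIntegrable (fun s => M.survival e s * c s) volume 0 t :=
  hc.bdd_measurable_mul ht (M.survival_measurable e) fun _ hs => M.abs_survival_le_one e hs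

/-- Growth rate of the agent's payoff from waiting. -/
def waitFlow (s : ℝ) : ℝ :=
  M.survival e s * (M.μ * (1 - M.β) * e.a s * M.hazardExt s - M.ρ * M.β)

lemma waitFlow_intervalIntegrable {t : ℝ} (ht : 0 ≤ t) :
    IntervalIntegrable (M.waitFlow e) volume 0 t := by
  refine M.survival_flow_intervalIntegrable e ht ?_
  have h : IntervalIntegrable (fun s => e.a s * (M.μ * (1 - M.β) * M.hazardExt s)) volume 0 t :=
    IntervalIntegrable.bdd_measurable_mul ht (C := 1)
      ((continuous_const.mul M.hazardExt_continuous).intervalIntegrable _ _) e.a_measurable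
      fun s _ => by rw [abs_of_nonneg (e.a_nonneg s)]; exact e.a_le_one s
  refine (h.sub (intervalIntegrable_const (c := M.ρ * M.β))).congr fun s _ => ?_
  ring

lemma agentFlow_eq {s : ℝ} (hs : 0 ≤ s) :
    M.agentFlow e s = (1 - e.FP.cdf s) * (M.β + M.μ * (1 - M.β) * e.a s)
      * (M.discount s * M.hazardExt s) := by
  rw [agentFlow, M.discount_mul_hazardExt hs]; ring

lemma integrableOn_agentFlow (hμ : M.μ < 1) : IntegrableOn (M.agentFlow e) (Ioi 0) := by
  have h1 : IntegrableOn (fun s => (1 - e.FP.cdf s) * (M.β + M.μ * (1 - M.β) * e.a s)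
      * (M.discount s * M.hazardExt s)) (Ioi 0) := by
    refine Integrable.bdd_mul (c := 2) M.integrableOn_discount_mul_hazardExt ?_ ?_
    · have h1 := e.FP.cdf_measurable
      have h2 := e.a_measurable
      exact Measurable.aestronglyMeasurable (by fun_prop)
    · refine (ae_restrict_mem measurableSet_Ioi).mono fun t ht => ?_
      have ht' : (0 : ℝ) ≤ t := le_of_lt ht
      have h0 := e.FP.cdf_nonneg ht'
      have h1 := e.FP.cdf_le_one ht'
      have ha0 := e.a_nonneg t
      have ha1 := e.a_le_one t
      have hb0 := M.β_pos
      have hb1 := M.β_lt_μ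
      have hm : 0 ≤ M.μ * (1 - M.β) := mul_nonneg M.μ_pos.le (by linarith)
      have hm1 : M.μ * (1 - M.β) ≤ 1 := by nlinarith [M.μ_pos]
      have hx0 : 0 ≤ M.β + M.μ * (1 - M.β) * e.a t := by positivity
      have hx2 : M.β + M.μ * (1 - M.β) * e.a t ≤ 2 := by nlinarith
      rw [Real.norm_eq_abs, abs_of_nonneg (mul_nonneg (by linarith) hx0)]
      nlinarith
  refine h1.congr_fun (fun t ht => ?_) measurableSet_Ioi
  exact (M.agentFlow_eq e (le_of_lt ht)).symm

/-- Every safe action pays `β`, so `β` serves as the baseline. Waiting earns the excess from trusted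
real news and costs the delay of `β`; the fake itself adds the premium `(μ - β) * a t` if the search
still runs. Stopping at `t` itself comes before a fake at `t`, since `survival` subtracts the
distribution function with its atom at `t`. -/
theorem agentPayoff_eq {t : ℝ} (ht : 0 ≤ t) :
    M.agentPayoff e t = M.β + (∫ s in (0 : ℝ)..t, M.waitFlow e s)
      + M.survival e t * ((M.μ - M.β) * e.a t) := by
  have hq := M.integralUpTo_discount e.FP ht
  have hpaid : e.FP.integralUpTo M.agentStopFlow t = M.β * e.FP.integralUpTo M.discount t := by
    unfold MixedTime.integralUpTo
    rw [mul_add, ← tsum_mul_left, ← intervalIntegral.integral_const_mul]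
    congr 1
    · refine intervalIntegral.integral_congr fun s hs => ?_
      rw [uIcc_of_le ht] at hs
      simp only [agentStopFlow, M.discount_eq hs.1]
      ring
    · refine tsum_congr fun s => ?_
      by_cases hs : s ∈ Iic t
      · rw [indicator_of_mem hs, indicator_of_mem hs]
        rcases lt_or_ge s 0 with h | h
        · rw [e.FP.atom_of_neg s h]; ring
        · rw [agentStopFlow, M.discount_eq h]; ring
      · rw [indicator_of_notMem hs, indicator_of_notMem hs, mul_zero]
  have hd := M.discount_sub 0 t
  rw [M.discount_zero] at hd
  have hc : Continuous fun s => M.discount s * (M.ρ + M.hazardExt s) :=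
    M.discount_continuous.mul (continuous_const.add M.hazardExt_continuous)
  have j1 : IntervalIntegrable (fun s => M.discount s * (M.ρ + M.hazardExt s)) volume 0 t :=
    hc.intervalIntegrable _ _
  have j2 : IntervalIntegrable (fun s => M.discount s * (M.ρ + M.hazardExt s) * e.FP.cdf s)
      volume 0 t := by
    refine (j1.bdd_measurable_mul ht e.FP.cdf_measurable (C := 1) fun s hs => ?_).congr
      fun s _ => ?_
    · rw [abs_of_nonneg (e.FP.cdf_nonneg hs)]; exact e.FP.cdf_le_one hs
    · ring
  have hflow : ∫ s in (0 : ℝ)..t, M.agentFlow e s = (∫ s in (0 : ℝ)..t, M.waitFlow e s)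
      + (M.β * (∫ s in (0 : ℝ)..t, M.discount s * (M.ρ + M.hazardExt s))
        - M.β * ∫ s in (0 : ℝ)..t, M.discount s * (M.ρ + M.hazardExt s) * e.FP.cdf s) := by
    rw [← intervalIntegral.integral_const_mul, ← intervalIntegral.integral_const_mul,
      ← intervalIntegral.integral_sub (j1.const_mul _) (j2.const_mul _),
      ← intervalIntegral.integral_add (M.waitFlow_intervalIntegrable e ht)
        ((j1.const_mul _).sub (j2.const_mul _))]
    refine intervalIntegral.integral_congr fun s hs => ?_
    rw [uIcc_of_le ht] at hs
    simp only [M.agentFlow_eq e hs.1, waitFlow, survival]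
    ring
  rw [agentPayoff, hpaid, hq, hflow, ← mul_assoc (Real.exp _), ← M.discount_eq ht, survival]
  linear_combination M.β * hd

theorem tendsto_agentPayoff (hμ : M.μ < 1) :
    Tendsto (M.agentPayoff e) atTop (𝓝 (M.agentPayoffTop e)) := by
  have h1 := intervalIntegral_tendsto_integral_Ioi (0 : ℝ)
    (M.integrableOn_agentFlow e hμ) (tendsto_id (α := ℝ) (x := atTop))
  have hb : ∀ t, 0 ≤ t → M.agentStopFlow t = M.β * M.discount t := fun t ht => by
    rw [agentStopFlow, M.discount_eq ht]; ring
  have h2 : Tendsto (e.FP.integralUpTo M.agentStopFlow) atTop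
      (𝓝 (e.FP.integral M.agentStopFlow)) := by
    refine e.FP.tendsto_integralUpTo ?_ ?_
    · have h1 : Integrable (fun t => ((Ici (0 : ℝ)).indicator
          (fun t => M.β * M.discount t) t) * e.FP.density t) := by
        refine Integrable.bdd_mul (c := M.β) e.FP.density_integrable ?_ ?_
        · exact (Measurable.indicator (M.discount_continuous.measurable.const_mul _)
            measurableSet_Ici).aestronglyMeasurable
        · refine ae_of_all _ fun t => ?_
          by_cases ht : t ∈ Ici (0 : ℝ)
          · rw [indicator_of_mem ht, Real.norm_of_nonneg
              (mul_nonneg M.β_pos.le (M.discount_pos t).le)]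
            exact mul_le_of_le_one_right M.β_pos.le (M.discount_le_one ht)
          · rw [indicator_of_notMem ht, norm_zero]; exact M.β_pos.le
      refine h1.congr (ae_of_all _ fun t => ?_)
      by_cases ht : t ∈ Ici (0 : ℝ)
      · simp only [indicator_of_mem ht, hb t ht]
      · simp only [e.FP.density_of_neg t (not_le.1 ht), mul_zero]
    · refine Summable.of_nonneg_of_le (fun _ => abs_nonneg _) (fun t => ?_)
        (e.FP.atom_summable.mul_left M.β)
      rcases lt_or_ge t 0 with ht | ht
      · rw [e.FP.atom_of_neg t ht]; simp
      · rw [abs_mul, abs_of_nonneg (e.FP.atom_nonneg t), hb t ht,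
          abs_of_nonneg (mul_nonneg M.β_pos.le (M.discount_pos t).le)]
        exact mul_le_mul_of_nonneg_right
          (mul_le_of_le_one_right M.β_pos.le (M.discount_le_one ht)) (e.FP.atom_nonneg t)
  have h3 : Tendsto (fun t => Real.exp (-M.ρ * t) * ((1 - M.G t) * (1 - e.FP.cdf t))
      * ((1 - e.a t) * M.β + M.μ * e.a t)) atTop (𝓝 0) := by
    refine squeeze_zero' ?_ ?_ M.tendsto_discount
    · filter_upwards [eventually_ge_atTop 0] with t ht
      have := M.survival_nonneg e ht
      rw [← mul_assoc, ← M.discount_eq ht]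
      refine mul_nonneg this ?_
      have := e.a_nonneg t
      have := e.a_le_one t
      have := M.β_pos
      have := M.μ_pos
      exact add_nonneg (mul_nonneg (by linarith) (by linarith)) (by positivity)
    · filter_upwards [eventually_ge_atTop 0] with t ht
      rw [← mul_assoc, ← M.discount_eq ht]
      have h0 := M.survival_nonneg e ht
      refine (mul_le_of_le_one_right h0 ?_).trans (M.survival_le_discount e ht)
      have := e.a_nonneg t
      have := e.a_le_one t
      have := M.β_lt_μ
      nlinarith
  have h := (h1.add h2).add h3
  rw [add_zero] at h
  exact h

end NewsGame

/-! ### The first-best cutoff and the schedule of faking. -/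

namespace NewsGame

variable (M : NewsGame)

/-- The rate of fake news, relative to the probability of no fake news so far, at which a player
with safe payoff `v` is indifferent between stopping and continuing to search. -/
def fakeRate (v s : ℝ) : ℝ := (M.μ * (1 - v) * M.hazardExt s - M.ρ * v) / (v - M.μ)

/-- The cumulated rate of fake news when the manipulative agent fakes for sure. -/
def totalFake : ℝ := -Real.log (1 - M.σ)

/-- The time at which the first-best search ends. -/
def IsCutoff (v τ : ℝ) : Prop := 0 < τ ∧ M.hazardExt τ = M.phiP v

/-- The times at which faking starts and ends in an equilibrium with beneficial search. -/
structure IsSchedule (v x τ : ℝ) : Prop where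
  cutoff : M.IsCutoff v τ
  start_pos : 0 < x
  start_lt : x < τ
  integral_fakeRate : ∫ s in x..τ, M.fakeRate v s = M.totalFake

lemma totalFake_pos : 0 < M.totalFake :=
  neg_pos.2 (Real.log_neg (by linarith [M.σ_lt_one]) (by linarith [M.σ_pos]))

lemma exp_neg_totalFake : Real.exp (-M.totalFake) = 1 - M.σ := by
  rw [totalFake, neg_neg, Real.exp_log (by linarith [M.σ_lt_one])]

lemma fakeRate_continuous (v : ℝ) : Continuous (M.fakeRate v) := by
  have := M.hazardExt_continuous
  unfold fakeRate
  fun_prop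

lemma fakeRate_intervalIntegrable (v a b : ℝ) :
    IntervalIntegrable (M.fakeRate v) volume a b :=
  (M.fakeRate_continuous v).intervalIntegrable _ _

variable {M} {v τ : ℝ}

lemma sub_mul_fakeRate (hv : M.μ < v) (s : ℝ) :
    (v - M.μ) * M.fakeRate v s = M.μ * (1 - v) * M.hazardExt s - M.ρ * v := by
  rw [fakeRate, mul_div_cancel₀]
  exact (sub_pos.2 hv).ne'

lemma mul_phiP (hv1 : v < 1) : M.μ * (1 - v) * M.phiP v = M.ρ * v := by
  rw [phiP, mul_div_cancel₀]
  exact (mul_pos M.μ_pos (sub_pos.2 hv1)).ne'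

lemma sub_mul_fakeRate_eq (hv : M.μ < v) (hv1 : v < 1) (s : ℝ) :
    (v - M.μ) * M.fakeRate v s = M.μ * (1 - v) * (M.hazardExt s - M.phiP v) := by
  rw [sub_mul_fakeRate hv, mul_sub (M.μ * (1 - v)), mul_phiP hv1]

lemma fakeRate_pos_iff (hv : M.μ < v) (hv1 : v < 1) (s : ℝ) :
    0 < M.fakeRate v s ↔ M.phiP v < M.hazardExt s := by
  rw [← mul_pos_iff_of_pos_left (sub_pos.2 hv), sub_mul_fakeRate_eq hv hv1,
    mul_pos_iff_of_pos_left (mul_pos M.μ_pos (sub_pos.2 hv1)), sub_pos]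

lemma fakeRate_neg_iff (hv : M.μ < v) (hv1 : v < 1) (s : ℝ) :
    M.fakeRate v s < 0 ↔ M.hazardExt s < M.phiP v := by
  rw [← neg_pos, ← mul_pos_iff_of_pos_left (sub_pos.2 hv), mul_neg, sub_mul_fakeRate_eq hv hv1,
    ← mul_neg, neg_sub, mul_pos_iff_of_pos_left (mul_pos M.μ_pos (sub_pos.2 hv1)), sub_pos]

lemma IsCutoff.fakeRate_pos (h : M.IsCutoff v τ) (hv : M.μ < v) (hv1 : v < 1) {s : ℝ}
    (hs : s < τ) : 0 < M.fakeRate v s := by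
  rw [fakeRate_pos_iff hv hv1, ← h.2]
  have h1 : M.hazardExt s = M.hazardExt (max s 0) := by
    unfold hazardExt; rw [max_eq_left (le_max_right s 0)]
  rw [h1]
  exact M.hazardExt_strictAntiOn (le_max_right s 0) h.1.le (max_lt hs h.1)

lemma IsCutoff.fakeRate_neg (h : M.IsCutoff v τ) (hv : M.μ < v) (hv1 : v < 1) {s : ℝ}
    (hs : τ < s) : M.fakeRate v s < 0 := by
  rw [fakeRate_neg_iff hv hv1, ← h.2]
  exact M.hazardExt_strictAntiOn h.1.le (h.1.le.trans hs.le) hs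

/-- The hazard rate decreases to `phiP v` at the cutoff, and `phiP v` exceeds `phiA`. The inequality
says that postponing a fake pays for the agent when nobody stops and news is trusted: `β * (1 - μ) *
H - ρ * μ` is the net growth rate of his payoff. -/
lemma IsCutoff.lt_hazardExt (h : M.IsCutoff v τ) (hμ : M.μ < 1) (hA : M.AssumptionA2 v) {s : ℝ}
    (hs : s ≤ τ) : M.ρ * M.μ < M.β * (1 - M.μ) * M.hazardExt s := by
  have h1 : M.phiA < M.hazardExt s := by
    have := M.hazardExt_antitone hs
    rw [h.2] at this
    exact lt_of_lt_of_le hA this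
  rw [phiA, div_lt_iff₀ (mul_pos M.β_pos (sub_pos.2 hμ))] at h1
  linarith

lemma Admissible.exists_cutoff (h : M.Admissible v) : ∃ τ, M.IsCutoff v τ := by
  obtain ⟨hv, hv1, ⟨h0, hTop, hlim, hlt⟩, -⟩ := h
  have h1 : ∀ᶠ t in atTop, M.hazard t < M.phiP v := hlim.eventually_lt_const hlt
  obtain ⟨T, hT, hT0⟩ := (h1.and (eventually_gt_atTop 0)).exists
  rw [← M.hazardExt_of_nonneg hT0.le] at hT
  rw [← M.hazardExt_of_nonneg le_rfl] at h0
  obtain ⟨τ, hτ, hτ'⟩ := intermediate_value_Ioo' hT0.le M.hazardExt_continuous.continuousOn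
    ⟨hT, h0⟩
  exact ⟨τ, hτ.1, hτ'⟩

lemma IsCutoff.unique (h : M.IsCutoff v τ) {τ' : ℝ} (h' : M.IsCutoff v τ') : τ = τ' :=
  M.hazardExt_strictAntiOn.injOn (show (0 : ℝ) ≤ τ from h.1.le) (show (0 : ℝ) ≤ τ' from h'.1.le)
    (h.2.trans h'.2.symm)

/-- The fake rate that makes the searcher indifferent is proportional to the gain from search
without fakes. Hence its sign also determines the first-best duration. -/
lemma firstBestPayoff_eq (hv : M.μ < v) {t : ℝ} (ht : 0 ≤ t) :
    M.firstBestPayoff v t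
      = v + ∫ s in (0 : ℝ)..t, M.discount s * ((v - M.μ) * M.fakeRate v s) := by
  have h1 : ∫ s in (0 : ℝ)..t, Real.exp (-M.ρ * s) * (M.g s * (M.μ + (1 - M.μ) * v))
      = ∫ s in (0 : ℝ)..t, (M.discount s * ((v - M.μ) * M.fakeRate v s)
        + v * (M.discount s * (M.ρ + M.hazardExt s))) := by
    refine intervalIntegral.integral_congr fun s hs => ?_
    rw [uIcc_of_le ht] at hs
    have := M.discount_mul_hazardExt hs.1
    simp only [sub_mul_fakeRate hv]
    linear_combination -(M.μ + (1 - M.μ) * v) * this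
  have c1 : Continuous fun s => M.discount s * ((v - M.μ) * M.fakeRate v s) :=
    M.discount_continuous.mul (continuous_const.mul (M.fakeRate_continuous v))
  have c2 : Continuous fun s => v * (M.discount s * (M.ρ + M.hazardExt s)) :=
    continuous_const.mul (M.discount_continuous.mul
      (continuous_const.add M.hazardExt_continuous))
  have hd := M.discount_sub 0 t
  rw [M.discount_zero] at hd
  rw [firstBestPayoff, h1, intervalIntegral.integral_add (c1.intervalIntegrable _ _)
    (c2.intervalIntegrable _ _), intervalIntegral.integral_const_mul, ← M.discount_eq ht]
  linear_combination v * hd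

lemma IsCutoff.firstBestPayoff_lt (h : M.IsCutoff v τ) (hv : M.μ < v) (hv1 : v < 1) {t : ℝ}
    (ht : 0 ≤ t) (hne : t ≠ τ) : M.firstBestPayoff v t < M.firstBestPayoff v τ := by
  have c1 : Continuous fun s => M.discount s * ((v - M.μ) * M.fakeRate v s) :=
    M.discount_continuous.mul (continuous_const.mul (M.fakeRate_continuous v))
  have hv0 : 0 < v - M.μ := sub_pos.2 hv
  rw [firstBestPayoff_eq hv ht, firstBestPayoff_eq hv h.1.le, add_lt_add_iff_left]
  rcases lt_or_gt_of_ne hne with hlt | hlt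
  · rw [← intervalIntegral.integral_add_adjacent_intervals (c1.intervalIntegrable 0 t)
      (c1.intervalIntegrable t τ), lt_add_iff_pos_right]
    refine intervalIntegral.intervalIntegral_pos_of_pos_on (c1.intervalIntegrable _ _)
      (fun s hs => ?_) hlt
    exact mul_pos (M.discount_pos s) (mul_pos hv0 (h.fakeRate_pos hv hv1 hs.2))
  · rw [← intervalIntegral.integral_add_adjacent_intervals (c1.intervalIntegrable 0 τ)
      (c1.intervalIntegrable τ t), add_lt_iff_neg_left, ← neg_pos,
      ← intervalIntegral.integral_neg]
    refine intervalIntegral.intervalIntegral_pos_of_pos_on (c1.neg.intervalIntegrable _ _)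
      (fun s hs => ?_) hlt
    have := h.fakeRate_neg hv hv1 hs.1
    have h2 := mul_pos (M.discount_pos s) (mul_pos hv0 (neg_pos.2 this))
    linarith

lemma IsCutoff.firstBestDuration_eq (h : M.IsCutoff v τ) (hv : M.μ < v) (hv1 : v < 1) :
    M.firstBestDuration v = τ := by
  have : {t | 0 ≤ t ∧ ∀ s, 0 ≤ s → M.firstBestPayoff v s ≤ M.firstBestPayoff v t} = {τ} := by
    ext t
    simp only [mem_ofPred_eq, mem_singleton_iff]
    constructor
    · rintro ⟨h0, h1⟩
      by_contra hne
      exact absurd (h1 τ h.1.le) (not_le.2 (h.firstBestPayoff_lt hv hv1 h0 hne))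
    · rintro rfl
      refine ⟨h.1.le, fun s hs => ?_⟩
      rcases eq_or_ne s t with rfl | hne
      · exact le_rfl
      · exact (h.firstBestPayoff_lt hv hv1 hs hne).le
  rw [firstBestDuration, this, csInf_singleton]

/-- The probability of no fake decays at the rate `fakeRate v` and must reach `1 - σ` at the cutoff.
`sigmaBar` is the prior for which this takes all the time from `0` on; for a smaller one faking
starts later. -/
lemma IsCutoff.lt_sigmaBar_iff (h : M.IsCutoff v τ) (hv : M.μ < v) (hv1 : v < 1) :
    M.σ < M.sigmaBar v ↔ M.totalFake < ∫ s in (0 : ℝ)..τ, M.fakeRate v s := by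
  have h1 : ∫ s in (0 : ℝ)..τ, (M.μ * (1 - v) * M.hazard s - M.ρ * v) / (v - M.μ)
      = ∫ s in (0 : ℝ)..τ, M.fakeRate v s := by
    refine intervalIntegral.integral_congr fun s hs => ?_
    rw [uIcc_of_le h.1.le] at hs
    simp only [fakeRate, M.hazardExt_of_nonneg hs.1]
  have h2 : M.totalFake < (∫ s in (0 : ℝ)..τ, M.fakeRate v s) ↔
      Real.exp (-∫ s in (0 : ℝ)..τ, M.fakeRate v s) < Real.exp (-M.totalFake) := by
    rw [Real.exp_lt_exp, neg_lt_neg_iff]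
  rw [h2, exp_neg_totalFake, sigmaBar, h.firstBestDuration_eq hv hv1, h1]
  constructor <;> intro h <;> linarith

lemma IsCutoff.integral_fakeRate_strictAntiOn (h : M.IsCutoff v τ) (hv : M.μ < v) (hv1 : v < 1) :
    StrictAntiOn (fun x => ∫ s in x..τ, M.fakeRate v s) (Iic τ) := by
  intro x hx y hy hxy
  have h1 := intervalIntegral.integral_add_adjacent_intervals
    (M.fakeRate_intervalIntegrable v x y) (M.fakeRate_intervalIntegrable v y τ)
  have h2 : 0 < ∫ s in x..y, M.fakeRate v s :=
    intervalIntegral.intervalIntegral_pos_of_pos_on (M.fakeRate_intervalIntegrable v _ _)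
      (fun s hs => h.fakeRate_pos hv hv1 (lt_of_lt_of_le hs.2 hy)) hxy
  simp only
  linarith

lemma IsCutoff.exists_schedule (h : M.IsCutoff v τ)
    (hσ : M.totalFake < ∫ s in (0 : ℝ)..τ, M.fakeRate v s) : ∃ x, M.IsSchedule v x τ := by
  have hc : Continuous fun x => ∫ s in x..τ, M.fakeRate v s := by
    have : (fun x => ∫ s in x..τ, M.fakeRate v s) = fun x => -∫ s in τ..x, M.fakeRate v s := by
      ext x; rw [intervalIntegral.integral_symm]
    rw [this]
    exact (intervalIntegral.continuous_primitive (M.fakeRate_intervalIntegrable v) τ).neg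
  obtain ⟨x, hx, hx'⟩ := intermediate_value_Ioo' h.1.le hc.continuousOn
    (show M.totalFake ∈ Ioo _ _ from ⟨by simpa using M.totalFake_pos, hσ⟩)
  exact ⟨x, h, hx.1, hx.2, hx'⟩

lemma IsSchedule.start_unique {x x' : ℝ} (h : M.IsSchedule v x τ) (h' : M.IsSchedule v x' τ)
    (hv : M.μ < v) (hv1 : v < 1) : x = x' :=
  (h.cutoff.integral_fakeRate_strictAntiOn hv hv1).injOn h.start_lt.le h'.start_lt.le
    (h.integral_fakeRate.trans h'.integral_fakeRate.symm)

end NewsGame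

/-- A bounded positive function cannot be dominated by small multiples of its own supremum. -/
theorem not_forall_pos_of_le_sup {x : ℝ → ℝ} {a b B C D : ℝ} (hab : a < b) (hD : 0 < D)
    (hC : 0 ≤ C) (hx : ∀ s ∈ Ico a b, 0 < x s) (hB : ∀ s ∈ Ico a b, x s ≤ B)
    (h : ∀ s ∈ Ico a b, ∀ X, (∀ r ∈ Ico s b, x r ≤ X) → D * x s ≤ C * X * (b - s)) : False := by
  obtain ⟨s', hs', hs'C⟩ : ∃ s' ∈ Ico a b, C * (b - s') ≤ D / 2 := by
    have h1 : Tendsto (fun s => C * (b - s)) (𝓝[<] b) (𝓝 (C * (b - b))) :=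
      (Continuous.tendsto (by fun_prop) b).mono_left nhdsWithin_le_nhds
    rw [sub_self, mul_zero] at h1
    have h2 := h1.eventually_lt_const (half_pos hD)
    obtain ⟨s, hs, hs'⟩ := (h2.and (Ico_mem_nhdsLT hab)).exists
    exact ⟨s, hs', hs.le⟩
  have hsub : ∀ s ∈ Ico s' b, s ∈ Ico a b := fun s hs => ⟨hs'.1.trans hs.1, hs.2⟩
  set X := sSup (x '' Ico s' b) with hX
  have hbdd : BddAbove (x '' Ico s' b) := by
    refine ⟨B, ?_⟩
    rintro _ ⟨s, hs, rfl⟩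
    exact hB s (hsub s hs)
  have hle : ∀ s ∈ Ico s' b, x s ≤ X := fun s hs => le_csSup hbdd ⟨s, hs, rfl⟩
  have hmem : s' ∈ Ico s' b := ⟨le_rfl, hs'.2⟩
  have hX0 : 0 < X := (hx s' hs').trans_le (hle s' hmem)
  have hhalf : X ≤ X / 2 := by
    refine csSup_le ⟨_, s', hmem, rfl⟩ ?_
    rintro _ ⟨s, hs, rfl⟩
    have h1 := h s (hsub s hs) X fun r hr => hle r ⟨hs.1.trans hr.1, hr.2⟩
    have h2 : C * (b - s) ≤ D / 2 :=
      (mul_le_mul_of_nonneg_left (by linarith [hs.1]) hC).trans hs'C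
    have h3 : D * x s ≤ D / 2 * X := by
      calc D * x s ≤ C * X * (b - s) := h1
        _ = C * (b - s) * X := by ring
        _ ≤ D / 2 * X := mul_le_mul_of_nonneg_right h2 hX0.le
    have h4 : D * x s ≤ D * (X / 2) := by linarith
    exact le_of_mul_le_mul_left h4 hD
  linarith

/-! ### Necessary conditions: trust in type-1 news and the end of the search. -/

namespace NewsGame

variable {M : NewsGame} {v τ : ℝ} {e : Profile}

namespace IsEquilibrium

variable (he : M.IsEquilibrium v e)

lemma a_of_atom (he : M.IsEquilibrium v e) (hv : M.μ < v) {t : ℝ} (ht : 0 ≤ t)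
    (h : 0 < e.FA.atom t) : e.a t = 0 :=
  he.safe_of_lt t ht (by rwa [M.belief_of_atom e h])

/-- A response short of certain risk is optimal only if the posterior is at most `v`: then either
the gain is zero or the risky action is not taken. At an atom the posterior is `μ < v`. -/
lemma a_mul_newsGain_of_lt_one (he : M.IsEquilibrium v e) (hv : M.μ < v) {t : ℝ} (ht : 0 ≤ t)
    (h : e.a t < 1) : e.a t * M.newsGain e v t = 0 := by
  rcases (e.FA.atom_nonneg t).lt_or_eq with h0 | h0
  · rw [he.a_of_atom hv ht h0, zero_mul]
  · rcases lt_trichotomy (M.newsGain e v t) 0 with h1 | h1 | h1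
    · rw [he.safe_of_lt t ht ((M.belief_lt_iff e v ht h0.symm).2 h1), zero_mul]
    · rw [h1, mul_zero]
    · exact absurd (he.risky_of_lt t ht ((M.lt_belief_iff e v ht h0.symm).2 h1)) h.ne

/-- Type-1 news at a time without faking is real, so it proves the good state. Consequently,
distrust at a time reveals that the agent fakes there, hence that this time is optimal for him. -/
lemma a_eq_one (he : M.IsEquilibrium v e) (hv1 : v < 1) {t : ℝ} (ht : 0 ≤ t)
    (h : ¬ e.FA.Supports t) : e.a t = 1 := by
  refine he.risky_of_lt t ht ?_
  rw [M.lt_belief_iff e v ht (e.FA.atom_eq_zero_of_not_supports h), newsGain,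
    e.FA.density_eq_zero_of_not_supports h, mul_zero, mul_zero, sub_zero]
  exact mul_pos (mul_pos (mul_pos M.μ_pos (sub_pos.2 hv1)) (M.hazardExt_pos t))
    (M.noFake_pos e ht)

lemma supports_of_a_lt_one (he : M.IsEquilibrium v e) (hv1 : v < 1) {t : ℝ} (ht : 0 ≤ t)
    (h : e.a t < 1) : e.FA.Supports t := by
  by_contra hn
  exact h.ne (he.a_eq_one hv1 ht hn)

lemma agentPayoff_le (he : M.IsEquilibrium v e) {s t : ℝ} (h : e.FA.Supports t) (hs : 0 ≤ s) :
    M.agentPayoff e s ≤ M.agentPayoff e t :=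
  (he.faking_optimal.1 t (e.FA.nonneg_of_supports h) h).1 s hs

end IsEquilibrium

lemma a_mul_newsGain_le (hv : M.μ < v) (hv1 : v < 1) {t : ℝ} (ht : 0 ≤ t) :
    e.a t * M.newsGain e v t ≤ M.μ * (1 - v) * M.hazardExt t * M.noFake e t := by
  have h1 : 0 ≤ M.μ * (1 - v) * M.hazardExt t * M.noFake e t :=
    (mul_pos (mul_pos (mul_pos M.μ_pos (sub_pos.2 hv1)) (M.hazardExt_pos t))
      (M.noFake_pos e ht)).le
  have h2 : 0 ≤ (v - M.μ) * (M.σ * e.FA.density t) :=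
    mul_nonneg (sub_pos.2 hv).le (mul_nonneg M.σ_pos.le (e.FA.density_nonneg t))
  have h3 : e.a t * M.newsGain e v t ≤ e.a t * (M.μ * (1 - v) * M.hazardExt t * M.noFake e t) :=
    mul_le_mul_of_nonneg_left (by unfold newsGain; linarith) (e.a_nonneg t)
  exact h3.trans (mul_le_of_le_one_left h1 (e.a_le_one t))

/-- Fakes only reduce the gain from news, so the flow is at most its first-best value, scaled by the
probability of no fake. Past the cutoff it is therefore negative for any strategies. -/
lemma searchFlow_le (hv : M.μ < v) (hv1 : v < 1) {t : ℝ} (ht : 0 ≤ t) :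
    M.searchFlow e v t ≤ M.discount t * ((v - M.μ) * M.fakeRate v t * M.noFake e t) := by
  rw [searchFlow, sub_mul_fakeRate hv]
  refine mul_le_mul_of_nonneg_left ?_ (M.discount_pos t).le
  have := a_mul_newsGain_le (e := e) hv hv1 ht
  linarith

lemma searchFlow_of_a_eq_one (hv : M.μ < v) {t : ℝ} (h : e.a t = 1) :
    M.searchFlow e v t = M.discount t * ((v - M.μ) *
      (M.fakeRate v t * M.noFake e t - M.σ * e.FA.density t)) := by
  have h1 := sub_mul_fakeRate hv t
  rw [searchFlow, h, newsGain]
  linear_combination -(M.discount t * M.noFake e t) * h1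

lemma searchFlow_integrable (M : NewsGame) (e : Profile) (v : ℝ) {s t : ℝ}
    (hs : 0 ≤ s) (ht : 0 ≤ t) :
    IntervalIntegrable (M.searchFlow e v) volume s t :=
  (M.searchFlow_intervalIntegrable e v hs).symm.trans (M.searchFlow_intervalIntegrable e v ht)

lemma waitFlow_ge (M : NewsGame) (e : Profile) (hμ : M.μ < 1) {s : ℝ}
    (hs : 0 ≤ s) : -(M.ρ * M.β) ≤ M.waitFlow e s := by
  have h0 := M.survival_nonneg e hs
  have h1 := M.abs_survival_le_one e hs
  rw [abs_of_nonneg h0] at h1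
  have hb : 0 < 1 - M.β := by linarith [M.β_lt_μ]
  have h2 : 0 ≤ M.μ * (1 - M.β) * e.a s * M.hazardExt s :=
    mul_nonneg (mul_nonneg (mul_nonneg M.μ_pos.le hb.le) (e.a_nonneg s)) (M.hazardExt_pos s).le
  have h3 : 0 < M.ρ * M.β := mul_pos M.ρ_pos M.β_pos
  unfold waitFlow
  nlinarith [mul_nonneg h0 h2]

lemma agentPayoff_sub (M : NewsGame) (e : Profile) {s t : ℝ} (hs : 0 ≤ s)
    (ht : 0 ≤ t) : M.agentPayoff e t - M.agentPayoff e s = (∫ r in s..t, M.waitFlow e r)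
      + (M.μ - M.β) * (M.survival e t * e.a t - M.survival e s * e.a s) := by
  rw [M.agentPayoff_eq e hs, M.agentPayoff_eq e ht,
    ← intervalIntegral.integral_add_adjacent_intervals (M.waitFlow_intervalIntegrable e hs)
      ((M.waitFlow_intervalIntegrable e hs).symm.trans (M.waitFlow_intervalIntegrable e ht))]
  ring

lemma waitFlow_integrable (M : NewsGame) (e : Profile) {s t : ℝ} (hs : 0 ≤ s)
    (ht : 0 ≤ t) : IntervalIntegrable (M.waitFlow e) volume s t :=
  (M.waitFlow_intervalIntegrable e hs).symm.trans (M.waitFlow_intervalIntegrable e ht)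

lemma survival_tendsto_right (M : NewsGame) (e : Profile) (s : ℝ) :
    Tendsto (M.survival e) (𝓝[>] s) (𝓝 (M.survival e s)) :=
  (M.discount_continuous.continuousAt.tendsto.mono_left nhdsWithin_le_nhds).mul
    ((e.FP.cdf_tendsto_right s).const_sub 1)

lemma agentPayoff_of_end (M : NewsGame) {e : Profile} {T : ℝ} (hT : 0 ≤ T)
    (hc : e.FP.cdf T = 1) {t : ℝ} (ht : T ≤ t) :
    M.agentPayoff e t = M.β + ∫ s in (0 : ℝ)..T, M.waitFlow e s := by
  have hs : ∀ r, T ≤ r → M.survival e r = 0 := fun r hr => by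
    have h1 := e.FP.cdf_mono hr
    rw [hc] at h1
    rw [survival, le_antisymm (e.FP.cdf_le_one (hT.trans hr)) h1, sub_self, mul_zero]
  have h0 : ∫ r in T..t, M.waitFlow e r = 0 := by
    have : ∫ r in T..t, M.waitFlow e r = ∫ r in T..t, (0 : ℝ) := by
      refine intervalIntegral.integral_congr fun r hr => ?_
      rw [uIcc_of_le ht] at hr
      simp only [waitFlow, hs r hr.1, zero_mul]
    rw [this, intervalIntegral.integral_zero]
  rw [M.agentPayoff_eq e (hT.trans ht), hs t ht, zero_mul, add_zero,
    ← intervalIntegral.integral_add_adjacent_intervals (M.waitFlow_intervalIntegrable e hT)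
      (M.waitFlow_integrable e hT (hT.trans ht)), h0, add_zero]

lemma agentPayoffTop_of_end (M : NewsGame) {e : Profile} (hμ : M.μ < 1) {T : ℝ}
    (hT : 0 ≤ T) (hc : e.FP.cdf T = 1) :
    M.agentPayoffTop e = M.β + ∫ s in (0 : ℝ)..T, M.waitFlow e s := by
  refine tendsto_nhds_unique (M.tendsto_agentPayoff e hμ) (tendsto_const_nhds.congr' ?_)
  filter_upwards [eventually_ge_atTop T] with t ht
  exact (M.agentPayoff_of_end hT hc ht).symm

/-- An equilibrium with beneficial search together with the cutoff of the first-best search. -/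
structure IsSearchEquilibrium (M : NewsGame) (v τ : ℝ) (e : Profile) : Prop where
  eq : M.IsEquilibrium v e
  lt_payoff : v < M.payoff v e
  cutoff : M.IsCutoff v τ
  μ_lt : M.μ < v
  lt_one : v < 1
  assumptionA2 : M.AssumptionA2 v

namespace IsSearchEquilibrium

variable (S : M.IsSearchEquilibrium v τ e)
include S

lemma μ_lt_one : M.μ < 1 := S.μ_lt.trans S.lt_one

lemma v_pos : 0 < v := M.μ_pos.trans S.μ_lt

lemma searchPayoff_eq {t : ℝ} (ht : 0 ≤ t) :
    M.searchPayoff v e t = v + ∫ s in (0 : ℝ)..t, M.searchFlow e v s :=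
  M.searchPayoff_eq e S.μ_lt_one v (fun _ ht h => S.eq.a_of_atom S.μ_lt ht h) ht

lemma searchPayoff_sub {s t : ℝ} (hs : 0 ≤ s) (ht : 0 ≤ t) :
    M.searchPayoff v e t - M.searchPayoff v e s = ∫ r in s..t, M.searchFlow e v r := by
  rw [S.searchPayoff_eq hs, S.searchPayoff_eq ht,
    ← intervalIntegral.integral_add_adjacent_intervals (M.searchFlow_integrable e v le_rfl hs)
      (M.searchFlow_integrable e v hs ht)]
  ring

lemma searchPayoff_zero : M.searchPayoff v e 0 = v := by
  rw [S.searchPayoff_eq le_rfl, intervalIntegral.integral_same, add_zero]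

lemma searchPayoff_continuousOn : ContinuousOn (M.searchPayoff v e) (Ici 0) := by
  intro t ht
  have ht' : (0 : ℝ) ≤ t := ht
  have h : ContinuousOn (fun t => v + ∫ s in (0 : ℝ)..t, M.searchFlow e v s) (uIcc 0 (t + 1)) :=
    continuousOn_const.add (intervalIntegral.continuousOn_primitive_interval'
      (M.searchFlow_intervalIntegrable e v (by linarith)) left_mem_uIcc)
  rw [uIcc_of_le (by linarith)] at h
  have h2 : ContinuousOn (M.searchPayoff v e) (Icc 0 (t + 1)) :=
    h.congr fun s hs => S.searchPayoff_eq hs.1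
  refine (h2 t ⟨ht, by linarith⟩).mono_of_mem_nhdsWithin ?_
  filter_upwards [self_mem_nhdsWithin, mem_nhdsWithin_of_mem_nhds (Iio_mem_nhds (lt_add_one t))]
    with s h1 h2 using ⟨h1, le_of_lt h2⟩

lemma searchPayoff_lt_of_flow_neg {s t : ℝ} (hs : 0 ≤ s) (hst : s < t)
    (h : ∀ r ∈ Ioo s t, M.searchFlow e v r < 0) :
    M.searchPayoff v e t < M.searchPayoff v e s := by
  have h1 := S.searchPayoff_sub hs (hs.trans hst.le)
  have h2 : 0 < ∫ r in s..t, -M.searchFlow e v r :=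
    intervalIntegral.intervalIntegral_pos_of_pos_on
      (M.searchFlow_integrable e v hs (hs.trans hst.le)).neg (fun r hr => neg_pos.2 (h r hr)) hst
  rw [intervalIntegral.integral_neg] at h2
  linarith

lemma searchPayoff_lt_of_flow_pos {s t : ℝ} (hs : 0 ≤ s) (hst : s < t)
    (h : ∀ r ∈ Ioo s t, 0 < M.searchFlow e v r) :
    M.searchPayoff v e s < M.searchPayoff v e t := by
  have h1 := S.searchPayoff_sub hs (hs.trans hst.le)
  have h2 : 0 < ∫ r in s..t, M.searchFlow e v r :=
    intervalIntegral.intervalIntegral_pos_of_pos_on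
      (M.searchFlow_integrable e v hs (hs.trans hst.le)) h hst
  linarith

lemma searchPayoff_lt_of_cutoff_le {s t : ℝ} (hs : τ ≤ s) (hst : s < t) :
    M.searchPayoff v e t < M.searchPayoff v e s := by
  have h0 := S.cutoff.1
  refine S.searchPayoff_lt_of_flow_neg (h0.le.trans hs) hst fun r hr => ?_
  have hr0 : 0 ≤ r := (h0.le.trans hs).trans hr.1.le
  refine (searchFlow_le S.μ_lt S.lt_one hr0).trans_lt ?_
  refine mul_neg_of_pos_of_neg (M.discount_pos r) (mul_neg_of_neg_of_pos ?_ (M.noFake_pos e hr0))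
  exact mul_neg_of_pos_of_neg (sub_pos.2 S.μ_lt)
    (S.cutoff.fakeRate_neg S.μ_lt S.lt_one (hs.trans_lt hr.1))

lemma searchPayoffTop_lt : M.searchPayoffTop v e < M.searchPayoff v e τ := by
  refine lt_of_le_of_lt ?_ (S.searchPayoff_lt_of_cutoff_le le_rfl (lt_add_one τ))
  refine le_of_tendsto (M.tendsto_searchPayoff e S.μ_lt_one v) ?_
  filter_upwards [eventually_gt_atTop (τ + 1)] with t ht
  exact (S.searchPayoff_lt_of_cutoff_le (by linarith) ht).le

lemma massTop_FP : e.FP.massTop = 0 := by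
  refine le_antisymm (not_lt.1 fun h => ?_) e.FP.massTop_nonneg
  exact absurd (S.eq.stopping_optimal.2 h τ S.cutoff.1.le) (not_le.2 S.searchPayoffTop_lt)

lemma searchPayoff_of_supports {t : ℝ} (h : e.FP.Supports t) :
    M.searchPayoff v e t = M.payoff v e := by
  have h1 : ∀ s, e.FP.Supports s → M.searchPayoff v e s = M.searchPayoff v e t := fun s hs =>
    le_antisymm ((S.eq.stopping_optimal.1 t (e.FP.nonneg_of_supports h) h).1 s
      (e.FP.nonneg_of_supports hs))
      ((S.eq.stopping_optimal.1 s (e.FP.nonneg_of_supports hs) hs).1 t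
        (e.FP.nonneg_of_supports h))
  rw [payoff, MixedTime.expectation, e.FP.integral_congr_supports h1, e.FP.integral_const,
    S.massTop_FP]
  ring

lemma searchPayoff_le {t : ℝ} (ht : 0 ≤ t) : M.searchPayoff v e t ≤ M.payoff v e := by
  obtain ⟨s, hs⟩ := e.FP.exists_supports_of_massTop (by rw [S.massTop_FP]; exact zero_lt_one)
  rw [← S.searchPayoff_of_supports hs]
  exact (S.eq.stopping_optimal.1 s (e.FP.nonneg_of_supports hs) hs).1 t ht

lemma not_supports_FP_of_lt {t : ℝ} (h : M.searchPayoff v e t < M.payoff v e) :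
    ¬ e.FP.Supports t := fun hs => h.ne (S.searchPayoff_of_supports hs)

lemma not_supports_FP_of_cutoff_lt {t : ℝ} (ht : τ < t) : ¬ e.FP.Supports t :=
  S.not_supports_FP_of_lt
    ((S.searchPayoff_lt_of_cutoff_le le_rfl ht).trans_le (S.searchPayoff_le S.cutoff.1.le))

lemma cdf_FP_cutoff : e.FP.cdf τ = 1 := by
  rw [e.FP.cdf_eq_total S.cutoff.1.le fun t ht => S.not_supports_FP_of_cutoff_lt ht,
    S.massTop_FP, sub_zero]

lemma eventually_searchPayoff_lt {t : ℝ} (ht : 0 ≤ t)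
    (h : M.searchPayoff v e t < M.payoff v e) :
    ∃ δ > 0, ∀ s, 0 ≤ s → |s - t| < δ → M.searchPayoff v e s < M.payoff v e := by
  have h1 := (S.searchPayoff_continuousOn t ht).eventually_lt_const h
  obtain ⟨δ, hδ, h2⟩ := Metric.mem_nhdsWithin_iff.1 h1
  exact ⟨δ, hδ, fun s hs hst => h2 ⟨by rwa [Metric.mem_ball, Real.dist_eq], hs⟩⟩

/-- The time at which the search has ended for sure. -/
lemma exists_end : ∃ T, 0 < T ∧ T ≤ τ ∧ e.FP.cdf T = 1 ∧
    (∀ t, 0 ≤ t → t < T → e.FP.cdf t < 1) ∧ M.searchPayoff v e T = M.payoff v e := by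
  set B := {t | 0 ≤ t ∧ e.FP.cdf t = 1} with hB
  have hτB : τ ∈ B := ⟨S.cutoff.1.le, S.cdf_FP_cutoff⟩
  have hbdd : BddBelow B := ⟨0, fun t ht => ht.1⟩
  set T := sInf B with hT
  have hT0 : 0 ≤ T := le_csInf ⟨τ, hτB⟩ fun t ht => ht.1
  have hlt : ∀ t, 0 ≤ t → t < T → e.FP.cdf t < 1 := fun t ht htT =>
    lt_of_le_of_ne (e.FP.cdf_le_one ht) fun h => absurd (csInf_le hbdd ⟨ht, h⟩) (not_le.2 htT)
  -- Right continuity of the distribution function makes the infimum a minimum.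
  have hT1 : e.FP.cdf T = 1 := by
    refine tendsto_nhds_unique (e.FP.cdf_tendsto_right T) (tendsto_const_nhds.congr' ?_)
    filter_upwards [self_mem_nhdsWithin] with r hr
    obtain ⟨s, hs, hsr⟩ := exists_lt_of_csInf_lt ⟨τ, hτB⟩ (show sInf B < r from hr)
    have h1 := e.FP.cdf_mono hsr.le
    rw [hs.2] at h1
    exact le_antisymm h1 (e.FP.cdf_le_one (hs.1.trans hsr.le))
  -- If `T` were not optimal, by continuity no time near it would be; the distribution function
  -- would be constant just before `T` and would reach one earlier.
  have hV : M.searchPayoff v e T = M.payoff v e := by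
    by_contra hne
    have hVlt := lt_of_le_of_ne (S.searchPayoff_le hT0) hne
    rcases hT0.eq_or_lt with h0 | h0
    · refine S.not_supports_FP_of_lt hVlt (Or.inr ?_)
      have h1 : e.FP.cdf 0 = 1 := by rw [← hT1, ← h0]
      rw [← h0, ← e.FP.cdf_zero, h1]
      exact zero_lt_one
    · obtain ⟨δ, hδ, h⟩ := S.eventually_searchPayoff_lt hT0 hVlt
      obtain ⟨s, hs1, hs2⟩ := exists_between (max_lt (sub_lt_self T hδ) h0)
      have hs0 : 0 < s := (le_max_right _ _).trans_lt hs1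
      have hsδ : T - δ < s := (le_max_left _ _).trans_lt hs1
      have h2 : e.FP.cdf T = e.FP.cdf s := by
        refine e.FP.cdf_eq_of_not_supports hs2.le fun r hr => ?_
        have hr0 : 0 ≤ r := hs0.le.trans hr.1.le
        refine S.not_supports_FP_of_lt (h r hr0 ?_)
        rw [abs_lt]
        constructor <;> linarith [hr.1, hr.2]
      rw [hT1] at h2
      exact (hlt s hs0.le hs2).ne h2.symm
  refine ⟨T, ?_, csInf_le hbdd hτB, hT1, hlt, hV⟩
  refine hT0.lt_of_ne fun h0 => ?_
  rw [← h0, S.searchPayoff_zero] at hV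
  exact S.lt_payoff.ne hV

/-- While the search may go on, a response other than the risky action persists for a while. -/
lemma eventually_a_lt_one {s : ℝ} (hs : 0 ≤ s) (hS : 0 < M.survival e s) (ha : e.a s < 1) :
    ∀ᶠ t in 𝓝[>] s, e.a t < 1 := by
  have hβ : 0 < M.μ - M.β := sub_pos.2 M.β_lt_μ
  -- This is a lower bound for what the agent gains by faking at `t` instead of `s` if type-1 news
  -- at `t` is trusted: the change in the premium less the cost of delay. It has a positive limit at
  -- `s`, although `s` is an optimal faking time.
  have h1 : Tendsto (fun t => (M.μ - M.β) * (M.survival e t - M.survival e s * e.a s)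
      - M.ρ * M.β * (t - s)) (𝓝[>] s)
      (𝓝 ((M.μ - M.β) * (M.survival e s - M.survival e s * e.a s) - M.ρ * M.β * (s - s))) := by
    refine Tendsto.sub (((M.survival_tendsto_right e s).sub_const _).const_mul _) ?_
    exact (Continuous.tendsto (by fun_prop) s).mono_left nhdsWithin_le_nhds
  have h2 : 0 < (M.μ - M.β) * (M.survival e s - M.survival e s * e.a s)
      - M.ρ * M.β * (s - s) := by
    rw [sub_self, mul_zero, sub_zero]
    refine mul_pos hβ ?_
    nlinarith
  filter_upwards [h1.eventually_const_lt h2, self_mem_nhdsWithin] with t h3 hst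
  refine lt_of_le_of_ne (e.a_le_one t) fun hat => ?_
  have hst' : s < t := hst
  have h4 := S.eq.agentPayoff_le (S.eq.supports_of_a_lt_one S.lt_one hs ha) (hs.trans hst'.le)
  have h5 := M.agentPayoff_sub e hs (hs.trans hst'.le)
  have h6 : ∫ r in s..t, (-(M.ρ * M.β)) ≤ ∫ r in s..t, M.waitFlow e r := by
    refine intervalIntegral.integral_mono_on hst'.le intervalIntegrable_const
      (M.waitFlow_integrable e hs (hs.trans hst'.le)) fun r hr => ?_
    exact M.waitFlow_ge e S.μ_lt_one (hs.trans hr.1)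
  rw [intervalIntegral.integral_const, smul_eq_mul] at h6
  rw [hat, mul_one] at h5
  nlinarith

lemma searchFlow_neg {t : ℝ} (ht : 0 ≤ t) (ha : e.a t < 1) : M.searchFlow e v t < 0 := by
  rw [searchFlow, S.eq.a_mul_newsGain_of_lt_one S.μ_lt ht ha, zero_sub]
  exact mul_neg_of_pos_of_neg (M.discount_pos t)
    (neg_neg_of_pos (mul_pos (mul_pos M.ρ_pos S.v_pos) (M.noFake_pos e ht)))

/-- The agent strictly prefers to wait when the search goes on for sure and the risky action
follows type-1 news. -/
lemma no_return {t₁ t₂ : ℝ} (h0 : 0 ≤ t₁) (h12 : t₁ < t₂) (h2τ : t₂ ≤ τ)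
    (hc : e.FP.cdf t₁ < 1) (hns : ∀ r ∈ Ioc t₁ t₂, ¬ e.FP.Supports r)
    (ha : ∀ r ∈ Ico t₁ t₂, e.a r < 1) (ha2 : e.a t₂ = 1) : False := by
  have hβ : 0 < M.μ - M.β := sub_pos.2 M.β_lt_μ
  have hb : 0 < 1 - M.β := by linarith [S.μ_lt_one]
  have hb1 : 0 < M.μ * (1 - M.β) := mul_pos M.μ_pos hb
  set c := 1 - e.FP.cdf t₁ with hcdef
  have hc0 : 0 < c := sub_pos.2 hc
  have hsurv : ∀ r ∈ Icc t₁ t₂, M.survival e r = c * M.discount r := by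
    intro r hr
    rw [survival, e.FP.cdf_eq_of_not_supports hr.1 fun u hu => hns u ⟨hu.1, hu.2.trans hr.2⟩,
      mul_comm]
  set C := M.μ * (1 - M.β) * M.hazardExt 0 with hC
  -- A Grönwall-type argument for the discounted distrust: optimality of faking at `s` rather than
  -- at `t₂` bounds it at `s` by a constant times its integral up to `t₂`, impossible for a positive
  -- function close to `t₂`.
  refine not_forall_pos_of_le_sup (x := fun r => M.discount r * (1 - e.a r)) (B := 1) (C := C)
    (D := M.μ - M.β) h12 hβ (mul_nonneg hb1.le (M.hazardExt_pos 0).le) ?_ ?_ ?_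
  · intro s hs
    exact mul_pos (M.discount_pos s) (sub_pos.2 (ha s hs))
  · intro s hs
    have := M.discount_le_one (h0.trans hs.1)
    have := M.discount_pos s
    have := e.a_nonneg s
    have := e.a_le_one s
    nlinarith
  · intro s hs X hX
    have hs0 : 0 ≤ s := h0.trans hs.1
    have ht0 : 0 ≤ t₂ := hs0.trans hs.2.le
    have h4 := S.eq.agentPayoff_le (S.eq.supports_of_a_lt_one S.lt_one hs0 (ha s hs)) ht0
    have h5 := M.agentPayoff_sub e hs0 ht0
    rw [hsurv s ⟨hs.1, hs.2.le⟩, hsurv t₂ ⟨h12.le, le_rfl⟩, ha2, mul_one] at h5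
    have hd := M.discount_sub s t₂
    have hX0 : 0 ≤ X :=
      (mul_pos (M.discount_pos s) (sub_pos.2 (ha s hs))).le.trans (hX s ⟨le_rfl, hs.2⟩)
    have hqc : Continuous fun r => M.discount r * (M.ρ + M.hazardExt r) :=
      M.discount_continuous.mul (continuous_const.add M.hazardExt_continuous)
    -- Under full trust the flow from waiting outweighs the decay `(μ - β) * (ρ + H)` of the
    -- premium; the missing trust costs at most `C * X`.
    have h6 : ∫ r in s..t₂, (c * (M.μ - M.β) * (M.discount r * (M.ρ + M.hazardExt r)) - c * (C * X))
        ≤ ∫ r in s..t₂, M.waitFlow e r := by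
      refine intervalIntegral.integral_mono_on_of_le_Ioo hs.2.le
        (((hqc.const_mul _).sub continuous_const).intervalIntegrable _ _)
        (M.waitFlow_integrable e hs0 ht0) fun r hr => ?_
      have hr' : r ∈ Ico s t₂ := ⟨hr.1.le, hr.2⟩
      have hr0 : 0 ≤ r := hs0.trans hr.1.le
      rw [waitFlow, hsurv r ⟨hs.1.trans hr.1.le, hr.2.le⟩]
      have e1 := hX r hr'
      have e2 := S.cutoff.lt_hazardExt S.μ_lt_one S.assumptionA2 (hr.2.le.trans h2τ)
      have e3 : M.hazardExt r ≤ M.hazardExt 0 := M.hazardExt_antitone hr0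
      have e4 := M.hazardExt_pos r
      have e5 := M.discount_pos r
      have e6 : M.μ * (1 - M.β) * M.hazardExt r * (M.discount r * (1 - e.a r)) ≤ C * X := by
        refine mul_le_mul (mul_le_mul_of_nonneg_left e3 hb1.le) e1 ?_ ?_
        · exact mul_nonneg e5.le (sub_nonneg.2 (e.a_le_one r))
        · exact mul_nonneg hb1.le (M.hazardExt_pos 0).le
      have e7 : 0 ≤ M.discount r * (M.β * (1 - M.μ) * M.hazardExt r - M.ρ * M.μ) :=
        mul_nonneg e5.le (by linarith)
      have e8 : c * ((M.μ - M.β) * (M.discount r * (M.ρ + M.hazardExt r)) - C * X) ≤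
          c * (M.discount r * (M.μ * (1 - M.β) * e.a r * M.hazardExt r - M.ρ * M.β)) := by
        refine mul_le_mul_of_nonneg_left ?_ hc0.le
        linarith
      linarith
    rw [intervalIntegral.integral_sub ((hqc.const_mul _).intervalIntegrable _ _)
      intervalIntegrable_const, intervalIntegral.integral_const_mul,
      intervalIntegral.integral_const, smul_eq_mul] at h6
    have h7 : c * ((M.μ - M.β) * (M.discount s * (1 - e.a s))) ≤ c * (C * X * (t₂ - s)) := by
      have h8 : c * (M.μ - M.β) * (∫ r in s..t₂, M.discount r * (M.ρ + M.hazardExt r))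
          = c * (M.μ - M.β) * (M.discount s - M.discount t₂) := by
        congr 1; linarith
      rw [h8] at h6
      linarith
    exact le_of_mul_le_mul_left h7 hc0

/-- Distrust, once it occurs, persists for a while, and meanwhile search only loses, so nobody stops
after its first moment. If it lasted until `T`, stopping at `T` would not be optimal. If it ended
before, trust would be back at a time up to which nobody stops, and the agent would have waited for
that time (`no_return`). -/
lemma a_eq_one_of_lt_end {T : ℝ} (hTτ : T ≤ τ)
    (hlt : ∀ t, 0 ≤ t → t < T → e.FP.cdf t < 1)
    (hV : M.searchPayoff v e T = M.payoff v e) {t : ℝ} (ht : 0 ≤ t) (htT : t < T) :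
    e.a t = 1 := by
  by_contra hne
  have hat : e.a t < 1 := lt_of_le_of_ne (e.a_le_one t) hne
  have hsurv : ∀ s, 0 ≤ s → s < T → 0 < M.survival e s := fun s h0 h1 =>
    mul_pos (M.discount_pos s) (sub_pos.2 (hlt s h0 h1))
  have hext : ∀ s, t ≤ s → s < T → e.a s < 1 → ∃ u, s < u ∧ u ≤ T ∧ ∀ r ∈ Ioo s u, e.a r < 1 := by
    intro s hts hsT has
    have h0 := ht.trans hts
    obtain ⟨u, hu, hu'⟩ := (mem_nhdsGT_iff_exists_Ioo_subset.1
      (S.eventually_a_lt_one h0 (hsurv s h0 hsT) has))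
    exact ⟨min u T, lt_min hu hsT, min_le_right _ _, fun r hr =>
      hu' ⟨hr.1, hr.2.trans_le (min_le_left _ _)⟩⟩
  -- The supremum of this set ends the maximal interval of distrust from `t` on; at that time trust
  -- must be restored unless it is `T`.
  set B := {u | t ≤ u ∧ u ≤ T ∧ ∀ r ∈ Ico t u, e.a r < 1} with hB
  have hbdd : BddAbove B := ⟨T, fun u hu => hu.2.1⟩
  have htB : t ∈ B := ⟨le_rfl, htT.le, fun r hr => absurd hr.2 (not_lt.2 hr.1)⟩
  set t₂ := sSup B with ht₂
  have hle : t₂ ≤ T := csSup_le ⟨t, htB⟩ fun u hu => hu.2.1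
  have hIco : ∀ r ∈ Ico t t₂, e.a r < 1 := by
    intro r hr
    obtain ⟨u, hu, hru⟩ := exists_lt_of_lt_csSup ⟨t, htB⟩ hr.2
    exact hu.2.2 r ⟨hr.1, hru⟩
  have hstep : ∀ s, t ≤ s → s ≤ t₂ → s < T → e.a s < 1 → s < t₂ := by
    intro s hts hst hsT has
    obtain ⟨u, hu, huT, hua⟩ := hext s hts hsT has
    refine lt_of_lt_of_le hu (le_csSup hbdd ⟨hts.trans hu.le, huT, fun r hr => ?_⟩)
    rcases lt_trichotomy r s with h | h | h
    · exact hIco r ⟨hr.1, h.trans_le hst⟩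
    · rw [h]; exact has
    · exact hua r ⟨h, hr.2⟩
  have ht2 : t < t₂ := hstep t le_rfl (le_csSup hbdd htB) htT hat
  have hVlt : ∀ r ∈ Ioc t t₂, M.searchPayoff v e r < M.payoff v e := by
    intro r hr
    refine (S.searchPayoff_lt_of_flow_neg ht hr.1 fun u hu => ?_).trans_le (S.searchPayoff_le ht)
    exact S.searchFlow_neg (ht.trans hu.1.le) (hIco u ⟨hu.1.le, hu.2.trans_le hr.2⟩)
  have ht2T : t₂ < T := lt_of_le_of_ne hle fun h => by
    have := hVlt t₂ ⟨ht2, le_rfl⟩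
    rw [h, hV] at this
    exact lt_irrefl _ this
  have ha2 : e.a t₂ = 1 := by
    by_contra hn
    exact lt_irrefl _ (hstep t₂ ht2.le le_rfl ht2T (lt_of_le_of_ne (e.a_le_one _) hn))
  exact S.no_return ht ht2 (hle.trans hTτ) (hlt t ht htT)
    (fun r hr => S.not_supports_FP_of_lt (hVlt r hr)) hIco ha2

/-- Waiting from `s` to `T` yields a flow of order `T - s`, whereas a trusted fake at `s` yields the
premium `μ - β` at once, both times the survival probability at `s`. Close to `T` the premium is
larger, so the agent fakes before the end for sure. -/
lemma exists_better_than_end {T : ℝ} (hT : 0 < T)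
    (hlt : ∀ t, 0 ≤ t → t < T → e.FP.cdf t < 1) (ha : ∀ t, 0 ≤ t → t < T → e.a t = 1) :
    ∃ s, 0 ≤ s ∧ M.β + ∫ s in (0 : ℝ)..T, M.waitFlow e s < M.agentPayoff e s := by
  have hβ : 0 < M.μ - M.β := sub_pos.2 M.β_lt_μ
  have hb : 0 < 1 - M.β := by linarith [S.μ_lt_one]
  have hb1 : 0 < M.μ * (1 - M.β) := mul_pos M.μ_pos hb
  set C := M.μ * (1 - M.β) * M.hazardExt 0 with hC
  have h1 : Tendsto (fun s => C * (T - s)) (𝓝[<] T) (𝓝 (C * (T - T))) :=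
    (Continuous.tendsto (by fun_prop) T).mono_left nhdsWithin_le_nhds
  rw [sub_self, mul_zero] at h1
  obtain ⟨s, hs, hs'⟩ := ((h1.eventually_lt_const hβ).and (Ico_mem_nhdsLT hT)).exists
  refine ⟨s, hs'.1, ?_⟩
  have hSs : 0 < M.survival e s :=
    mul_pos (M.discount_pos s) (sub_pos.2 (hlt s hs'.1 hs'.2))
  rw [M.agentPayoff_eq e hs'.1, ha s hs'.1 hs'.2,
    ← intervalIntegral.integral_add_adjacent_intervals (M.waitFlow_intervalIntegrable e hs'.1)
      (M.waitFlow_integrable e hs'.1 hT.le)]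
  have h2 : ∫ r in s..T, M.waitFlow e r ≤ ∫ r in s..T, M.survival e s * C := by
    refine intervalIntegral.integral_mono_on hs'.2.le (M.waitFlow_integrable e hs'.1 hT.le)
      intervalIntegrable_const fun r hr => ?_
    have hr0 := hs'.1.trans hr.1
    have e1 := M.survival_antitoneOn e hs'.1 hr0 hr.1
    have e2 := M.survival_nonneg e hr0
    have e3 : M.μ * (1 - M.β) * e.a r * M.hazardExt r - M.ρ * M.β ≤ C := by
      have e4 : M.μ * (1 - M.β) * e.a r * M.hazardExt r ≤ C := by
        refine mul_le_mul (mul_le_of_le_one_right hb1.le (e.a_le_one r))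
          (M.hazardExt_antitone hr0) (M.hazardExt_pos r).le hb1.le
      have := mul_pos M.ρ_pos M.β_pos
      linarith
    have hC0 : 0 ≤ C := mul_nonneg hb1.le (M.hazardExt_pos 0).le
    calc M.waitFlow e r ≤ M.survival e r * C := mul_le_mul_of_nonneg_left e3 e2
      _ ≤ M.survival e s * C := mul_le_mul_of_nonneg_right e1 hC0
  rw [intervalIntegral.integral_const, smul_eq_mul] at h2
  have h3 : M.survival e s * (C * (T - s)) < M.survival e s * (M.μ - M.β) :=
    mul_lt_mul_of_pos_left hs hSs
  linarith

/-- Structure of an equilibrium with beneficial search around the end of the search. -/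
lemma end_structure : (∀ t, 0 ≤ t → t < τ → e.a t = 1) ∧
    (∀ t, 0 ≤ t → t < τ → e.FP.cdf t < 1) ∧ (∀ t, τ ≤ t → ¬ e.FA.Supports t) ∧
    e.FA.massTop = 0 ∧ (∀ t, e.FA.atom t = 0) ∧ M.searchPayoff v e τ = M.payoff v e := by
  obtain ⟨T, hT0, hTτ, hT1, hlt, hV⟩ := S.exists_end
  have ha : ∀ t, 0 ≤ t → t < T → e.a t = 1 := fun t ht htT =>
    S.a_eq_one_of_lt_end hTτ hlt hV ht htT
  obtain ⟨s, hs0, hs⟩ := S.exists_better_than_end hT0 hlt ha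
  have hns : ∀ t, T ≤ t → ¬ e.FA.Supports t := by
    intro t ht hsup
    have h1 := S.eq.agentPayoff_le hsup hs0
    rw [M.agentPayoff_of_end hT0.le hT1 ht] at h1
    exact absurd h1 (not_le.2 hs)
  have hm : e.FA.massTop = 0 := by
    refine le_antisymm (not_lt.1 fun h => ?_) e.FA.massTop_nonneg
    have h1 := S.eq.faking_optimal.2 h s hs0
    rw [M.agentPayoffTop_of_end S.μ_lt_one hT0.le hT1] at h1
    exact absurd h1 (not_le.2 hs)
  have hatom : ∀ t, e.FA.atom t = 0 := by
    intro t
    rcases (e.FA.atom_nonneg t).lt_or_eq with h | h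
    · have ht := e.FA.nonneg_of_supports (Or.inr h)
      rcases lt_or_ge t T with h1 | h1
      · have h2 := S.eq.a_of_atom S.μ_lt ht h
        rw [ha t ht h1] at h2
        exact absurd h2 one_ne_zero
      · exact absurd (Or.inr h) (hns t h1)
    · exact h.symm
  -- After `T` all news is real, so if `T < τ` it would pay to search on until `τ`, against the
  -- optimality of `T`.
  have hTeq : T = τ := by
    refine le_antisymm hTτ (not_lt.1 fun h => ?_)
    refine absurd (S.searchPayoff_lt_of_flow_pos hT0.le h fun r hr => ?_)
      (not_lt.2 ((S.searchPayoff_le S.cutoff.1.le).trans hV.ge))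
    have hr0 := hT0.le.trans hr.1.le
    rw [searchFlow_of_a_eq_one S.μ_lt (S.eq.a_eq_one S.lt_one hr0 (hns r hr.1.le)),
      e.FA.density_eq_zero_of_not_supports (hns r hr.1.le), mul_zero, sub_zero]
    exact mul_pos (M.discount_pos r) (mul_pos (sub_pos.2 S.μ_lt)
      (mul_pos (S.cutoff.fakeRate_pos S.μ_lt S.lt_one hr.2) (M.noFake_pos e hr0)))
  subst hTeq
  exact ⟨ha, hlt, hns, hm, hatom, hV⟩

end IsSearchEquilibrium

end NewsGame

/-- A property that holds almost everywhere holds somewhere in every nonempty open interval. -/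
theorem exists_mem_Ioo_of_ae {p : ℝ → Prop} (h : ∀ᵐ t, p t) {a b : ℝ} (hab : a < b) :
    ∃ t ∈ Ioo a b, p t := by
  by_contra! hn
  have h1 : volume (Ioo a b) = 0 := measure_mono_null (fun t ht => hn t ht) (ae_iff.1 h)
  rw [Real.volume_Ioo, ENNReal.ofReal_eq_zero] at h1
  linarith

/-! ### Indifference, the faking and stopping rates, and the payoff formula. -/

namespace NewsGame

/-- The rate at which the agent's discounted survival probability falls when he is indifferent
about the time of faking. -/
def survivalRate (M : NewsGame) (s : ℝ) : ℝ :=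
  (M.μ * (1 - M.β) * M.hazardExt s - M.ρ * M.β) / (M.μ - M.β)

/-- The discounted probability that neither news nor fake news has arrived and the search still
runs at `s`, when faking starts at `x`, with respect to the opponents' indifference. -/
def mixingWeight (M : NewsGame) (v x s : ℝ) : ℝ :=
  M.discount x * Real.exp (-∫ r in x..s, M.survivalRate r)
    * Real.exp (-∫ r in x..s, M.fakeRate v r)

/-- Payoff of a principal with safe payoff `θ` when a player with safe payoff `v` has the decision
authority and faking takes place between `x` and `τ`. -/
def delegationPayoff (M : NewsGame) (θ v x τ : ℝ) : ℝ :=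
  θ + (θ - M.μ) * ((∫ s in (0 : ℝ)..x, M.discount s * M.fakeRate θ s)
    + ∫ s in x..τ, M.mixingWeight v x s * (M.fakeRate θ s - M.fakeRate v s))

variable {M : NewsGame} {v τ : ℝ} {e : Profile}

lemma survivalRate_continuous (M : NewsGame) : Continuous M.survivalRate := by
  have := M.hazardExt_continuous
  unfold survivalRate
  fun_prop

lemma sub_mul_survivalRate (M : NewsGame) (s : ℝ) :
    (M.μ - M.β) * M.survivalRate s = M.μ * (1 - M.β) * M.hazardExt s - M.ρ * M.β := by
  rw [survivalRate, mul_div_cancel₀]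
  exact (sub_pos.2 M.β_lt_μ).ne'

lemma noOverrule_of_newsGain_pos {θ : ℝ} (he : M.IsEquilibrium v e) (hv : v ≤ θ)
    (hθ : M.μ < θ) {t : ℝ} (ht : 0 ≤ t) (h0 : e.FA.atom t = 0) (h : 0 < M.newsGain e θ t) :
    M.NoOverrule θ e t := by
  have h1 : θ < M.belief e t := (M.lt_belief_iff e θ ht h0).2 h
  have h2 : e.a t = 1 := he.risky_of_lt t ht (hv.trans_lt h1)
  rintro (_ | _ | _)
  · exact ⟨fun h => absurd h (lt_irrefl _), fun _ => hθ⟩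
  · exact ⟨fun h => absurd h (lt_irrefl _), fun _ => M.μ_pos.trans hθ⟩
  · refine ⟨fun _ => h1, fun h => ?_⟩
    rw [riskyProb, h2] at h
    exact absurd h (lt_irrefl _)

lemma newsGain_of_density_eq_zero {θ t : ℝ} (hθ : θ < 1) (ht : 0 ≤ t)
    (h : e.FA.density t = 0) : 0 < M.newsGain e θ t := by
  rw [newsGain, h, mul_zero, mul_zero, sub_zero]
  exact mul_pos (mul_pos (mul_pos M.μ_pos (sub_pos.2 hθ)) (M.hazardExt_pos t))
    (M.noFake_pos e ht)

lemma newsGain_of_density_eq {θ t : ℝ} (ht : 0 ≤ t)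
    (h : M.σ * e.FA.density t = M.fakeRate v t * M.noFake e t)
    (hθ : (θ - M.μ) * M.fakeRate v t < M.μ * (1 - θ) * M.hazardExt t) :
    0 < M.newsGain e θ t := by
  rw [newsGain, h]
  have := mul_lt_mul_of_pos_right hθ (M.noFake_pos e ht)
  linarith

namespace IsSearchEquilibrium

variable (S : M.IsSearchEquilibrium v τ e)
include S

lemma a_eq_one {t : ℝ} (ht : 0 ≤ t) (h : t < τ) : e.a t = 1 := S.end_structure.1 t ht h

lemma cdf_FP_lt_one {t : ℝ} (ht : 0 ≤ t) (h : t < τ) : e.FP.cdf t < 1 :=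
  S.end_structure.2.1 t ht h

lemma not_supports_FA_of_cutoff_le {t : ℝ} (ht : τ ≤ t) : ¬ e.FA.Supports t :=
  S.end_structure.2.2.1 t ht

lemma massTop_FA : e.FA.massTop = 0 := S.end_structure.2.2.2.1

lemma atom_FA (t : ℝ) : e.FA.atom t = 0 := S.end_structure.2.2.2.2.1 t

lemma searchPayoff_cutoff : M.searchPayoff v e τ = M.payoff v e := S.end_structure.2.2.2.2.2

/-- If stopping is not optimal at `s`, it does not happen for a while after `s` either. News is
trusted before `τ`, so by `AssumptionA2` the agent strictly gains by postponing the fake a little.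
-/
lemma not_supports_FA_of_lt {s : ℝ} (hs : 0 ≤ s) (hsτ : s < τ)
    (h : M.searchPayoff v e s < M.payoff v e) : ¬ e.FA.Supports s := by
  intro hsup
  obtain ⟨δ, hδ, hlt⟩ := S.eventually_searchPayoff_lt hs h
  obtain ⟨t, hst, ht⟩ := exists_between (lt_min hsτ (lt_add_of_pos_right s hδ))
  have htτ : t < τ := ht.trans_le (min_le_left _ _)
  have htδ : t < s + δ := ht.trans_le (min_le_right _ _)
  have ht0 : 0 ≤ t := hs.trans hst.le
  have hns : ∀ r ∈ Ioc s t, ¬ e.FP.Supports r := fun r hr =>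
    S.not_supports_FP_of_lt (hlt r (hs.trans hr.1.le) (by
      rw [abs_lt]; constructor <;> linarith [hr.1, hr.2]))
  set c := 1 - e.FP.cdf s with hc
  have hc0 : 0 < c := sub_pos.2 (S.cdf_FP_lt_one hs hsτ)
  have hsurv : ∀ r ∈ Icc s t, M.survival e r = c * M.discount r := by
    intro r hr
    rw [survival, e.FP.cdf_eq_of_not_supports hr.1 fun u hu => hns u ⟨hu.1, hu.2.trans hr.2⟩,
      mul_comm]
  have h4 := S.eq.agentPayoff_le hsup ht0
  have h5 := M.agentPayoff_sub e hs ht0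
  rw [hsurv s ⟨le_rfl, hst.le⟩, hsurv t ⟨hst.le, le_rfl⟩, S.a_eq_one hs hsτ,
    S.a_eq_one ht0 htτ, mul_one, mul_one] at h5
  have hd := M.discount_sub s t
  have c1 : Continuous fun r => M.discount r * (M.ρ + M.hazardExt r) :=
    M.discount_continuous.mul (continuous_const.add M.hazardExt_continuous)
  have c2 : Continuous fun r => M.discount r * (M.β * (1 - M.μ) * M.hazardExt r - M.ρ * M.μ) :=
    M.discount_continuous.mul ((continuous_const.mul M.hazardExt_continuous).sub
      continuous_const)
  have h6 : ∫ r in s..t, M.waitFlow e r = c * (∫ r in s..t,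
      M.discount r * (M.β * (1 - M.μ) * M.hazardExt r - M.ρ * M.μ))
      + c * (M.μ - M.β) * ∫ r in s..t, M.discount r * (M.ρ + M.hazardExt r) := by
    rw [← intervalIntegral.integral_const_mul, ← intervalIntegral.integral_const_mul,
      ← intervalIntegral.integral_add ((c2.intervalIntegrable _ _).const_mul c)
        ((c1.intervalIntegrable _ _).const_mul (c * (M.μ - M.β)))]
    refine intervalIntegral.integral_congr fun r hr => ?_
    rw [uIcc_of_le hst.le] at hr
    simp only [waitFlow, hsurv r hr, S.a_eq_one (hs.trans hr.1) (hr.2.trans_lt htτ)]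
    ring
  have h7 : 0 < ∫ r in s..t, M.discount r * (M.β * (1 - M.μ) * M.hazardExt r - M.ρ * M.μ) := by
    refine intervalIntegral.intervalIntegral_pos_of_pos_on (c2.intervalIntegrable _ _)
      (fun r hr => mul_pos (M.discount_pos r) (sub_pos.2 ?_)) hst
    exact S.cutoff.lt_hazardExt S.μ_lt_one S.assumptionA2 (hr.2.trans htτ).le
  have h8 := mul_pos hc0 h7
  have h9 : c * (M.μ - M.β) * (∫ r in s..t, M.discount r * (M.ρ + M.hazardExt r))
      = c * (M.μ - M.β) * (M.discount s - M.discount t) := by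
    congr 1; linarith
  rw [h9] at h6
  linarith

lemma isCompact_optimal (t : ℝ) :
    IsCompact {s | s ∈ Icc 0 t ∧ M.searchPayoff v e s = M.payoff v e} := by
  have h := ContinuousOn.preimage_isClosed_of_isClosed
    (S.searchPayoff_continuousOn.mono (fun s (hs : s ∈ Icc 0 t) => hs.1)) isClosed_Icc
    (isClosed_singleton (x := M.payoff v e))
  exact isCompact_Icc.of_isClosed_subset h inter_subset_left

/-- The earliest optimal stopping time: up to it the agent does not fake, from it on the player
with the decision authority is indifferent. -/
lemma exists_start : ∃ x, 0 < x ∧ x ≤ τ ∧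
    (∀ t, 0 ≤ t → t < x → M.searchPayoff v e t < M.payoff v e) ∧
    (∀ t, x ≤ t → t ≤ τ → M.searchPayoff v e t = M.payoff v e) := by
  obtain ⟨x, ⟨⟨hx0, hxτ⟩, hx⟩, hmin⟩ := (S.isCompact_optimal τ).exists_isLeast
    ⟨τ, ⟨S.cutoff.1.le, le_rfl⟩, S.searchPayoff_cutoff⟩
  refine ⟨x, hx0.lt_of_ne fun h => ?_, hxτ, fun t ht htx => ?_, fun t hxt htτ => ?_⟩
  · rw [← h, S.searchPayoff_zero] at hx
    exact S.lt_payoff.ne hx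
  · refine lt_of_le_of_ne (S.searchPayoff_le ht) fun h => ?_
    exact absurd (hmin ⟨⟨ht, htx.le.trans hxτ⟩, h⟩) (not_le.2 htx)
  · by_contra hne
    have ht0 := hx0.trans hxt
    have hlt := lt_of_le_of_ne (S.searchPayoff_le ht0) hne
    have htτ' : t < τ := lt_of_le_of_ne htτ fun h => hne (h ▸ S.searchPayoff_cutoff)
    -- After the last optimal time `c` before `t` there is no faking up to `t`, so search strictly
    -- gains there and the payoff at `t` would exceed the maximum.
    obtain ⟨c, ⟨⟨hc0, hct⟩, hc⟩, hmax⟩ := (S.isCompact_optimal t).exists_isGreatest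
      ⟨x, ⟨hx0, hxt⟩, hx⟩
    have hct' : c < t := lt_of_le_of_ne hct fun h => hne (h ▸ hc)
    refine absurd (S.searchPayoff_lt_of_flow_pos hc0 hct' fun r hr => ?_)
      (not_lt.2 (hlt.le.trans hc.ge))
    have hr0 := hc0.trans hr.1.le
    have hrτ := hr.2.trans htτ'
    have hVr : M.searchPayoff v e r < M.payoff v e := by
      refine lt_of_le_of_ne (S.searchPayoff_le hr0) fun h => ?_
      exact absurd (hmax ⟨⟨hr0, hr.2.le⟩, h⟩) (not_le.2 hr.1)
    rw [searchFlow_of_a_eq_one S.μ_lt (S.a_eq_one hr0 hrτ),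
      e.FA.density_eq_zero_of_not_supports (S.not_supports_FA_of_lt hr0 hrτ hVr), mul_zero,
      sub_zero]
    exact mul_pos (M.discount_pos r) (mul_pos (sub_pos.2 S.μ_lt)
      (mul_pos (S.cutoff.fakeRate_pos S.μ_lt S.lt_one hrτ) (M.noFake_pos e hr0)))

/-- The structure of an equilibrium with beneficial search. -/
theorem structure_theorem : ∃ x, M.IsSchedule v x τ ∧
    (∀ t, 0 ≤ t → t < x → e.FA.density t = 0) ∧ (∀ t, 0 ≤ t → t < x → e.FP.cdf t = 0) ∧
    (∀ t, 0 ≤ t → t < x → M.noFake e t = 1) ∧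
    (∀ t, x ≤ t → t ≤ τ → M.noFake e t = Real.exp (-∫ s in x..t, M.fakeRate v s)) ∧
    (∀ᵐ t, t ∈ Ioo x τ → M.σ * e.FA.density t = M.fakeRate v t * M.noFake e t) ∧
    (∀ᵐ t, t ∈ Ioo x τ →
      M.survival e t = M.discount x * Real.exp (-∫ s in x..t, M.survivalRate s)) := by
  obtain ⟨x, hx0, hxτ, hlt, hopt⟩ := S.exists_start
  have hβ : 0 < M.μ - M.β := sub_pos.2 M.β_lt_μ
  have hdens0 : ∀ t, 0 ≤ t → t < x → e.FA.density t = 0 := fun t ht htx =>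
    e.FA.density_eq_zero_of_not_supports
      (S.not_supports_FA_of_lt ht (htx.trans_le hxτ) (hlt t ht htx))
  have hFP0 : ∀ t, 0 ≤ t → t < x → e.FP.cdf t = 0 := by
    intro t ht htx
    rw [e.FP.cdf_eq_of_not_supports ht fun r hr =>
      S.not_supports_FP_of_lt (hlt r hr.1.le (hr.2.trans_lt htx)), e.FP.cdf_zero]
    exact e.FP.atom_eq_zero_of_not_supports (S.not_supports_FP_of_lt (hlt 0 le_rfl hx0))
  have hFA : ∀ t, e.FA.cdf t = ∫ s in (0 : ℝ)..t, e.FA.density s := fun t => by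
    rw [e.FA.cdf_eq, MixedTime.atomCdf]
    simp [S.atom_FA, indicator]
  have hint0 : ∀ t, 0 ≤ t → t ≤ x → ∫ s in (0 : ℝ)..t, e.FA.density s = 0 := by
    intro t ht htx
    refine intervalIntegral.integral_zero_ae ?_
    have : ∀ᵐ s : ℝ, s ≠ x := by simp [ae_iff, measure_singleton]
    filter_upwards [this] with s hs hst
    rw [uIoc_of_le ht] at hst
    exact hdens0 s hst.1.le (lt_of_le_of_ne (hst.2.trans htx) hs)
  have hN1 : ∀ t, 0 ≤ t → t < x → M.noFake e t = 1 := fun t ht htx => by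
    rw [noFake, hFA, hint0 t ht htx.le, mul_zero, sub_zero]
  -- The searcher's payoff is constant on `[x, τ]`; differentiating its integral representation
  -- makes the flow vanish almost everywhere.
  have hdens : ∀ᵐ t, t ∈ Ioo x τ → M.σ * e.FA.density t = M.fakeRate v t * M.noFake e t := by
    have h1 := (M.searchFlow_integrable e v hx0.le S.cutoff.1.le).ae_hasDerivAt_integral
    filter_upwards [h1] with t ht htI
    rw [uIcc_of_le hxτ] at ht
    have h2 := ht ⟨htI.1.le, htI.2.le⟩ x ⟨le_rfl, hxτ⟩
    have h3 : (fun u => ∫ s in x..u, M.searchFlow e v s) =ᶠ[𝓝 t] fun _ => 0 := by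
      filter_upwards [Ioo_mem_nhds htI.1 htI.2] with u hu
      rw [← S.searchPayoff_sub hx0.le (hx0.le.trans hu.1.le), hopt u hu.1.le hu.2.le,
        hopt x le_rfl hxτ, sub_self]
    have h4 := h2.unique ((hasDerivAt_const t (0 : ℝ)).congr_of_eventuallyEq h3)
    have ht0 := hx0.le.trans htI.1.le
    rw [searchFlow_of_a_eq_one S.μ_lt (S.a_eq_one ht0 htI.2)] at h4
    have h5 := (mul_eq_zero.1 ((mul_eq_zero.1 h4).resolve_left (M.discount_pos t).ne')).resolve_left
      (sub_pos.2 S.μ_lt).ne'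
    linarith
  have hneτ : ∀ᵐ s : ℝ, s ≠ τ := by simp [ae_iff, measure_singleton]
  have hN : ∀ t, x ≤ t → t ≤ τ → M.noFake e t = Real.exp (-∫ s in x..t, M.fakeRate v s) := by
    intro t hxt htτ
    have hii := e.FA.density_intervalIntegrable x t
    have hcongr : ∀ u, x ≤ u → u ≤ τ → (fun s => M.σ * e.FA.density s)
        =ᵐ[volume.restrict (uIoc x u)] fun s => M.fakeRate v s * M.noFake e s := by
      intro u hxu huτ
      rw [EventuallyEq, ae_restrict_iff' measurableSet_uIoc]
      filter_upwards [hdens, hneτ] with s hs hsτ hsu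
      rw [uIoc_of_le hxu] at hsu
      exact hs ⟨hsu.1, lt_of_le_of_ne (hsu.2.trans huτ) hsτ⟩
    have h := eq_mul_exp_of_integral_equation (c := M.fakeRate v) (y := M.noFake e) (a := x)
      (b := t) (y₀ := 1) (M.fakeRate_continuous v) ((hii.const_mul M.σ).congr_ae (hcongr t hxt htτ))
      (fun u hu => ?_) ⟨hxt, le_rfl⟩
    · rw [h, one_mul]
    · have h1 : ∫ s in x..u, M.fakeRate v s * M.noFake e s = ∫ s in x..u, M.σ * e.FA.density s :=
        (intervalIntegral.integral_congr_ae_restrict (hcongr u hu.1 (hu.2.trans htτ))).symm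
      rw [h1, intervalIntegral.integral_const_mul, noFake, hFA,
        ← intervalIntegral.integral_add_adjacent_intervals (e.FA.density_intervalIntegrable 0 x)
          (e.FA.density_intervalIntegrable x u), hint0 x hx0.le le_rfl, zero_add]
  -- The manipulative agent has faked for sure by `τ`, so the probability of no fake is `1 - σ`
  -- there.
  have htotal : ∫ s in x..τ, M.fakeRate v s = M.totalFake := by
    have h1 := hN τ hxτ le_rfl
    rw [noFake, e.FA.cdf_eq_total S.cutoff.1.le fun t ht => S.not_supports_FA_of_cutoff_le ht.le,
      S.massTop_FA, sub_zero, mul_one, ← M.exp_neg_totalFake] at h1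
    have := Real.exp_injective h1
    linarith
  have hxτ' : x < τ := by
    refine lt_of_le_of_ne hxτ fun h => ?_
    rw [h, intervalIntegral.integral_same] at htotal
    exact M.totalFake_pos.ne htotal
  refine ⟨x, ⟨S.cutoff, hx0, hxτ', htotal⟩, hdens0, hFP0, hN1, hN, hdens, ?_⟩
  obtain ⟨t₀, ht₀⟩ := e.FA.exists_supports_of_massTop (by rw [S.massTop_FA]; exact zero_lt_one)
  -- `D t` is the premium that makes faking at `t` optimal. Survival may jump, but `D` is continuous
  -- and equals `(μ - β)` times survival almost everywhere between `x` and `τ`; hence the integral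
  -- equation is solved for `D`.
  set D : ℝ → ℝ := fun t => M.agentPayoff e t₀ - M.β - ∫ s in (0 : ℝ)..t, M.waitFlow e s with hD
  have hDge : ∀ t, 0 ≤ t → t < τ → (M.μ - M.β) * M.survival e t ≤ D t := by
    intro t ht htτ
    have h1 := S.eq.agentPayoff_le ht₀ ht
    rw [M.agentPayoff_eq e ht, S.a_eq_one ht htτ, mul_one] at h1
    simp only [hD]
    linarith
  have hDeq : ∀ᵐ t, t ∈ Ioo x τ → (M.μ - M.β) * M.survival e t = D t := by
    filter_upwards [hdens] with t ht htI
    have ht0 := hx0.le.trans htI.1.le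
    refine le_antisymm (hDge t ht0 htI.2) ?_
    have h2 : 0 < M.σ * e.FA.density t := by
      rw [ht htI]
      exact mul_pos (S.cutoff.fakeRate_pos S.μ_lt S.lt_one htI.2) (M.noFake_pos e ht0)
    have h1 := S.eq.agentPayoff_le (Or.inl (pos_of_mul_pos_right h2 M.σ_pos.le))
      (e.FA.nonneg_of_supports ht₀)
    rw [M.agentPayoff_eq e ht0, S.a_eq_one ht0 htI.2, mul_one] at h1
    simp only [hD]
    linarith
  have hDc : ContinuousOn D (Icc 0 τ) := by
    refine continuousOn_const.sub ?_
    have := intervalIntegral.continuousOn_primitive_interval'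
      (M.waitFlow_intervalIntegrable e S.cutoff.1.le) left_mem_uIcc
    rwa [uIcc_of_le S.cutoff.1.le] at this
  have hDcx : ContinuousAt D x := hDc.continuousAt (Icc_mem_nhds hx0 hxτ')
  have hqx : ContinuousAt (fun t => (M.μ - M.β) * M.discount t) x :=
    (M.discount_continuous.const_smul (M.μ - M.β)).continuousAt
  -- The upper bound comes from times after `x`, where survival is at most the discount factor. The
  -- lower one comes from times before `x`, where nobody has stopped and faking is not better than
  -- the optimum.
  have hDx : D x = (M.μ - M.β) * M.discount x := by
    refine le_antisymm (not_lt.1 fun h => ?_) ?_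
    · have h1 := (hqx.tendsto.eventually_lt hDcx.tendsto h)
      obtain ⟨l, u, hlu, hsub⟩ := mem_nhds_iff_exists_Ioo_subset.1 h1
      obtain ⟨t, ht, ht'⟩ := exists_mem_Ioo_of_ae hDeq (lt_min hlu.2 hxτ')
      have h2 := hsub ⟨hlu.1.trans ht.1, ht.2.trans_le (min_le_left _ _)⟩
      have h3 := ht' ⟨ht.1, ht.2.trans_le (min_le_right _ _)⟩
      have h4 := mul_le_mul_of_nonneg_left
        (M.survival_le_discount e (hx0.le.trans ht.1.le)) hβ.le
      have h5 : (M.μ - M.β) * M.discount t < D t := h2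
      linarith
    · refine le_of_tendsto_of_tendsto (hqx.tendsto.mono_left nhdsWithin_le_nhds)
        (hDcx.tendsto.mono_left nhdsWithin_le_nhds : Tendsto D (𝓝[<] x) _) ?_
      filter_upwards [Ico_mem_nhdsLT hx0] with t ht
      have h1 := hDge t ht.1 (ht.2.trans hxτ')
      rwa [survival, hFP0 t ht.1 ht.2, sub_zero, mul_one] at h1
  have hcongr : ∀ u, x ≤ u → u ≤ τ → M.waitFlow e
      =ᵐ[volume.restrict (uIoc x u)] fun s => M.survivalRate s * D s := by
    intro u hxu huτ
    rw [EventuallyEq, ae_restrict_iff' measurableSet_uIoc]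
    filter_upwards [hDeq, hneτ] with s hs hsτ hsu
    rw [uIoc_of_le hxu] at hsu
    have hsτ' := lt_of_le_of_ne (hsu.2.trans huτ) hsτ
    rw [← hs ⟨hsu.1, hsτ'⟩, waitFlow, S.a_eq_one (hx0.le.trans hsu.1.le) hsτ', mul_one,
      ← M.sub_mul_survivalRate]
    ring
  have hDsol : ∀ t ∈ Icc x τ, D t = D x * Real.exp (-∫ s in x..t, M.survivalRate s) := by
    intro t ht
    refine eq_mul_exp_of_integral_equation M.survivalRate_continuous
      ((M.waitFlow_integrable e hx0.le S.cutoff.1.le).congr_ae (hcongr τ hxτ le_rfl))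
      (fun u hu => ?_) ht
    rw [← intervalIntegral.integral_congr_ae_restrict (hcongr u hu.1 hu.2)]
    simp only [hD]
    rw [← intervalIntegral.integral_add_adjacent_intervals
      (M.waitFlow_intervalIntegrable e hx0.le)
      (M.waitFlow_integrable e hx0.le (hx0.le.trans hu.1))]
    ring
  filter_upwards [hDeq] with t ht htI
  have h1 := ht htI
  rw [hDsol t ⟨htI.1.le, htI.2.le⟩, hDx, mul_assoc] at h1
  exact mul_left_cancel₀ hβ.ne' h1

/-- The payoff from delegation in an equilibrium with beneficial search. -/
theorem payoff_eq {θ : ℝ} (hθ : M.μ < θ) :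
    ∃ x, M.IsSchedule v x τ ∧ M.payoff θ e = M.delegationPayoff θ v x τ := by
  obtain ⟨x, hx, hd0, hFP0, hN1, hN, hd, hs⟩ := S.structure_theorem
  refine ⟨x, hx, ?_⟩
  have hτ0 := S.cutoff.1.le
  have hneτ : ∀ᵐ s : ℝ, s ≠ τ := by simp [ae_iff, measure_singleton]
  have hnex : ∀ᵐ s : ℝ, s ≠ x := by simp [ae_iff, measure_singleton]
  have hii := M.searchFlow_intervalIntegrable e θ hτ0
  have hFPm : IntervalIntegrable (fun s => M.searchFlow e θ s * e.FP.cdf s) volume 0 τ := by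
    refine (hii.bdd_measurable_mul hτ0 e.FP.cdf_measurable (C := 1) fun s hs => ?_).congr
      fun s _ => mul_comm _ _
    rw [abs_of_nonneg (e.FP.cdf_nonneg hs)]; exact e.FP.cdf_le_one hs
  -- Averaging over the stopping time weights the flow at `s` by the probability that the search
  -- still runs. The safe payoff `θ` here need not be that of the player who stops.
  have h1 : M.payoff θ e = θ + ∫ s in (0 : ℝ)..τ, M.searchFlow e θ s * (1 - e.FP.cdf s) := by
    have hW : ∀ s, 0 ≤ s → M.searchPayoff θ e s = θ + ∫ r in (0 : ℝ)..s, M.searchFlow e θ r :=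
      fun s hs => M.searchPayoff_eq e S.μ_lt_one θ
        (fun t _ h => absurd h (by rw [S.atom_FA]; exact lt_irrefl _)) hs
    rw [payoff, MixedTime.expectation, S.massTop_FP, zero_mul, add_zero,
      e.FP.integral_eq_integralUpTo hτ0 fun t ht => S.not_supports_FP_of_cutoff_lt ht,
      e.FP.integralUpTo_primitive hτ0 hii θ fun s hs => hW s hs.1, S.cdf_FP_cutoff, mul_one,
      hW τ hτ0, add_sub_assoc, ← intervalIntegral.integral_sub hii hFPm]
    congr 1
    refine intervalIntegral.integral_congr fun s _ => ?_
    ring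
  have h2 : ∀ s, 0 ≤ s → s < τ → M.searchFlow e θ s * (1 - e.FP.cdf s)
      = (θ - M.μ) * (M.survival e s * (M.fakeRate θ s * M.noFake e s
        - M.σ * e.FA.density s)) := by
    intro s hs0 hsτ
    rw [searchFlow_of_a_eq_one hθ (S.a_eq_one hs0 hsτ), survival]
    ring
  have hint : IntervalIntegrable (fun s => M.searchFlow e θ s * (1 - e.FP.cdf s)) volume 0 τ := by
    refine (hii.sub hFPm).congr fun s _ => ?_
    ring
  have hsub1 : uIcc 0 x ⊆ uIcc 0 τ := by
    rw [uIcc_of_le hx.start_pos.le, uIcc_of_le hτ0]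
    exact Icc_subset_Icc le_rfl hx.start_lt.le
  have hsub2 : uIcc x τ ⊆ uIcc 0 τ := by
    rw [uIcc_of_le hx.start_lt.le, uIcc_of_le hτ0]
    exact Icc_subset_Icc hx.start_pos.le le_rfl
  rw [h1, delegationPayoff, ← intervalIntegral.integral_add_adjacent_intervals
    (hint.mono_set hsub1) (hint.mono_set hsub2), mul_add, ← intervalIntegral.integral_const_mul,
    ← intervalIntegral.integral_const_mul]
  congr 2
  · refine intervalIntegral.integral_congr_ae ?_
    filter_upwards [hnex] with s hsx hsI
    rw [uIoc_of_le hx.start_pos.le] at hsI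
    have hsx' := lt_of_le_of_ne hsI.2 hsx
    rw [h2 s hsI.1.le (hsx'.trans hx.start_lt), hd0 s hsI.1.le hsx', hN1 s hsI.1.le hsx', survival,
      hFP0 s hsI.1.le hsx']
    ring
  · refine intervalIntegral.integral_congr_ae ?_
    filter_upwards [hneτ, hd, hs] with s hsτ hds hss hsI
    rw [uIoc_of_le hx.start_lt.le] at hsI
    have hsτ' := lt_of_le_of_ne hsI.2 hsτ
    rw [h2 s (hx.start_pos.le.trans hsI.1.le) hsτ', hds ⟨hsI.1, hsτ'⟩, hss ⟨hsI.1, hsτ'⟩,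
      hN s hsI.1.le hsI.2, mixingWeight]
    ring

/-- Almost surely the principal is not tempted to overrule the player with the authority. -/
theorem ae_noOverrule {θ : ℝ} (hvθ : v ≤ θ) (hθ1 : θ < 1)
    (hθ : ∀ t, 0 ≤ t → t < τ → (θ - M.μ) * M.fakeRate v t < M.μ * (1 - θ) * M.hazardExt t) :
    ∀ᵐ t, 0 ≤ t → M.NoOverrule θ e t := by
  obtain ⟨x, hx, hd0, -, -, -, hd, -⟩ := S.structure_theorem
  have hnex : ∀ᵐ s : ℝ, s ≠ x := by simp [ae_iff, measure_singleton]
  have hμθ := S.μ_lt.trans_le hvθ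
  filter_upwards [hnex, hd] with t htx htd ht
  refine noOverrule_of_newsGain_pos S.eq hvθ hμθ ht (S.atom_FA t) ?_
  rcases lt_or_ge t τ with h | h
  · rcases lt_or_gt_of_ne htx with h' | h'
    · exact newsGain_of_density_eq_zero hθ1 ht (hd0 t ht h')
    · exact newsGain_of_density_eq ht (htd ⟨h', h⟩) (hθ t ht h)
  · exact newsGain_of_density_eq_zero hθ1 ht
      (e.FA.density_eq_zero_of_not_supports (S.not_supports_FA_of_cutoff_le h))

end IsSearchEquilibrium

end NewsGame

/-! ### Construction of an equilibrium with beneficial search. -/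

lemma hasDerivAt_exp_neg_primitive {c : ℝ → ℝ} (hc : Continuous c) (x t : ℝ) :
    HasDerivAt (fun t => Real.exp (-∫ s in x..t, c s))
      (-(c t * Real.exp (-∫ s in x..t, c s))) t := by
  have h : HasDerivAt (fun t => ∫ s in x..t, c s) (c t) t :=
    intervalIntegral.integral_hasDerivAt_right (hc.intervalIntegrable _ _)
      (hc.stronglyMeasurableAtFilter _ _) hc.continuousAt
  convert! h.neg.exp using 1
  simp only [Pi.neg_apply]
  ring

lemma continuous_exp_neg_primitive {c : ℝ → ℝ} (hc : Continuous c) (x : ℝ) :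
    Continuous fun t => Real.exp (-∫ s in x..t, c s) :=
  continuous_iff_continuousAt.2 fun t => (hasDerivAt_exp_neg_primitive hc x t).continuousAt

lemma integral_mul_exp_neg_primitive {c : ℝ → ℝ} (hc : Continuous c) (x t : ℝ) :
    ∫ s in x..t, c s * Real.exp (-∫ r in x..s, c r) = 1 - Real.exp (-∫ s in x..t, c s) := by
  have h := intervalIntegral.integral_eq_sub_of_hasDerivAt (a := x) (b := t)
    (f := fun t => Real.exp (-∫ s in x..t, c s))
    (fun s _ => hasDerivAt_exp_neg_primitive hc x s)
    ((hc.mul (continuous_exp_neg_primitive hc x)).neg.intervalIntegrable _ _)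
  rw [intervalIntegral.integral_neg, intervalIntegral.integral_same, neg_zero, Real.exp_zero] at h
  linarith

namespace MixedTime

variable {c : ℝ → ℝ} {x τ z α : ℝ}

lemma integral_indicator_Ico_eq (hxτ : x ≤ τ) (φ : ℝ → ℝ) :
    ∫ t, (Ico x τ).indicator φ t = ∫ t in x..τ, φ t := by
  rw [integral_indicator measurableSet_Ico, intervalIntegral.integral_of_le hxτ,
    integral_Ico_eq_integral_Ioo, integral_Ioc_eq_integral_Ioo]

/-- Data of a strategy with hazard rate `c` between `x` and `τ`, scaled by `z`, and an atom of
mass `α` at `τ`. -/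
structure IsRate (c : ℝ → ℝ) (x τ z α : ℝ) : Prop where
  continuous : Continuous c
  start_nonneg : 0 ≤ x
  start_le : x ≤ τ
  rate_nonneg : ∀ t ∈ Icc x τ, 0 ≤ c t
  scale_nonneg : 0 ≤ z
  mass_nonneg : 0 ≤ α
  total_le : z * (1 - Real.exp (-∫ s in x..τ, c s)) + α ≤ 1

/-- The strategy with hazard rate `c` between `x` and `τ`, scaled by `z`, and an atom of mass `α`
at `τ`. -/
def ofRate (R : IsRate c x τ z α) : MixedTime where
  density := (Ico x τ).indicator fun t => z * (c t * Real.exp (-∫ s in x..t, c s))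
  atom := Pi.single τ α
  density_measurable := Measurable.indicator
    ((R.continuous.mul (continuous_exp_neg_primitive R.continuous x)).measurable.const_mul z)
    measurableSet_Ico
  density_nonneg t := by
    refine indicator_nonneg (fun t ht => ?_) t
    exact mul_nonneg R.scale_nonneg
      (mul_nonneg (R.rate_nonneg t ⟨ht.1, ht.2.le⟩) (Real.exp_pos _).le)
  density_of_neg t ht := indicator_of_notMem
    (fun h => absurd (R.start_nonneg.trans h.1) (not_le.2 ht)) _
  density_integrable := by
    rw [integrable_indicator_iff measurableSet_Ico]
    refine (Continuous.integrableOn_Icc ?_).mono_set Ico_subset_Icc_self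
    exact continuous_const.mul (R.continuous.mul (continuous_exp_neg_primitive R.continuous x))
  atom_nonneg t := by
    by_cases h : t = τ
    · rw [h, Pi.single_eq_same]; exact R.mass_nonneg
    · rw [Pi.single_eq_of_ne h]
  atom_of_neg t ht := Pi.single_eq_of_ne
    (ne_of_lt (ht.trans_le (R.start_nonneg.trans R.start_le))) _
  atom_summable := (hasSum_pi_single τ α).summable
  total_le_one := by
    rw [integral_indicator_Ico_eq R.start_le, tsum_pi_single, intervalIntegral.integral_const_mul,
      integral_mul_exp_neg_primitive R.continuous]
    exact R.total_le

section

variable (R : IsRate c x τ z α)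

lemma massTop_ofRate : (ofRate R).massTop
    = 1 - (z * (1 - Real.exp (-∫ s in x..τ, c s)) + α) := by
  simp only [massTop, ofRate]
  rw [integral_indicator_Ico_eq R.start_le, tsum_pi_single, intervalIntegral.integral_const_mul,
    integral_mul_exp_neg_primitive R.continuous]

lemma ofRate_density_of_mem {t : ℝ} (ht : t ∈ Ico x τ) :
    (ofRate R).density t = z * (c t * Real.exp (-∫ s in x..t, c s)) :=
  indicator_of_mem ht fun t => z * (c t * Real.exp (-∫ s in x..t, c s))

lemma ofRate_density_of_notMem {t : ℝ} (ht : t ∉ Ico x τ) :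
    (ofRate R).density t = 0 :=
  indicator_of_notMem ht fun t => z * (c t * Real.exp (-∫ s in x..t, c s))

lemma ofRate_atom_of_ne {t : ℝ} (ht : t ≠ τ) : (ofRate R).atom t = 0 :=
  Pi.single_eq_of_ne ht _

lemma ofRate_atom_self : (ofRate R).atom τ = α :=
  Pi.single_eq_same _ _

lemma mem_of_supports_ofRate {t : ℝ} (ht : (ofRate R).Supports t) :
    t ∈ Icc x τ := by
  by_contra hn
  rcases ht with h | h
  · rw [ofRate_density_of_notMem R fun h => hn ⟨h.1, h.2.le⟩] at h
    exact lt_irrefl _ h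
  · rw [ofRate_atom_of_ne R fun h => hn (by rw [h]; exact ⟨R.start_le, le_rfl⟩)] at h
    exact lt_irrefl _ h

lemma cdf_ofRate_of_le {t : ℝ} (h0 : 0 ≤ t) (ht : t < x) :
    (ofRate R).cdf t = 0 := by
  rw [cdf_eq_of_not_supports _ h0 fun r hr h => not_lt.2 (mem_of_supports_ofRate R h).1
    (hr.2.trans_lt ht), cdf_zero, ofRate_atom_of_ne R ((h0.trans_lt ht).trans_le R.start_le).ne]

lemma cdf_ofRate_of_mem {t : ℝ} (ht : x ≤ t) (htτ : t < τ) :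
    (ofRate R).cdf t = z * (1 - Real.exp (-∫ s in x..t, c s)) := by
  set F := ofRate R with hF
  have hatom : F.atomCdf t = 0 := by
    have : (Iic t).indicator F.atom = fun _ => 0 := by
      ext s
      by_cases hs : s ∈ Iic t
      · rw [indicator_of_mem hs, hF, ofRate_atom_of_ne R (lt_of_le_of_lt hs htτ).ne]
      · rw [indicator_of_notMem hs]
    simp [atomCdf, this]
  have hnex : ∀ᵐ s : ℝ, s ≠ x := by simp [ae_iff, measure_singleton]
  have h2 : ∫ s in (0 : ℝ)..x, F.density s = 0 := by
    refine intervalIntegral.integral_zero_ae ?_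
    filter_upwards [hnex] with s hs hsI
    rw [uIoc_of_le R.start_nonneg] at hsI
    exact ofRate_density_of_notMem R fun h => hs (le_antisymm hsI.2 h.1)
  have h3 : ∫ s in x..t, F.density s = ∫ s in x..t, z * (c s * Real.exp (-∫ r in x..s, c r)) := by
    refine intervalIntegral.integral_congr fun s hs => ?_
    rw [uIcc_of_le ht] at hs
    exact ofRate_density_of_mem R ⟨hs.1, hs.2.trans_lt htτ⟩
  rw [cdf_eq, hatom, add_zero, ← intervalIntegral.integral_add_adjacent_intervals
    (F.density_intervalIntegrable 0 x) (F.density_intervalIntegrable x t), h2, zero_add, h3,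
    intervalIntegral.integral_const_mul, integral_mul_exp_neg_primitive R.continuous]

lemma cdf_ofRate_of_ge {t : ℝ} (ht : τ ≤ t) :
    (ofRate R).cdf t = z * (1 - Real.exp (-∫ s in x..τ, c s)) + α := by
  rw [cdf_eq_total _ (R.start_nonneg.trans (R.start_le.trans ht)) fun r hr h =>
    not_lt.2 (mem_of_supports_ofRate R h).2 (ht.trans_lt hr), massTop_ofRate]
  ring

end

end MixedTime

namespace NewsGame

variable {M : NewsGame} {v x τ : ℝ}

/-- The stopping rate that makes the agent indifferent about the time of faking. -/
def stopRate (M : NewsGame) (s : ℝ) : ℝ := M.survivalRate s - (M.ρ + M.hazardExt s)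

lemma stopRate_continuous (M : NewsGame) : Continuous M.stopRate :=
  M.survivalRate_continuous.sub (continuous_const.add M.hazardExt_continuous)

lemma sub_mul_stopRate (M : NewsGame) (s : ℝ) :
    (M.μ - M.β) * M.stopRate s = M.β * (1 - M.μ) * M.hazardExt s - M.ρ * M.μ := by
  rw [stopRate, mul_sub, sub_mul_survivalRate]
  ring

lemma IsCutoff.stopRate_pos (h : M.IsCutoff v τ) (hμ : M.μ < 1) (hA : M.AssumptionA2 v) {s : ℝ}
    (hs : s ≤ τ) : 0 < M.stopRate s := by
  rw [← mul_pos_iff_of_pos_left (sub_pos.2 M.β_lt_μ), sub_mul_stopRate, sub_pos]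
  exact h.lt_hazardExt hμ hA hs

lemma discount_eq_mul_exp (M : NewsGame) (x t : ℝ) :
    M.discount t = M.discount x * Real.exp (-∫ s in x..t, (M.ρ + M.hazardExt s)) := by
  rw [intervalIntegral.integral_add intervalIntegrable_const
    (M.hazardExt_continuous.intervalIntegrable _ _), intervalIntegral.integral_const, smul_eq_mul,
    discount, discount, ← Real.exp_add,
    ← intervalIntegral.integral_add_adjacent_intervals
      (M.hazardExt_continuous.intervalIntegrable 0 x)
      (M.hazardExt_continuous.intervalIntegrable x t)]
  congr 1
  ring

/-- The discount factor decays at the rate `ρ + H`; stopping adds exactly what is missing to the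
rate `survivalRate`. -/
lemma discount_mul_exp_stopRate (M : NewsGame) (x t : ℝ) :
    M.discount t * Real.exp (-∫ s in x..t, M.stopRate s)
      = M.discount x * Real.exp (-∫ s in x..t, M.survivalRate s) := by
  have h1 : IntervalIntegrable (fun s => M.ρ + M.hazardExt s) volume x t :=
    (continuous_const.add M.hazardExt_continuous).intervalIntegrable _ _
  rw [M.discount_eq_mul_exp x t, mul_assoc, ← Real.exp_add, ← neg_add,
    ← intervalIntegral.integral_add h1
      (M.stopRate_continuous.intervalIntegrable _ _)]
  simp only [stopRate, add_sub_cancel]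

/-- The scale `1 / σ` solves `1 - σ * F = exp (-∫ fakeRate)` for the distribution function `F`. As
the cumulated rate is `totalFake`, the mass is exactly one without an atom. -/
lemma IsSchedule.fakingRate (h : M.IsSchedule v x τ) (hv : M.μ < v) (hv1 : v < 1) :
    MixedTime.IsRate (M.fakeRate v) x τ (1 / M.σ) 0 where
  continuous := M.fakeRate_continuous v
  start_nonneg := h.start_pos.le
  start_le := h.start_lt.le
  rate_nonneg t ht := by
    rcases ht.2.lt_or_eq with h1 | h1
    · exact (h.cutoff.fakeRate_pos hv hv1 h1).le
    · rw [h1, fakeRate, h.cutoff.2, mul_phiP hv1, sub_self, zero_div]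
  scale_nonneg := (one_div_pos.2 M.σ_pos).le
  mass_nonneg := le_rfl
  total_le := by
    rw [h.integral_fakeRate, exp_neg_totalFake, add_zero, sub_sub_cancel,
      one_div_mul_cancel M.σ_pos.ne']

/-- The probability not yet used up by the stopping rate becomes an atom at `τ`. The rate is
positive up to `τ` by `AssumptionA2`. -/
lemma IsSchedule.stoppingRate (h : M.IsSchedule v x τ) (hμ : M.μ < 1) (hA : M.AssumptionA2 v) :
    MixedTime.IsRate M.stopRate x τ 1 (Real.exp (-∫ s in x..τ, M.stopRate s)) where
  continuous := M.stopRate_continuous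
  start_nonneg := h.start_pos.le
  start_le := h.start_lt.le
  rate_nonneg _ ht := (h.cutoff.stopRate_pos hμ hA ht.2).le
  scale_nonneg := zero_le_one
  mass_nonneg := (Real.exp_pos _).le
  total_le := by rw [one_mul, sub_add_cancel]

/-- The equilibrium with beneficial search. -/
def IsSchedule.profile (h : M.IsSchedule v x τ) (hv : M.μ < v) (hv1 : v < 1)
    (hA : M.AssumptionA2 v) : Profile where
  a := fun _ => 1
  a_measurable := measurable_const
  a_nonneg := fun _ => zero_le_one
  a_le_one := fun _ => le_rfl
  FA := MixedTime.ofRate (h.fakingRate hv hv1)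
  FP := MixedTime.ofRate (h.stoppingRate (hv.trans hv1) hA)

namespace IsSchedule

variable (h : M.IsSchedule v x τ) (hv : M.μ < v) (hv1 : v < 1) (hA : M.AssumptionA2 v)

lemma profile_a (t : ℝ) : (h.profile hv hv1 hA).a t = 1 := rfl

lemma profile_FA_atom (t : ℝ) : (h.profile hv hv1 hA).FA.atom t = 0 := by
  by_cases ht : t = τ
  · rw [ht]; exact MixedTime.ofRate_atom_self (h.fakingRate hv hv1)
  · exact MixedTime.ofRate_atom_of_ne (h.fakingRate hv hv1) ht

lemma profile_FA_massTop : (h.profile hv hv1 hA).FA.massTop = 0 := by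
  have h1 : (h.profile hv hv1 hA).FA.massTop
      = 1 - (1 / M.σ * (1 - Real.exp (-∫ s in x..τ, M.fakeRate v s)) + 0) :=
    MixedTime.massTop_ofRate (h.fakingRate hv hv1)
  rw [h1, h.integral_fakeRate, exp_neg_totalFake, add_zero, sub_sub_cancel,
    one_div_mul_cancel M.σ_pos.ne', sub_self]

lemma profile_FP_massTop : (h.profile hv hv1 hA).FP.massTop = 0 := by
  have h1 : (h.profile hv hv1 hA).FP.massTop
      = 1 - (1 * (1 - Real.exp (-∫ s in x..τ, M.stopRate s))
        + Real.exp (-∫ s in x..τ, M.stopRate s)) :=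
    MixedTime.massTop_ofRate (h.stoppingRate (hv.trans hv1) hA)
  rw [h1]; ring

lemma profile_noFake_of_mem {t : ℝ} (ht : x ≤ t) (htτ : t < τ) :
    M.noFake (h.profile hv hv1 hA) t = Real.exp (-∫ s in x..t, M.fakeRate v s) := by
  have h1 : (h.profile hv hv1 hA).FA.cdf t
      = 1 / M.σ * (1 - Real.exp (-∫ s in x..t, M.fakeRate v s)) :=
    MixedTime.cdf_ofRate_of_mem (h.fakingRate hv hv1) ht htτ
  rw [noFake, h1, ← mul_assoc, mul_one_div_cancel M.σ_pos.ne']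
  ring

lemma profile_density_of_mem {t : ℝ} (ht : x ≤ t) (htτ : t < τ) :
    M.σ * (h.profile hv hv1 hA).FA.density t
      = M.fakeRate v t * M.noFake (h.profile hv hv1 hA) t := by
  have h1 : (h.profile hv hv1 hA).FA.density t
      = 1 / M.σ * (M.fakeRate v t * Real.exp (-∫ s in x..t, M.fakeRate v s)) :=
    MixedTime.ofRate_density_of_mem (h.fakingRate hv hv1) ⟨ht, htτ⟩
  rw [h.profile_noFake_of_mem hv hv1 hA ht htτ, h1, ← mul_assoc,
    mul_one_div_cancel M.σ_pos.ne', one_mul]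

lemma profile_density_of_notMem {t : ℝ} (ht : t ∉ Ico x τ) :
    (h.profile hv hv1 hA).FA.density t = 0 :=
  MixedTime.ofRate_density_of_notMem (h.fakingRate hv hv1) ht

lemma profile_newsGain_pos {θ : ℝ} (hθ1 : θ < 1)
    (hθ : ∀ t, 0 ≤ t → t < τ → (θ - M.μ) * M.fakeRate v t < M.μ * (1 - θ) * M.hazardExt t)
    {t : ℝ} (ht : 0 ≤ t) : 0 < M.newsGain (h.profile hv hv1 hA) θ t := by
  by_cases hm : t ∈ Ico x τ
  · exact newsGain_of_density_eq ht (h.profile_density_of_mem hv hv1 hA hm.1 hm.2)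
      (hθ t ht hm.2)
  · exact newsGain_of_density_eq_zero hθ1 ht (h.profile_density_of_notMem hv hv1 hA hm)

lemma profile_lt_belief {t : ℝ} (ht : 0 ≤ t) : v < M.belief (h.profile hv hv1 hA) t := by
  rw [M.lt_belief_iff _ v ht (h.profile_FA_atom hv hv1 hA t)]
  -- At the indifference rate the gain from type-1 news must still pay for the delay cost `ρ * v`,
  -- so the posterior exceeds `v` strictly.
  refine h.profile_newsGain_pos hv hv1 hA hv1 (fun s _ _ => ?_) ht
  rw [sub_mul_fakeRate hv]
  have := mul_pos M.ρ_pos (M.μ_pos.trans hv)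
  linarith

lemma profile_searchPayoff {t : ℝ} (ht : 0 ≤ t) :
    M.searchPayoff v (h.profile hv hv1 hA) t
      = v + ∫ s in (0 : ℝ)..t, M.searchFlow (h.profile hv hv1 hA) v s :=
  M.searchPayoff_eq _ (hv.trans hv1) v
    (fun t _ h0 => absurd h0 (by rw [profile_FA_atom]; exact lt_irrefl _)) ht

lemma profile_searchPayoff_sub {s t : ℝ} (hs : 0 ≤ s) (ht : 0 ≤ t) :
    M.searchPayoff v (h.profile hv hv1 hA) t - M.searchPayoff v (h.profile hv hv1 hA) s
      = ∫ r in s..t, M.searchFlow (h.profile hv hv1 hA) v r := by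
  rw [h.profile_searchPayoff hv hv1 hA hs, h.profile_searchPayoff hv hv1 hA ht,
    ← intervalIntegral.integral_add_adjacent_intervals (M.searchFlow_integrable _ v le_rfl hs)
      (M.searchFlow_integrable _ v hs ht)]
  ring

lemma profile_searchFlow (t : ℝ) : M.searchFlow (h.profile hv hv1 hA) v t
    = M.discount t * ((v - M.μ) * (M.fakeRate v t * M.noFake (h.profile hv hv1 hA) t
      - M.σ * (h.profile hv hv1 hA).FA.density t)) :=
  searchFlow_of_a_eq_one hv (h.profile_a hv hv1 hA t)

lemma profile_searchFlow_of_notMem {t : ℝ} (ht : t ∉ Ico x τ) :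
    M.searchFlow (h.profile hv hv1 hA) v t
      = M.discount t * ((v - M.μ) * (M.fakeRate v t * M.noFake (h.profile hv hv1 hA) t)) := by
  rw [profile_searchFlow, h.profile_density_of_notMem hv hv1 hA ht, mul_zero, sub_zero]

lemma profile_searchPayoff_lt {t : ℝ} (ht : 0 ≤ t) (htx : t < x) :
    M.searchPayoff v (h.profile hv hv1 hA) t < M.searchPayoff v (h.profile hv hv1 hA) x := by
  have h1 := h.profile_searchPayoff_sub hv hv1 hA ht h.start_pos.le
  have h2 : 0 < ∫ r in t..x, M.searchFlow (h.profile hv hv1 hA) v r := by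
    refine intervalIntegral.intervalIntegral_pos_of_pos_on
      (M.searchFlow_integrable _ v ht h.start_pos.le) (fun r hr => ?_) htx
    rw [h.profile_searchFlow_of_notMem hv hv1 hA fun hm => not_lt.2 hm.1 hr.2]
    exact mul_pos (M.discount_pos r) (mul_pos (sub_pos.2 hv)
      (mul_pos (h.cutoff.fakeRate_pos hv hv1 (hr.2.trans h.start_lt))
        (M.noFake_pos _ (ht.trans hr.1.le))))
  linarith

lemma profile_searchPayoff_eq {t : ℝ} (hxt : x ≤ t) (htτ : t ≤ τ) :
    M.searchPayoff v (h.profile hv hv1 hA) t = M.searchPayoff v (h.profile hv hv1 hA) x := by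
  have h1 := h.profile_searchPayoff_sub hv hv1 hA h.start_pos.le (h.start_pos.le.trans hxt)
  have hneτ : ∀ᵐ s : ℝ, s ≠ τ := by simp [ae_iff, measure_singleton]
  have h2 : ∫ r in x..t, M.searchFlow (h.profile hv hv1 hA) v r = 0 := by
    refine intervalIntegral.integral_zero_ae ?_
    filter_upwards [hneτ] with s hs hsI
    rw [uIoc_of_le hxt] at hsI
    rw [profile_searchFlow, h.profile_density_of_mem hv hv1 hA hsI.1.le
      (lt_of_le_of_ne (hsI.2.trans htτ) hs), sub_self, mul_zero, mul_zero]
  linarith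

/-- The payoff rises up to `x`, is constant up to `τ`, where fakes offset the gain, and does not
increase afterwards. -/
lemma profile_searchPayoff_le {t : ℝ} (ht : 0 ≤ t) :
    M.searchPayoff v (h.profile hv hv1 hA) t ≤ M.searchPayoff v (h.profile hv hv1 hA) x := by
  rcases lt_or_ge t x with h1 | h1
  · exact (h.profile_searchPayoff_lt hv hv1 hA ht h1).le
  rcases le_or_gt t τ with h2 | h2
  · exact (h.profile_searchPayoff_eq hv hv1 hA h1 h2).le
  rw [← h.profile_searchPayoff_eq hv hv1 hA h.start_lt.le le_rfl]
  have h3 := h.profile_searchPayoff_sub hv hv1 hA h.cutoff.1.le ht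
  have h4 : ∫ r in τ..t, M.searchFlow (h.profile hv hv1 hA) v r ≤ ∫ r in τ..t, (0 : ℝ) := by
    refine intervalIntegral.integral_mono_on_of_le_Ioo h2.le
      (M.searchFlow_integrable _ v h.cutoff.1.le ht) intervalIntegrable_const fun r hr => ?_
    rw [h.profile_searchFlow_of_notMem hv hv1 hA fun hm => not_lt.2 hr.1.le hm.2]
    exact (mul_neg_of_pos_of_neg (M.discount_pos r) (mul_neg_of_pos_of_neg (sub_pos.2 hv)
      (mul_neg_of_neg_of_pos (h.cutoff.fakeRate_neg hv hv1 hr.1)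
        (M.noFake_pos _ (h.cutoff.1.le.trans hr.1.le))))).le
  rw [intervalIntegral.integral_zero] at h4
  linarith

lemma profile_searchPayoffTop_le :
    M.searchPayoffTop v (h.profile hv hv1 hA) ≤ M.searchPayoff v (h.profile hv hv1 hA) x := by
  refine le_of_tendsto (M.tendsto_searchPayoff _ (hv.trans hv1) v) ?_
  filter_upwards [eventually_ge_atTop 0] with t ht using h.profile_searchPayoff_le hv hv1 hA ht

lemma profile_searchPayoff_of_supports {t : ℝ} (ht : (h.profile hv hv1 hA).FP.Supports t) :
    M.searchPayoff v (h.profile hv hv1 hA) t = M.searchPayoff v (h.profile hv hv1 hA) x := by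
  have h1 : t ∈ Icc x τ := MixedTime.mem_of_supports_ofRate (h.stoppingRate (hv.trans hv1) hA) ht
  exact h.profile_searchPayoff_eq hv hv1 hA h1.1 h1.2

lemma profile_lt_payoff : v < M.payoff v (h.profile hv hv1 hA) := by
  rw [payoff, MixedTime.expectation, profile_FP_massTop,
    MixedTime.integral_congr_supports _ (fun t ht =>
      h.profile_searchPayoff_of_supports hv hv1 hA ht), MixedTime.integral_const,
    profile_FP_massTop, sub_zero, mul_one, zero_mul, add_zero]
  have h1 := h.profile_searchPayoff_lt hv hv1 hA le_rfl h.start_pos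
  rwa [h.profile_searchPayoff hv hv1 hA le_rfl, intervalIntegral.integral_same, add_zero] at h1

lemma profile_survival_of_lt {t : ℝ} (h0 : 0 ≤ t) (ht : t < x) :
    M.survival (h.profile hv hv1 hA) t = M.discount t := by
  have h1 : (h.profile hv hv1 hA).FP.cdf t = 0 :=
    MixedTime.cdf_ofRate_of_le (h.stoppingRate (hv.trans hv1) hA) h0 ht
  rw [survival, h1, sub_zero, mul_one]

lemma profile_survival_of_mem {t : ℝ} (hxt : x ≤ t) (ht : t < τ) :
    M.survival (h.profile hv hv1 hA) t
      = M.discount x * Real.exp (-∫ s in x..t, M.survivalRate s) := by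
  have h1 : (h.profile hv hv1 hA).FP.cdf t
      = 1 * (1 - Real.exp (-∫ s in x..t, M.stopRate s)) :=
    MixedTime.cdf_ofRate_of_mem (h.stoppingRate (hv.trans hv1) hA) hxt ht
  rw [survival, h1, one_mul, sub_sub_cancel, discount_mul_exp_stopRate]

lemma profile_cdf_FP : (h.profile hv hv1 hA).FP.cdf τ = 1 := by
  have h1 : (h.profile hv hv1 hA).FP.cdf τ
      = 1 * (1 - Real.exp (-∫ s in x..τ, M.stopRate s))
        + Real.exp (-∫ s in x..τ, M.stopRate s) :=
    MixedTime.cdf_ofRate_of_ge (h.stoppingRate (hv.trans hv1) hA) le_rfl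
  rw [h1]; ring

lemma profile_integral_waitFlow {t : ℝ} (hxt : x ≤ t) (htτ : t ≤ τ) :
    ∫ s in x..t, M.waitFlow (h.profile hv hv1 hA) s
      = (M.μ - M.β) * (M.discount x
        * (1 - Real.exp (-∫ s in x..t, M.survivalRate s))) := by
  have hneτ : ∀ᵐ s : ℝ, s ≠ τ := by simp [ae_iff, measure_singleton]
  rw [← integral_mul_exp_neg_primitive M.survivalRate_continuous,
    ← intervalIntegral.integral_const_mul, ← intervalIntegral.integral_const_mul]
  refine intervalIntegral.integral_congr_ae ?_
  filter_upwards [hneτ] with s hs hsI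
  rw [uIoc_of_le hxt] at hsI
  rw [waitFlow, h.profile_survival_of_mem hv hv1 hA hsI.1.le
    (lt_of_le_of_ne (hsI.2.trans htτ) hs), profile_a, mul_one, ← M.sub_mul_survivalRate]
  ring

lemma profile_survival_start : M.survival (h.profile hv hv1 hA) x = M.discount x := by
  rw [h.profile_survival_of_mem hv hv1 hA le_rfl h.start_lt, intervalIntegral.integral_same,
    neg_zero, Real.exp_zero, mul_one]

lemma profile_agentPayoff_of_mem {t : ℝ} (hxt : x ≤ t) (htτ : t < τ) :
    M.agentPayoff (h.profile hv hv1 hA) t = M.agentPayoff (h.profile hv hv1 hA) x := by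
  have h1 := M.agentPayoff_sub (h.profile hv hv1 hA) h.start_pos.le (h.start_pos.le.trans hxt)
  rw [h.profile_integral_waitFlow hv hv1 hA hxt htτ.le, h.profile_survival_start,
    h.profile_survival_of_mem hv hv1 hA hxt htτ, profile_a, profile_a] at h1
  linarith

/-- Nobody stops before `x` and news is trusted, so `AssumptionA2` makes waiting until `x` at least
as good. -/
lemma profile_agentPayoff_le_of_lt {t : ℝ} (ht : 0 ≤ t) (htx : t < x) :
    M.agentPayoff (h.profile hv hv1 hA) t ≤ M.agentPayoff (h.profile hv hv1 hA) x := by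
  have h1 := M.agentPayoff_sub (h.profile hv hv1 hA) ht h.start_pos.le
  rw [h.profile_survival_start, h.profile_survival_of_lt hv hv1 hA ht htx, profile_a,
    profile_a] at h1
  have hd := M.discount_sub t x
  have c1 : Continuous fun r => (M.μ - M.β) * (M.discount r * (M.ρ + M.hazardExt r)) :=
    continuous_const.mul (M.discount_continuous.mul
      (continuous_const.add M.hazardExt_continuous))
  have h2 : ∫ r in t..x, (M.μ - M.β) * (M.discount r * (M.ρ + M.hazardExt r))
      ≤ ∫ r in t..x, M.waitFlow (h.profile hv hv1 hA) r := by
    refine intervalIntegral.integral_mono_on_of_le_Ioo htx.le (c1.intervalIntegrable _ _)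
      (M.waitFlow_integrable _ ht h.start_pos.le) fun r hr => ?_
    have e1 := h.cutoff.lt_hazardExt (hv.trans hv1) hA (hr.2.trans h.start_lt).le
    rw [waitFlow, h.profile_survival_of_lt hv hv1 hA (ht.trans hr.1.le) hr.2, profile_a, mul_one]
    have e2 : 0 ≤ M.discount r * (M.β * (1 - M.μ) * M.hazardExt r - M.ρ * M.μ) :=
      mul_nonneg (M.discount_pos r).le (by linarith)
    linarith
  rw [intervalIntegral.integral_const_mul] at h2
  have h3 : (M.μ - M.β) * (∫ r in t..x, M.discount r * (M.ρ + M.hazardExt r))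
      = (M.μ - M.β) * (M.discount t - M.discount x) := by
    congr 1; linarith
  rw [h3] at h2
  linarith

/-- The left side is the payoff from faking too late or never. It falls short by the premium `μ - β`
times the left limit of survival at `τ`. -/
lemma profile_end_le : M.β + ∫ s in (0 : ℝ)..τ, M.waitFlow (h.profile hv hv1 hA) s
    ≤ M.agentPayoff (h.profile hv hv1 hA) x := by
  rw [M.agentPayoff_eq _ h.start_pos.le, h.profile_survival_start, profile_a, mul_one,
    ← intervalIntegral.integral_add_adjacent_intervals
      (M.waitFlow_intervalIntegrable _ h.start_pos.le)
      (M.waitFlow_integrable _ h.start_pos.le h.cutoff.1.le),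
    h.profile_integral_waitFlow hv hv1 hA h.start_lt.le le_rfl]
  have h1 : 0 ≤ (M.μ - M.β) * (M.discount x * Real.exp (-∫ s in x..τ, M.survivalRate s)) :=
    mul_nonneg (sub_pos.2 M.β_lt_μ).le (mul_pos (M.discount_pos x) (Real.exp_pos _)).le
  linarith

lemma profile_agentPayoff_le {t : ℝ} (ht : 0 ≤ t) :
    M.agentPayoff (h.profile hv hv1 hA) t ≤ M.agentPayoff (h.profile hv hv1 hA) x := by
  rcases lt_or_ge t x with h1 | h1
  · exact h.profile_agentPayoff_le_of_lt hv hv1 hA ht h1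
  rcases lt_or_ge t τ with h2 | h2
  · exact (h.profile_agentPayoff_of_mem hv hv1 hA h1 h2).le
  rw [M.agentPayoff_of_end h.cutoff.1.le (h.profile_cdf_FP hv hv1 hA) h2]
  exact h.profile_end_le hv hv1 hA

/-- The profile is an equilibrium with beneficial search. -/
theorem isBeneficialEquilibrium_profile :
    M.IsBeneficialEquilibrium v (h.profile hv hv1 hA) := by
  refine ⟨⟨⟨fun t _ hs => ?_, fun hm => ?_⟩, fun _ _ _ => rfl, fun t ht hlt => ?_,
    ⟨fun t _ hs => ?_, fun hm => ?_⟩⟩, h.profile_lt_payoff hv hv1 hA⟩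
  · have hs' : t ∈ Icc x τ := MixedTime.mem_of_supports_ofRate (h.fakingRate hv hv1) hs
    have htτ : t < τ := by
      refine lt_of_le_of_ne hs'.2 fun ht => ?_
      rcases hs with h1 | h1
      · rw [h.profile_density_of_notMem hv hv1 hA fun hm => hm.2.ne ht] at h1
        exact lt_irrefl _ h1
      · rw [profile_FA_atom] at h1
        exact lt_irrefl _ h1
    rw [h.profile_agentPayoff_of_mem hv hv1 hA hs'.1 htτ]
    refine ⟨fun s hs => h.profile_agentPayoff_le hv hv1 hA hs, ?_⟩
    rw [M.agentPayoffTop_of_end (hv.trans hv1) h.cutoff.1.le (h.profile_cdf_FP hv hv1 hA)]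
    exact h.profile_end_le hv hv1 hA
  · rw [profile_FA_massTop] at hm
    exact absurd hm (lt_irrefl _)
  · exact absurd hlt (not_lt.2 (h.profile_lt_belief hv hv1 hA ht).le)
  · rw [h.profile_searchPayoff_of_supports hv hv1 hA hs]
    exact ⟨fun s hs => h.profile_searchPayoff_le hv hv1 hA hs,
      h.profile_searchPayoffTop_le hv hv1 hA⟩
  · rw [profile_FP_massTop] at hm
    exact absurd hm (lt_irrefl _)

theorem profile_noOverrule {θ : ℝ} (hvθ : v ≤ θ) (hθ1 : θ < 1)
    (hθ : ∀ t, 0 ≤ t → t < τ → (θ - M.μ) * M.fakeRate v t < M.μ * (1 - θ) * M.hazardExt t)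
    {t : ℝ} (ht : 0 ≤ t) : M.NoOverrule θ (h.profile hv hv1 hA) t :=
  noOverrule_of_newsGain_pos (h.isBeneficialEquilibrium_profile hv hv1 hA).1 hvθ
    (hv.trans_le hvθ) ht (h.profile_FA_atom hv hv1 hA t)
    (h.profile_newsGain_pos hv hv1 hA hθ1 hθ ht)

end IsSchedule

end NewsGame

/-! ### Dependence on the safe payoff of the intermediary and the derivative of the payoff. -/

lemma tendsto_intervalIntegral_of_continuous {ι : Type*} {l : Filter ι} {f : ℝ → ℝ}
    (hf : Continuous f) {a b : ι → ℝ} {x t : ℝ} (ha : Tendsto a l (𝓝 x))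
    (hb : Tendsto b l (𝓝 t)) :
    Tendsto (fun i => ∫ s in a i..b i, f s) l (𝓝 (∫ s in x..t, f s)) := by
  have hc := intervalIntegral.continuous_primitive
    (fun c d => hf.intervalIntegrable (μ := volume) c d) 0
  have key : ∀ c d : ℝ, ∫ s in c..d, f s = (∫ s in (0 : ℝ)..d, f s) - ∫ s in (0 : ℝ)..c, f s :=
    fun c d => (intervalIntegral.integral_interval_sub_left (hf.intervalIntegrable _ _)
      (hf.intervalIntegrable _ _)).symm
  rw [key x t]
  exact (((hc.tendsto t).comp hb).sub ((hc.tendsto x).comp ha)).congr fun i => (key _ _).symm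

/-- The increments of two functions near `x` are proportional up to a factor that converges to
the ratio of their derivatives. -/
lemma exists_tendsto_factor {A B : ℝ → ℝ} {x a b : ℝ} (hA : HasDerivAt A a x)
    (hB : HasDerivAt B b x) (hb : b ≠ 0) :
    ∃ C : ℝ → ℝ, Tendsto C (𝓝 x) (𝓝 (a / b)) ∧
      ∀ᶠ y in 𝓝 x, A y - A x = C y * (B y - B x) := by
  have hA' : Tendsto (dslope A x) (𝓝 x) (𝓝 a) := by
    have := (continuousAt_dslope_same.2 hA.differentiableAt).tendsto
    rwa [dslope_same, hA.deriv] at this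
  have hB' : Tendsto (dslope B x) (𝓝 x) (𝓝 b) := by
    have := (continuousAt_dslope_same.2 hB.differentiableAt).tendsto
    rwa [dslope_same, hB.deriv] at this
  refine ⟨fun y => dslope A x y / dslope B x y, hA'.div hB' hb, ?_⟩
  filter_upwards [hB'.eventually_ne hb] with y hy
  rw [← sub_smul_dslope A x y, ← sub_smul_dslope B x y, smul_eq_mul, smul_eq_mul]
  field_simp

namespace NewsGame

variable {M : NewsGame} {θ x₀ τ₀ : ℝ}

/-- The coefficient of `1 / (v - μ)` in the rate of fake news. -/
def newsExcess (M : NewsGame) (s : ℝ) : ℝ := M.μ * ((1 - M.μ) * M.hazardExt s - M.ρ)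

lemma newsExcess_continuous (M : NewsGame) : Continuous M.newsExcess := by
  have := M.hazardExt_continuous
  unfold newsExcess
  fun_prop

/-- The rate is affine in `1 / (v - μ)`. Changes of `v` thus act through a single scalar times
`newsExcess`. -/
lemma fakeRate_eq {v : ℝ} (hv : M.μ < v) (s : ℝ) :
    M.fakeRate v s = (v - M.μ)⁻¹ * M.newsExcess s - (M.μ * M.hazardExt s + M.ρ) := by
  have := (sub_pos.2 hv).ne'
  rw [fakeRate, newsExcess]
  field_simp
  ring

lemma integral_fakeRate_eq {v : ℝ} (hv : M.μ < v) (a b : ℝ) :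
    ∫ s in a..b, M.fakeRate v s
      = (v - M.μ)⁻¹ * (∫ s in a..b, M.newsExcess s) - ∫ s in a..b, (M.μ * M.hazardExt s + M.ρ) := by
  have c2 : Continuous fun s => M.μ * M.hazardExt s + M.ρ :=
    (continuous_const.mul M.hazardExt_continuous).add continuous_const
  have c1 : Continuous fun s => (v - M.μ)⁻¹ * M.newsExcess s :=
    continuous_const.mul M.newsExcess_continuous
  rw [← intervalIntegral.integral_const_mul, ← intervalIntegral.integral_sub
    (c1.intervalIntegrable _ _) (c2.intervalIntegrable _ _)]
  exact intervalIntegral.integral_congr fun s _ => fakeRate_eq hv s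

lemma integral_fakeRate_sub {v : ℝ} (hv : M.μ < v) (hθ : M.μ < θ) (a b : ℝ) :
    (∫ s in a..b, M.fakeRate v s) - ∫ s in a..b, M.fakeRate θ s
      = ((v - M.μ)⁻¹ - (θ - M.μ)⁻¹) * ∫ s in a..b, M.newsExcess s := by
  rw [integral_fakeRate_eq hv, integral_fakeRate_eq hθ]
  ring

lemma tendsto_integral_fakeRate (hθ : M.μ < θ) {a b : ℝ → ℝ} {x t : ℝ}
    (ha : Tendsto a (𝓝 θ) (𝓝 x)) (hb : Tendsto b (𝓝 θ) (𝓝 t)) :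
    Tendsto (fun v => ∫ s in a v..b v, M.fakeRate v s) (𝓝 θ) (𝓝 (∫ s in x..t, M.fakeRate θ s)) := by
  have c2 : Continuous fun s => M.μ * M.hazardExt s + M.ρ :=
    (continuous_const.mul M.hazardExt_continuous).add continuous_const
  have h1 : Tendsto (fun v : ℝ => (v - M.μ)⁻¹) (𝓝 θ) (𝓝 (θ - M.μ)⁻¹) :=
    (tendsto_id.sub_const M.μ).inv₀ (sub_pos.2 hθ).ne'
  rw [integral_fakeRate_eq hθ]
  refine ((h1.mul (tendsto_intervalIntegral_of_continuous M.newsExcess_continuous ha hb)).sub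
    (tendsto_intervalIntegral_of_continuous c2 ha hb)).congr' ?_
  filter_upwards [lt_mem_nhds hθ] with v hv
  rw [integral_fakeRate_eq hv]

lemma tendsto_integral_mixingWeight (hθ : M.μ < θ) {a b : ℝ → ℝ} {x t : ℝ}
    (ha : Tendsto a (𝓝 θ) (𝓝 x)) (hb : Tendsto b (𝓝 θ) (𝓝 t)) :
    Tendsto (fun v => ∫ s in a v..b v, M.mixingWeight v (a v) s * M.newsExcess s) (𝓝 θ)
      (𝓝 (∫ s in x..t, M.mixingWeight θ x s * M.newsExcess s)) := by
  have c2 : Continuous fun s => M.μ * M.hazardExt s + M.ρ :=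
    (continuous_const.mul M.hazardExt_continuous).add continuous_const
  have prim : ∀ f : ℝ → ℝ, Continuous f → Continuous fun y => ∫ s in (0 : ℝ)..y, f s := fun f hf =>
    intervalIntegral.continuous_primitive (fun c d => hf.intervalIntegrable c d) 0
  have key : ∀ f : ℝ → ℝ, Continuous f → ∀ c d : ℝ,
      ∫ s in c..d, f s = (∫ s in (0 : ℝ)..d, f s) - ∫ s in (0 : ℝ)..c, f s := fun f hf c d =>
    (intervalIntegral.integral_interval_sub_left (hf.intervalIntegrable _ _)
      (hf.intervalIntegrable _ _)).symm
  have p1 := prim _ M.survivalRate_continuous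
  have p2 := prim _ M.newsExcess_continuous
  have p3 := prim _ c2
  have c1 := M.newsExcess_continuous
  have cd := M.discount_continuous
  set S := fun y => ∫ s in (0 : ℝ)..y, M.survivalRate s with hS
  set P := fun y => ∫ s in (0 : ℝ)..y, M.newsExcess s with hP
  set Q := fun y => ∫ s in (0 : ℝ)..y, (M.μ * M.hazardExt s + M.ρ) with hQ
  -- The parameter `p` consists of `1 / (v - μ)` and the two limits of integration. With all inner
  -- integrals written through primitives from `0`, the integrand is jointly continuous.
  let W : ℝ × ℝ × ℝ → ℝ → ℝ := fun p s => M.discount p.2.1 * Real.exp (-(S s - S p.2.1))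
    * Real.exp (-(p.1 * (P s - P p.2.1) - (Q s - Q p.2.1))) * M.newsExcess s
  have cW : Continuous (Function.uncurry W) := by
    simp only [W, Function.uncurry_def]
    fun_prop
  have hW : ∀ v, M.μ < v → ∀ y s, M.mixingWeight v y s * M.newsExcess s
      = W ((v - M.μ)⁻¹, y, s) s := by
    intro v hv y s
    simp only [W, mixingWeight, integral_fakeRate_eq hv, key _ M.survivalRate_continuous y s,
      key _ M.newsExcess_continuous y s, key _ c2 y s, hS, hP, hQ]
  have cI : Continuous fun p : ℝ × ℝ × ℝ => (∫ s in (0 : ℝ)..p.2.2, W p s)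
      - ∫ s in (0 : ℝ)..p.2.1, W p s :=
    (intervalIntegral.continuous_parametric_intervalIntegral_of_continuous cW
      (continuous_snd.comp continuous_snd)).sub
    (intervalIntegral.continuous_parametric_intervalIntegral_of_continuous cW
      (continuous_fst.comp continuous_snd))
  have hI : ∀ v, M.μ < v → ∀ y z, ∫ s in y..z, M.mixingWeight v y s * M.newsExcess s
      = (∫ s in (0 : ℝ)..z, W ((v - M.μ)⁻¹, y, z) s)
        - ∫ s in (0 : ℝ)..y, W ((v - M.μ)⁻¹, y, z) s := by
    intro v hv y z
    have cw : Continuous (W ((v - M.μ)⁻¹, y, z)) := cW.comp (Continuous.prodMk_right _)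
    rw [← key _ cw]
    exact intervalIntegral.integral_congr fun s _ => hW v hv y s
  have h1 : Tendsto (fun v : ℝ => (v - M.μ)⁻¹) (𝓝 θ) (𝓝 (θ - M.μ)⁻¹) :=
    (tendsto_id.sub_const M.μ).inv₀ (sub_pos.2 hθ).ne'
  rw [hI θ hθ]
  refine ((cI.tendsto ((θ - M.μ)⁻¹, x, t)).comp (h1.prodMk_nhds (ha.prodMk_nhds hb))).congr' ?_
  filter_upwards [lt_mem_nhds hθ] with v hv
  rw [hI v hv]
  rfl

lemma continuousAt_phiP (hθ1 : θ < 1) : ContinuousAt M.phiP θ := by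
  unfold phiP
  refine ContinuousAt.div (by fun_prop) (by fun_prop) ?_
  exact (mul_pos M.μ_pos (sub_pos.2 hθ1)).ne'

lemma Admissible.eventually (h : M.Admissible θ) : ∀ᶠ v in 𝓝 θ, M.Admissible v := by
  obtain ⟨hθ, hθ1, ⟨h0, hTop, hlim, hlt⟩, h2⟩ := h
  have hc := (continuousAt_phiP (M := M) hθ1).tendsto
  filter_upwards [lt_mem_nhds hθ, gt_mem_nhds hθ1, hc.eventually_lt_const h0,
    hc.eventually_const_lt hlt, hc.eventually_const_lt h2] with v a1 a2 a3 a4 a5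
  exact ⟨a1, a2, ⟨a3, hTop, hlim, a4⟩, a5⟩

lemma IsCutoff.eventually_lt (h : M.IsCutoff θ τ₀) (hθ : M.μ < θ) (hθ1 : θ < 1) {t : ℝ}
    (ht : t < τ₀) : ∀ᶠ v in 𝓝 θ, ∀ τ, M.IsCutoff v τ → t < τ := by
  have h1 := (fakeRate_pos_iff hθ hθ1 t).1 (h.fakeRate_pos hθ hθ1 ht)
  filter_upwards [(continuousAt_phiP hθ1).tendsto.eventually_lt_const h1] with v hv τ hτ
  by_contra hn
  have := M.hazardExt_antitone (not_lt.1 hn)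
  rw [hτ.2] at this
  exact not_le.2 hv this

lemma IsCutoff.eventually_gt (h : M.IsCutoff θ τ₀) (hθ : M.μ < θ) (hθ1 : θ < 1) {t : ℝ}
    (ht : τ₀ < t) : ∀ᶠ v in 𝓝 θ, ∀ τ, M.IsCutoff v τ → τ < t := by
  have h1 := (fakeRate_neg_iff hθ hθ1 t).1 (h.fakeRate_neg hθ hθ1 ht)
  filter_upwards [(continuousAt_phiP hθ1).tendsto.eventually_const_lt h1] with v hv τ hτ
  by_contra hn
  have := M.hazardExt_antitone (not_lt.1 hn)
  rw [hτ.2] at this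
  exact not_le.2 hv this

lemma IsCutoff.tendsto (h : M.IsCutoff θ τ₀) (hθ : M.μ < θ) (hθ1 : θ < 1) {T : ℝ → ℝ}
    (hT : ∀ᶠ v in 𝓝 θ, M.IsCutoff v (T v)) : Tendsto T (𝓝 θ) (𝓝 τ₀) := by
  refine tendsto_order.2 ⟨fun t ht => ?_, fun t ht => ?_⟩
  · filter_upwards [hT, h.eventually_lt hθ hθ1 ht] with v h1 h2 using h2 _ h1
  · filter_upwards [hT, h.eventually_gt hθ hθ1 ht] with v h1 h2 using h2 _ h1

lemma Admissible.eventually_schedule (h : M.Admissible θ) (hσ : M.σ < M.sigmaBar θ) :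
    ∀ᶠ v in 𝓝 θ, M.σ < M.sigmaBar v ∧ ∃ x τ, M.IsSchedule v x τ := by
  have h1 : ∀ v, ∃ τ, M.Admissible v → M.IsCutoff v τ := fun v => by
    by_cases hv : M.Admissible v
    · exact hv.exists_cutoff.imp fun τ hτ _ => hτ
    · exact ⟨0, fun h => absurd h hv⟩
  choose T hT using h1
  have hc := h.eventually.mono fun v hv => hT v hv
  have h2 := tendsto_integral_fakeRate h.1 (tendsto_const_nhds (x := (0 : ℝ)))
    ((hT θ h).tendsto h.1 h.2.1 hc)
  filter_upwards [h.eventually,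
    h2.eventually_const_lt (((hT θ h).lt_sigmaBar_iff h.1 h.2.1).1 hσ)] with v hv hlt
  obtain ⟨x, hx⟩ := (hT v hv).exists_schedule hlt
  exact ⟨((hT v hv).lt_sigmaBar_iff hv.1 hv.2.1).2 hlt, x, T v, hx⟩

/-- Starting at a `y ≠ x₀` below the cutoff would give too much or too little faking. By continuity
this remains so for `v` near `θ`, and monotonicity in the start puts `X v` on the right side of `y`.
-/
lemma IsSchedule.tendsto_start (h : M.IsSchedule θ x₀ τ₀) (hθ : M.μ < θ) (hθ1 : θ < 1)
    {X T : ℝ → ℝ} (hXT : ∀ᶠ v in 𝓝 θ, M.IsSchedule v (X v) (T v)) :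
    Tendsto X (𝓝 θ) (𝓝 x₀) := by
  have hT := h.cutoff.tendsto hθ hθ1 (hXT.mono fun v hv => hv.cutoff)
  have hmono := h.cutoff.integral_fakeRate_strictAntiOn hθ hθ1
  have hlim : ∀ y, Tendsto (fun v => ∫ s in y..T v, M.fakeRate v s) (𝓝 θ)
      (𝓝 (∫ s in y..τ₀, M.fakeRate θ s)) := fun y =>
    tendsto_integral_fakeRate hθ tendsto_const_nhds hT
  refine tendsto_order.2 ⟨fun y hy => ?_, fun y' hy' => ?_⟩
  · have h1 : M.totalFake < ∫ s in y..τ₀, M.fakeRate θ s := by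
      rw [← h.integral_fakeRate]
      exact hmono (hy.trans h.start_lt).le h.start_lt.le hy
    filter_upwards [hXT, (hlim y).eventually_const_lt h1, lt_mem_nhds hθ, gt_mem_nhds hθ1,
      hT.eventually_const_lt (hy.trans h.start_lt)] with v hv h2 h3 h4 h5
    rw [← hv.integral_fakeRate] at h2
    exact ((hv.cutoff.integral_fakeRate_strictAntiOn h3 h4).lt_iff_gt hv.start_lt.le h5.le).1 h2
  -- The comparison point must also lie below `τ₀`, as the cumulated rate is monotone in the start
  -- only up to the cutoff.
  · obtain ⟨y, hy, hy2⟩ := exists_between (lt_min hy' h.start_lt)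
    have hyτ := hy2.trans_le (min_le_right _ _)
    have h1 : ∫ s in y..τ₀, M.fakeRate θ s < M.totalFake := by
      rw [← h.integral_fakeRate]
      exact hmono h.start_lt.le hyτ.le hy
    filter_upwards [hXT, (hlim y).eventually_lt_const h1, lt_mem_nhds hθ, gt_mem_nhds hθ1,
      hT.eventually_const_lt hyτ] with v hv h2 h3 h4 h5
    rw [← hv.integral_fakeRate] at h2
    exact (((hv.cutoff.integral_fakeRate_strictAntiOn h3 h4).lt_iff_gt h5.le hv.start_lt.le).1
      h2).trans_le (hy2.le.trans (min_le_left _ _))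

/-- The rate changes sign from positive to negative at `τ`, so ending there maximizes the cumulated
rate. In the envelope argument this replaces differentiability of the cutoff in `v`. -/
lemma IsCutoff.integral_fakeRate_le {v τ : ℝ} (h : M.IsCutoff v τ) (hv : M.μ < v) (hv1 : v < 1)
    (x t : ℝ) : ∫ s in x..t, M.fakeRate v s ≤ ∫ s in x..τ, M.fakeRate v s := by
  rw [← intervalIntegral.integral_add_adjacent_intervals (M.fakeRate_intervalIntegrable v x t)
    (M.fakeRate_intervalIntegrable v t τ), le_add_iff_nonneg_right]
  rcases le_total t τ with hle | hle
  · refine intervalIntegral.integral_nonneg hle fun s hs => ?_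
    rcases hs.2.lt_or_eq with h1 | h1
    · exact (h.fakeRate_pos hv hv1 h1).le
    · rw [h1, fakeRate, h.2, mul_phiP hv1, sub_self, zero_div]
  · rw [intervalIntegral.integral_symm, ← intervalIntegral.integral_neg]
    refine intervalIntegral.integral_nonneg hle fun s hs => ?_
    rcases hs.1.lt_or_eq with h1 | h1
    · exact (neg_pos.2 (h.fakeRate_neg hv hv1 h1)).le
    · rw [← h1, fakeRate, h.2, mul_phiP hv1, sub_self, zero_div, neg_zero]

lemma slope_inv_sub {v : ℝ} (hv : M.μ < v) (hθ : M.μ < θ) (hne : v ≠ θ) :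
    ((v - M.μ)⁻¹ - (θ - M.μ)⁻¹) / (v - θ) = -((v - M.μ)⁻¹ * (θ - M.μ)⁻¹) := by
  have h1 := (sub_pos.2 hv).ne'
  have h2 := (sub_pos.2 hθ).ne'
  have h3 := sub_ne_zero.2 hne
  field_simp
  ring

lemma tendsto_slope_inv_sub (hθ : M.μ < θ) :
    Tendsto (fun v => ((v - M.μ)⁻¹ - (θ - M.μ)⁻¹) / (v - θ)) (𝓝[≠] θ)
      (𝓝 (-((θ - M.μ)⁻¹ * (θ - M.μ)⁻¹))) := by
  have h1 : Tendsto (fun v : ℝ => (v - M.μ)⁻¹) (𝓝 θ) (𝓝 (θ - M.μ)⁻¹) :=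
    (tendsto_id.sub_const M.μ).inv₀ (sub_pos.2 hθ).ne'
  refine ((h1.mul_const (θ - M.μ)⁻¹).neg.mono_left nhdsWithin_le_nhds).congr' ?_
  filter_upwards [nhdsWithin_le_nhds (lt_mem_nhds hθ), self_mem_nhdsWithin] with v hv hne
  rw [slope_inv_sub hv hθ hne]

/-- An envelope formula for the start of faking. -/
lemma IsSchedule.tendsto_slope_start (h : M.IsSchedule θ x₀ τ₀) (hθ : M.μ < θ) (hθ1 : θ < 1)
    {X T : ℝ → ℝ} (hXT : ∀ᶠ v in 𝓝 θ, M.IsSchedule v (X v) (T v)) :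
    Tendsto (fun v => (∫ s in x₀..X v, M.fakeRate θ s) / (v - θ)) (𝓝[≠] θ)
      (𝓝 (-((θ - M.μ)⁻¹ * (θ - M.μ)⁻¹) * ∫ s in x₀..τ₀, M.newsExcess s)) := by
  have hT := h.cutoff.tendsto hθ hθ1 (hXT.mono fun v hv => hv.cutoff)
  have hX := h.tendsto_start hθ hθ1 hXT
  set q : ℝ → ℝ := fun v => (v - M.μ)⁻¹ - (θ - M.μ)⁻¹ with hq
  have hm := tendsto_slope_inv_sub hθ
  have hJ := (tendsto_intervalIntegral_of_continuous M.newsExcess_continuous hX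
    (tendsto_const_nhds (x := τ₀))).mono_left (nhdsWithin_le_nhds (s := {θ}ᶜ))
  have hE := (tendsto_intervalIntegral_of_continuous M.newsExcess_continuous
    (tendsto_const_nhds (x := τ₀)) hT).mono_left (nhdsWithin_le_nhds (s := {θ}ᶜ))
  rw [intervalIntegral.integral_same] at hE
  -- Optimality of `τ₀` for `θ` and of `T v` for `v` traps the increment between `q v` times the
  -- integrals of `newsExcess` from `X v` to `τ₀` and to `T v`. The difference is of smaller order
  -- than `v - θ`, since `T v` tends to `τ₀`.
  have hbound : ∀ᶠ v in 𝓝[≠] θ,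
      ‖(∫ s in x₀..X v, M.fakeRate θ s) / (v - θ)
          - q v / (v - θ) * ∫ s in X v..τ₀, M.newsExcess s‖
        ≤ ‖q v / (v - θ) * ∫ s in τ₀..T v, M.newsExcess s‖ := by
    filter_upwards [nhdsWithin_le_nhds (lt_mem_nhds hθ), nhdsWithin_le_nhds (gt_mem_nhds hθ1),
      nhdsWithin_le_nhds hXT] with v hv hv1 hs
    have e1 := intervalIntegral.integral_add_adjacent_intervals
      (M.fakeRate_intervalIntegrable θ x₀ (X v)) (M.fakeRate_intervalIntegrable θ (X v) τ₀)
    have e2 := intervalIntegral.integral_add_adjacent_intervals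
      (M.newsExcess_continuous.intervalIntegrable (μ := volume) (X v) τ₀)
      (M.newsExcess_continuous.intervalIntegrable τ₀ (T v))
    have e3 := integral_fakeRate_sub hv hθ (X v) τ₀
    have e4 := integral_fakeRate_sub hv hθ (X v) (T v)
    have e5 := hs.cutoff.integral_fakeRate_le hv hv1 (X v) τ₀
    have e6 := h.cutoff.integral_fakeRate_le hθ hθ1 (X v) (T v)
    have e7 := h.integral_fakeRate
    have e8 := hs.integral_fakeRate
    rw [← e2, mul_add] at e4
    rw [div_mul_eq_mul_div, div_mul_eq_mul_div, ← sub_div, norm_div, norm_div]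
    refine div_le_div_of_nonneg_right ?_ (norm_nonneg _)
    rw [Real.norm_of_nonneg (by simp only [hq]; linarith)]
    refine le_trans ?_ (Real.le_norm_self _)
    simp only [hq]
    linarith
  have h0 := squeeze_zero_norm' hbound (by simpa using (hm.mul hE).norm)
  have := h0.add (hm.mul hJ)
  rw [zero_add] at this
  refine this.congr fun v => ?_
  simp only [hq]
  ring

/-- The explicit factor in front of the second integral vanishes at `v = θ`. For the derivative
there, only the limit of that integral is needed. -/
lemma delegationPayoff_eq {v x τ : ℝ} (hv : M.μ < v) (hθ : M.μ < θ) :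
    M.delegationPayoff θ v x τ = θ + (θ - M.μ) * ((∫ s in (0 : ℝ)..x, M.discount s * M.fakeRate θ s)
      - ((v - M.μ)⁻¹ - (θ - M.μ)⁻¹) * ∫ s in x..τ, M.mixingWeight v x s * M.newsExcess s) := by
  rw [delegationPayoff, sub_eq_add_neg _ (((v - M.μ)⁻¹ - (θ - M.μ)⁻¹) * _), ← neg_mul,
    ← intervalIntegral.integral_const_mul]
  congr 3
  refine intervalIntegral.integral_congr fun s _ => ?_
  simp only [fakeRate_eq hv, fakeRate_eq hθ]
  ring

/-- The derivative of the principal's payoff with respect to the safe payoff of the player with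
the decision authority. -/
lemma IsSchedule.hasDerivAt_delegationPayoff (h : M.IsSchedule θ x₀ τ₀) (hθ : M.μ < θ)
    (hθ1 : θ < 1) {X T : ℝ → ℝ} (hXT : ∀ᶠ v in 𝓝 θ, M.IsSchedule v (X v) (T v)) :
    HasDerivAt (fun v => M.delegationPayoff θ v (X v) (T v))
      (-((θ - M.μ)⁻¹ * (M.discount x₀ * (∫ s in x₀..τ₀, M.newsExcess s)
        - ∫ s in x₀..τ₀, M.mixingWeight θ x₀ s * M.newsExcess s))) θ := by
  have hT := h.cutoff.tendsto hθ hθ1 (hXT.mono fun v hv => hv.cutoff)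
  have hX := h.tendsto_start hθ hθ1 hXT
  have hXθ : X θ = x₀ := by
    have h1 := hXT.self_of_nhds
    have h2 := h1.cutoff.unique h.cutoff
    rw [h2] at h1
    exact h1.start_unique h hθ hθ1
  have cA : Continuous fun s => M.discount s * M.fakeRate θ s :=
    M.discount_continuous.mul (M.fakeRate_continuous θ)
  have deriv_prim : ∀ (f : ℝ → ℝ) (a : ℝ), Continuous f →
      HasDerivAt (fun y => ∫ s in a..y, f s) (f x₀) x₀ := fun f a hf =>
    intervalIntegral.integral_hasDerivAt_right (hf.intervalIntegrable _ _)
      (hf.stronglyMeasurableAtFilter _ _) hf.continuousAt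
  have hf0 := h.cutoff.fakeRate_pos hθ hθ1 h.start_lt
  -- The start `X v` is not known to be differentiable. The increment of the gain up to the start is
  -- expressed by that of the cumulated `fakeRate θ`, whose slope the envelope formula gives; the
  -- factor tends to `discount x₀`.
  obtain ⟨C, hC, hAC⟩ := exists_tendsto_factor (deriv_prim _ 0 cA)
    (deriv_prim _ x₀ (M.fakeRate_continuous θ)) hf0.ne'
  rw [mul_div_cancel_right₀ _ hf0.ne'] at hC
  simp only [intervalIntegral.integral_same, sub_zero] at hAC
  have hslope := ((hC.comp hX).mono_left nhdsWithin_le_nhds).mul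
    (h.tendsto_slope_start hθ hθ1 hXT)
  have hΦ := (tendsto_slope_inv_sub hθ).mul
    ((tendsto_integral_mixingWeight hθ hX hT).mono_left nhdsWithin_le_nhds)
  rw [hasDerivAt_iff_tendsto_slope]
  have hlim := (hslope.sub hΦ).const_mul (θ - M.μ)
  have hd : (θ - M.μ) * (M.discount x₀ * (-((θ - M.μ)⁻¹ * (θ - M.μ)⁻¹)
        * ∫ s in x₀..τ₀, M.newsExcess s)
      - -((θ - M.μ)⁻¹ * (θ - M.μ)⁻¹) * ∫ s in x₀..τ₀, M.mixingWeight θ x₀ s * M.newsExcess s)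
      = -((θ - M.μ)⁻¹ * (M.discount x₀ * (∫ s in x₀..τ₀, M.newsExcess s)
        - ∫ s in x₀..τ₀, M.mixingWeight θ x₀ s * M.newsExcess s)) := by
    have := (sub_pos.2 hθ).ne'
    field_simp
    ring
  rw [hd] at hlim
  refine hlim.congr' ?_
  filter_upwards [nhdsWithin_le_nhds (lt_mem_nhds hθ), nhdsWithin_le_nhds (hX.eventually hAC)]
    with v hv hA
  rw [slope_def_field, delegationPayoff_eq hv hθ, delegationPayoff_eq hθ hθ, hXθ, sub_self,
    zero_mul, sub_zero]
  simp only [Function.comp_apply]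
  rw [eq_add_of_sub_eq hA]
  ring

lemma IsCutoff.newsExcess_pos (h : M.IsCutoff θ τ₀) (hθ : M.μ < θ) (hθ1 : θ < 1) {s : ℝ}
    (hs : s < τ₀) : 0 < M.newsExcess s := by
  have h1 := h.fakeRate_pos hθ hθ1 hs
  rw [fakeRate_eq hθ] at h1
  have h2 := mul_pos M.μ_pos (M.hazardExt_pos s)
  exact pos_of_mul_pos_right (by linarith [M.ρ_pos] : 0 < (θ - M.μ)⁻¹ * M.newsExcess s)
    (inv_pos.2 (sub_pos.2 hθ)).le

lemma mixingWeight_continuous (M : NewsGame) (v x : ℝ) : Continuous (M.mixingWeight v x) :=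
  (continuous_const.mul (continuous_exp_neg_primitive M.survivalRate_continuous x)).mul
    (continuous_exp_neg_primitive (M.fakeRate_continuous v) x)

/-- The weight equals the discount factor at the start of faking and then decays, because both the
survival rate and the fake rate are positive before the cutoff. This is why later fakes hurt less
than a later start helps. -/
lemma IsSchedule.mixingWeight_lt (h : M.IsSchedule θ x₀ τ₀) (hθ : M.μ < θ) (hθ1 : θ < 1)
    (hA : M.AssumptionA2 θ) {s : ℝ} (hs : s ∈ Ioo x₀ τ₀) :
    M.mixingWeight θ x₀ s < M.discount x₀ := by
  have h1 : 0 < ∫ r in x₀..s, M.survivalRate r := by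
    refine intervalIntegral.intervalIntegral_pos_of_pos_on
      (M.survivalRate_continuous.intervalIntegrable _ _) (fun r hr => ?_) hs.1
    have e1 := h.cutoff.stopRate_pos (hθ.trans hθ1) hA (hr.2.trans hs.2).le
    rw [stopRate] at e1
    linarith [M.ρ_pos, M.hazardExt_pos r]
  have h2 : 0 < ∫ r in x₀..s, M.fakeRate θ r :=
    intervalIntegral.intervalIntegral_pos_of_pos_on (M.fakeRate_intervalIntegrable θ _ _)
      (fun r hr => h.cutoff.fakeRate_pos hθ hθ1 (hr.2.trans hs.2)) hs.1
  rw [mixingWeight, mul_assoc, ← Real.exp_add]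
  exact mul_lt_of_lt_one_right (M.discount_pos x₀) (Real.exp_lt_one_iff.2 (by linarith))

lemma IsSchedule.integral_mixingWeight_lt (h : M.IsSchedule θ x₀ τ₀) (hθ : M.μ < θ) (hθ1 : θ < 1)
    (hA : M.AssumptionA2 θ) : ∫ s in x₀..τ₀, M.mixingWeight θ x₀ s * M.newsExcess s
      < M.discount x₀ * ∫ s in x₀..τ₀, M.newsExcess s := by
  have c1 : Continuous fun s => M.mixingWeight θ x₀ s * M.newsExcess s :=
    (M.mixingWeight_continuous θ x₀).mul M.newsExcess_continuous
  have c2 : Continuous fun s => M.discount x₀ * M.newsExcess s :=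
    continuous_const.mul M.newsExcess_continuous
  rw [← intervalIntegral.integral_const_mul, ← sub_pos, ← intervalIntegral.integral_sub
    (c2.intervalIntegrable _ _) (c1.intervalIntegrable _ _)]
  refine intervalIntegral.intervalIntegral_pos_of_pos_on
    ((c2.sub c1).intervalIntegrable _ _) (fun s hs => ?_) h.start_lt
  rw [← sub_mul]
  exact mul_pos (sub_pos.2 (h.mixingWeight_lt hθ hθ1 hA hs))
    (h.cutoff.newsExcess_pos hθ hθ1 hs.2)

/-- With an intermediary whose safe payoff is close to `θ`, fake news is so rare that a principal
with safe payoff `θ` strictly prefers the risky action after type-1 news. -/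
lemma eventually_fakeRate_lt (hθ : M.μ < θ) : ∀ᶠ v in 𝓝 θ, ∀ t, 0 ≤ t →
    (θ - M.μ) * M.fakeRate v t < M.μ * (1 - θ) * M.hazardExt t := by
  -- `K` bounds `newsExcess` at all nonnegative times, as the hazard rate is largest at `0`. So the
  -- change of the fake rate is uniformly small in time and fits into the slack `ρ * θ`.
  set K := M.μ * (|1 - M.μ| * M.hazardExt 0 + M.ρ) with hK
  have h1 : Tendsto (fun v : ℝ => (θ - M.μ) * |(v - M.μ)⁻¹ - (θ - M.μ)⁻¹| * K) (𝓝 θ) (𝓝 0) := by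
    have h2 : Tendsto (fun v : ℝ => (v - M.μ)⁻¹) (𝓝 θ) (𝓝 (θ - M.μ)⁻¹) :=
      (tendsto_id.sub_const M.μ).inv₀ (sub_pos.2 hθ).ne'
    simpa using (((h2.sub_const (θ - M.μ)⁻¹).abs).const_mul (θ - M.μ)).mul_const K
  have h3 : 0 < M.ρ * θ := mul_pos M.ρ_pos (M.μ_pos.trans hθ)
  filter_upwards [h1.eventually_lt_const h3, lt_mem_nhds hθ] with v hv hμv t ht
  have e1 := sub_mul_fakeRate hθ (M := M) t
  have e2 : M.fakeRate v t = M.fakeRate θ t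
      + ((v - M.μ)⁻¹ - (θ - M.μ)⁻¹) * M.newsExcess t := by
    rw [fakeRate_eq hμv, fakeRate_eq hθ]; ring
  have e3 : |M.newsExcess t| ≤ K := by
    rw [newsExcess, abs_mul, abs_of_pos M.μ_pos, hK]
    refine mul_le_mul_of_nonneg_left ((abs_sub _ _).trans ?_) M.μ_pos.le
    rw [abs_mul, abs_of_pos (M.hazardExt_pos t), abs_of_pos M.ρ_pos]
    gcongr
    exact M.hazardExt_antitone ht
  have e4 : ((v - M.μ)⁻¹ - (θ - M.μ)⁻¹) * M.newsExcess t
      ≤ |(v - M.μ)⁻¹ - (θ - M.μ)⁻¹| * K :=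
    (le_abs_self _).trans (by rw [abs_mul]; gcongr)
  have e5 := mul_le_mul_of_nonneg_left e4 (sub_pos.2 hθ).le
  rw [e2, mul_add, e1]
  linarith

lemma IsBeneficialEquilibrium.isSearchEquilibrium {v τ : ℝ} {e : Profile}
    (he : M.IsBeneficialEquilibrium v e) (hv : M.Admissible v) (hτ : M.IsCutoff v τ) :
    M.IsSearchEquilibrium v τ e :=
  ⟨he.1, he.2, hτ, hv.1, hv.2.1, hv.2.2.2⟩

lemma IsSchedule.payoff_eq {v x τ : ℝ} {e : Profile} (h : M.IsSchedule v x τ)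
    (hv : M.Admissible v) (hθ : M.μ < θ) (he : M.IsBeneficialEquilibrium v e) :
    M.payoff θ e = M.delegationPayoff θ v x τ := by
  obtain ⟨x', hx', hp⟩ := (he.isSearchEquilibrium hv h.cutoff).payoff_eq hθ
  rw [hp, hx'.start_unique h hv.1 hv.2.1]

end NewsGame

end

/-! ### The proposition. -/

theorem proposition6 (M : NewsGame) (θ : ℝ) (hθ : M.Admissible θ) (hσ : M.σ < M.sigmaBar θ) :
    -- the principal's payoff from delegation is a well-defined function of the intermediary's
    -- safe payoff near `θ`, and its derivative at `θ` is negative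
    (∃ (U : ℝ → ℝ) (d : ℝ),
      (∀ᶠ θI in 𝓝 θ, (∃ e, M.IsBeneficialEquilibrium θI e) ∧
        ∀ e, M.IsBeneficialEquilibrium θI e → M.payoff θ e = U θI) ∧
      HasDerivAt U d θ ∧ d < 0) ∧
    -- delegation to any intermediary with a slightly smaller safe payoff
    ∃ θs < θ, ∀ θI ∈ Set.Ioo θs θ,
      -- the intermediary satisfies the same assumptions as the principal, and an equilibrium with
      -- beneficial search exists in which the principal is not tempted to overrule at any time
      M.Admissible θI ∧ M.σ < M.sigmaBar θI ∧
      (∃ eI, M.IsBeneficialEquilibrium θI eI ∧ ∀ t, 0 ≤ t → M.NoOverrule θ eI t) ∧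
      ∀ eI, M.IsBeneficialEquilibrium θI eI →
        -- the principal strictly gains over every equilibrium of the game without delegation
        (∀ e, M.IsEquilibrium θ e → M.payoff θ e < M.payoff θ eI) ∧
        -- and is never tempted to overrule (posteriors given densities are determined only up
        -- to Lebesgue-null sets of times, atoms apart)
        (∀ᵐ t ∂MeasureTheory.volume, 0 ≤ t → M.NoOverrule θ eI t) ∧
        (∀ t, 0 ≤ t → 0 < eI.FA.atom t → M.NoOverrule θ eI t) := by
  have hnear := hθ.eventually.and (hθ.eventually_schedule hσ)
  have hex : ∀ v, ∃ x τ, (∃ x τ, M.IsSchedule v x τ) → M.IsSchedule v x τ := fun v => by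
    by_cases h : ∃ x τ, M.IsSchedule v x τ
    · obtain ⟨x, τ, hx⟩ := h
      exact ⟨x, τ, fun _ => hx⟩
    -- A default value for safe payoffs without a schedule, which do not occur near `θ`.
    · exact ⟨0, 0, fun h' => absurd h' h⟩
  choose X T hXT using hex
  have hsched : ∀ᶠ v in 𝓝 θ, M.IsSchedule v (X v) (T v) := hnear.mono fun v hv => hXT v hv.2.2
  have h0 := hsched.self_of_nhds
  have hderiv := h0.hasDerivAt_delegationPayoff hθ.1 hθ.2.1 hsched
  have hneg : -((θ - M.μ)⁻¹ * (M.discount (X θ) * (∫ s in X θ..T θ, M.newsExcess s)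
      - ∫ s in X θ..T θ, M.mixingWeight θ (X θ) s * M.newsExcess s)) < 0 :=
    neg_lt_zero.2 (mul_pos (inv_pos.2 (sub_pos.2 hθ.1))
      (sub_pos.2 (h0.integral_mixingWeight_lt hθ.1 hθ.2.1 hθ.2.2.2)))
  refine ⟨⟨fun v => M.delegationPayoff θ v (X v) (T v), _, ?_, hderiv, hneg⟩, ?_⟩
  · filter_upwards [hnear, hsched] with v hv hs
    exact ⟨⟨_, hs.isBeneficialEquilibrium_profile hv.1.1 hv.1.2.1 hv.1.2.2.2⟩,
      fun e he => hs.payoff_eq hv.1 hθ.1 he⟩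
  have hgain : ∀ᶠ v in 𝓝[<] θ,
      M.delegationPayoff θ θ (X θ) (T θ) < M.delegationPayoff θ v (X v) (T v) := by
    have h1 := (hasDerivAt_iff_tendsto_slope.1 hderiv).mono_left
      (nhdsWithin_mono θ fun v (hv : v < θ) => hv.ne)
    filter_upwards [h1.eventually_lt_const hneg, self_mem_nhdsWithin] with v hv hlt
    rw [slope_def_field, div_neg_iff] at hv
    have h2 : v < θ := hlt
    rcases hv with hv | hv <;> linarith [hv.1, hv.2]
  obtain ⟨θs, hθs, hall⟩ := (mem_nhdsLT_iff_exists_Ioo_subset).1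
    (hgain.and (nhdsWithin_le_nhds
      ((hnear.and hsched).and (NewsGame.eventually_fakeRate_lt hθ.1))))
  refine ⟨θs, hθs, fun v hv => ?_⟩
  obtain ⟨hlt, ⟨⟨hadm, hσv, -⟩, hs⟩, hrate⟩ := hall hv
  -- Beneficial equilibria attain this value exactly. All others pay at most `θ`, which the
  -- constructed equilibrium exceeds.
  have hbase : ∀ e, M.IsEquilibrium θ e → M.payoff θ e ≤ M.delegationPayoff θ θ (X θ) (T θ) := by
    intro e he
    rcases lt_or_ge θ (M.payoff θ e) with h | h
    · exact (h0.payoff_eq hθ hθ.1 ⟨he, h⟩).le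
    · have h1 := h0.isBeneficialEquilibrium_profile hθ.1 hθ.2.1 hθ.2.2.2
      rw [← h0.payoff_eq hθ hθ.1 h1]
      exact h.trans h1.2.le
  refine ⟨hadm, hσv, ⟨_, hs.isBeneficialEquilibrium_profile hadm.1 hadm.2.1 hadm.2.2.2,
    fun t ht => hs.profile_noOverrule hadm.1 hadm.2.1 hadm.2.2.2 hv.2.le hθ.2.1
      (fun t ht _ => hrate t ht) ht⟩, fun eI heI => ?_⟩
  have S := heI.isSearchEquilibrium hadm hs.cutoff
  refine ⟨fun e he => ?_, S.ae_noOverrule hv.2.le hθ.2.1 fun t ht _ => hrate t ht,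
    -- The faking time has no atoms in an equilibrium with beneficial search, since an atom would be
    -- met with distrust before `τ`, and from `τ` on the agent does not fake.
    fun t _ ha => absurd (S.atom_FA t) ha.ne'⟩
  rw [hs.payoff_eq hadm hθ.1 heI]
  exact (hbase e he).trans_lt hlt
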